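/- **Conventions.** Let $\mathcal B$ be a braided monoidal category with tensor unit $\mathbf 1$ and braiding $c_{x,y}:x\otimes y\to y\otimes x$ (associators and unitors are suppressed below). *Enriched categories.* A category $\mathcal C$ enriched over $\mathcal B$ has objects, hom objects $\mathcal C(x,y)\in\mathcal B$, identities $\mathbf 1\to\mathcal C(x,x)$ and a unital associative composition $\mathcal C(y,z)\otimes\mathcal C(x,y)\to\mathcal C(x,z)$. Its underlying category has the morphisms $\mathbf 1\to\mathcal C(x,y)$ as morphisms $x\to y$. An enriched functor $F:\mathcal C\to\mathcal D$ consists of a map on objects and morphisms $\mathcal C(x,y)\to\mathcal D(Fx,Fy)$ compatible with identities and composition. An enriched natural transformation $\xi:F\to G$ is a family of morphisms $\xi_x:Fx\to Gx$ of the underlying category such that $\xi_y\circ F=G\circ\xi_x$ as morphisms $\mathcal C(x,y)\to\mathcal D(Fx,Gy)$ for all $x,y$. The product $\mathcal C\times\mathcal D$ has hom objects $\mathcal C(x,x')\otimes\mathcal D(y,y')$ and the composition $$\mathcal C(x',x'')\otimes\mathcal D(y',y'')\otimes\mathcal C(x,x')\otimes\mathcal D(y,y')\xrightarrow{1\otimes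 c^{-1}_{\mathcal C(x,x'),\mathcal D(y',y'')}\otimes1}\mathcal C(x',x'')\otimes\mathcal C(x,x')\otimes\mathcal D(y',y'')\otimes\mathcal D(y,y')\to\mathcal C(x,x'')\otimes\mathcal D(y,y'').$$ *Enriched (braided) monoidal categories.* An enriched monoidal category is an enriched category $\mathcal C$ with a unit object, an enriched functor $\otimes:\mathcal C\times\mathcal C\to\mathcal C$, and enriched natural unit and associativity isomorphisms satisfying the triangle and pentagon axioms in the underlying category. For $F:\mathcal C\times\mathcal D\to\mathcal E$ let $F^{rev}$ be given by $F^{rev}(y,x)=F(x,y)$ and $\mathcal D(y,y')\otimes\mathcal C(x,x')\xrightarrow{c}\mathcal C(x,x')\otimes\mathcal D(y,y')\to\mathcal E(F(x,y),F(x',y'))$. A braiding on $\mathcal C$ requires that $\otimes^{rev}$ be an enriched functor, and is then an enriched natural isomorphism $\otimes\to\otimes^{rev}$ satisfying the hexagon axioms in the underlying category. An enriched braided monoidal functor is an enriched functor whose underlying functor is equipped with a braided (strong) monoidal structure with enriched natural $Fx\otimes Fy\cong F(x\otimes y)$. An equivalence of enriched braided monoidal categories consists of enriched braided monoidal functors in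 both directions whose composites are isomorphic to the identity functors through enriched monoidal natural isomorphisms. *Drinfeld center.* Assume that $\mathcal B$ has equalizers and intersections of arbitrary families of subobjects of an object. The Drinfeld center $Z(\mathcal C)$ of an enriched monoidal category $\mathcal C$ is the following enriched braided monoidal category. An object is an object $x\in\mathcal C$ with a half-braiding $b_{x,-}$, i.e. an enriched natural isomorphism $x\otimes-\to-\otimes x$ that is a half-braiding in the underlying monoidal category. The hom object $Z(\mathcal C)(x,y)$ is the intersection over all $z\in\mathcal C$ of the equalizers of the two morphisms $\mathcal C(x,y)\to\mathcal C(x\otimes z,z\otimes y)$ given by $(z\otimes-)\circ b_{x,z}$ and $b_{y,z}\circ(-\otimes z)$. Identities, composition, tensor product, unitors and associator are induced from $\mathcal C$ (with the usual half-braidings on $x\otimes y$ and on the unit), and the braiding is $b_{x,y}$. *Self-enrichment.* Let $\mathcal B$ be rigid, with duals $u_x:\mathbf 1\to x\otimes x^*$, $v_x:x^*\otimes x\to\mathbf 1$. The canonical self-enrichment $\mathcal B^\sharp$ is the enriched monoidal category with the objects of $\mathcal B$, hom objects $\mathcal B^\sharp(x,y)=y\otimes x^*$, identities $u_x$, composition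 $1\otimes v_y\otimes 1: z\otimes y^*\otimes y\otimes x^*\to z\otimes x^*$, tensor product on objects as in $\mathcal B$ and on hom objects $$x'\otimes x^*\otimes y'\otimes y^*\xrightarrow{1\otimes c_{x^*,\,y'\otimes y^*}}x'\otimes y'\otimes y^*\otimes x^*\cong(x'\otimes y')\otimes(x\otimes y)^*,$$ and the unit object, unitors and associator of $\mathcal B$. *Braided fusion categories.* A fusion category is a rigid semisimple $\mathbb C$-linear abelian monoidal category, with bilinear tensor product, finitely many simple objects up to isomorphism, finite-dimensional hom spaces and simple tensor unit. A braided fusion category $\mathcal B$ is nondegenerate if $\mathbf 1$ is, up to isomorphism, the only simple object $x$ with $c_{y,x}\circ c_{x,y}=1_{x\otimes y}$ for all $y\in\mathcal B$. Writing $V\mathbf 1$ for the direct sum of $\dim V$ copies of $\mathbf 1$ attached functorially to a finite-dimensional vector space $V$, a braided fusion category $\mathcal B$ is itself viewed as a braided monoidal category enriched over $\mathcal B$, with the objects of $\mathcal B$, hom objects $\operatorname{Hom}_{\mathcal B}(x,y)\mathbf 1$, and with identities, composition, tensor product, unitors, associator and braiding induced from those of $\mathcal B$. **Corollary.** Let $\mathcal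 B$ be a nondegenerate braided fusion category. Then there is an equivalence $Z(\mathcal B^\sharp)\simeq\mathcal B$ of braided monoidal categories enriched over $\mathcal B$, where the right-hand side is $\mathcal B$ viewed as enriched over itself through $\operatorname{Hom}_{\mathcal B}(x,y)\mathbf 1$. -/

import Mathlib

set_option linter.unusedSectionVars false

open CategoryTheory MonoidalCategory BraidedCategory Limits

universe w w₁ w₂ w₃ w₄ v u

noncomputable section

namespace EnrichedCenter

attribute [-instance] CategoryTheory.catToReflQuiver

/-! ## Categories enriched over a monoidal category

The composition law is written in the order `Hom y z ⊗ Hom x y ⟶ Hom x z`. Mathlib's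
`EnrichedCategory` uses the opposite order; over a braided base that is not symmetric the order
matters for products and tensor products. -/

/-- A category enriched over the monoidal category `B`. -/
structure ECat (B : Type u) [Category.{v} B] [MonoidalCategory B] where
  Obj : Type w
  Hom : Obj → Obj → B
  id : ∀ x, 𝟙_ B ⟶ Hom x x
  comp : ∀ x y z, Hom y z ⊗ Hom x y ⟶ Hom x z
  comp_id : ∀ x y, (ρ_ (Hom x y)).inv ≫ Hom x y ◁ id x ≫ comp x x y = 𝟙 _
  id_comp : ∀ x y, (λ_ (Hom x y)).inv ≫ id y ▷ Hom x y ≫ comp x y y = 𝟙 _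
  assoc : ∀ x y z t, comp y z t ▷ Hom x y ≫ comp x y t =
    (α_ _ _ _).hom ≫ Hom z t ◁ comp x y z ≫ comp x z t

section Basic

variable {B : Type u} [Category.{v} B] [MonoidalCategory B]

namespace ECat

/-- Morphisms `x ⟶ y` of the underlying category: morphisms `𝟙 ⟶ Hom x y` of `B`. -/
@[ext]
structure UHom (C : ECat.{w} B) (x y : C.Obj) where
  hom : 𝟙_ B ⟶ C.Hom x y

variable (C : ECat.{w} B)

/-- Postcomposition `g ∘ -` with a morphism `g` of the underlying category. -/
def post (x : C.Obj) {y z : C.Obj} (g : C.UHom y z) : C.Hom x y ⟶ C.Hom x z :=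
  (λ_ _).inv ≫ g.hom ▷ _ ≫ C.comp x y z

/-- Precomposition `- ∘ f` with a morphism `f` of the underlying category. -/
def pre {x y : C.Obj} (f : C.UHom x y) (z : C.Obj) : C.Hom y z ⟶ C.Hom x z :=
  (ρ_ _).inv ≫ _ ◁ f.hom ≫ C.comp x y z

theorem hom_post {x y z : C.Obj} (f : C.UHom x y) (g : C.UHom y z) :
    f.hom ≫ C.post x g = (λ_ (𝟙_ B)).inv ≫ (g.hom ⊗ₘ f.hom) ≫ C.comp x y z := by
  simp only [post, leftUnitor_inv_naturality_assoc, tensorHom_def', Category.assoc]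

theorem hom_pre {x y z : C.Obj} (f : C.UHom x y) (g : C.UHom y z) :
    g.hom ≫ C.pre f z = (λ_ (𝟙_ B)).inv ≫ (g.hom ⊗ₘ f.hom) ≫ C.comp x y z := by
  simp only [pre, rightUnitor_inv_naturality_assoc, MonoidalCategory.tensorHom_def, Category.assoc, unitors_inv_equal]

theorem post_comp {x y z t : C.Obj} (h : C.UHom z t) :
    C.post y h ▷ C.Hom x y ≫ C.comp x y t = C.comp x y z ≫ C.post x h := by
  simp only [post, comp_whiskerRight, Category.assoc, C.assoc, leftUnitor_inv_naturality_assoc]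
  rw [whisker_exchange_assoc]
  simp

theorem pre_comp {x y z t : C.Obj} (f : C.UHom x y) :
    C.Hom z t ◁ C.pre f z ≫ C.comp x z t = C.comp y z t ≫ C.pre f t := by
  simp only [pre, MonoidalCategory.whiskerLeft_comp, Category.assoc, rightUnitor_inv_naturality_assoc]
  rw [← whisker_exchange_assoc, C.assoc]
  simp

theorem pre_post {x y z t : C.Obj} (f : C.UHom y z) :
    C.pre f t ▷ C.Hom x y ≫ C.comp x y t = C.Hom z t ◁ C.post x f ≫ C.comp x z t := by
  simp only [pre, post, comp_whiskerRight, MonoidalCategory.whiskerLeft_comp, Category.assoc, C.assoc]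
  simp

/-- The underlying category of an enriched category. -/
instance instCategoryObj : Category.{v} C.Obj where
  Hom x y := C.UHom x y
  id x := ⟨C.id x⟩
  comp {x y z} f g := ⟨(λ_ (𝟙_ B)).inv ≫ (g.hom ⊗ₘ f.hom) ≫ C.comp x y z⟩
  id_comp {x y} f := by
    ext
    dsimp
    rw [← hom_pre C ⟨C.id x⟩ f, pre, C.comp_id, Category.comp_id]
  comp_id {x y} f := by
    ext
    dsimp
    rw [← hom_post C f ⟨C.id y⟩, post, C.id_comp, Category.comp_id]
  assoc {x y z t} f g h := by
    ext
    dsimp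
    rw [← hom_post C ⟨_⟩ h]
    dsimp only
    simp only [Category.assoc]
    rw [← post_comp, ← hom_post C g h]
    simp only [← tensorHom_id, tensorHom_comp_tensorHom_assoc, Category.comp_id]

@[simp] theorem id_hom (x : C.Obj) : UHom.hom (𝟙 x) = C.id x := rfl

theorem comp_hom {x y z : C.Obj} (f : x ⟶ y) (g : y ⟶ z) :
    UHom.hom (f ≫ g) = (λ_ (𝟙_ B)).inv ≫ (UHom.hom g ⊗ₘ UHom.hom f) ≫ C.comp x y z := rfl

theorem comp_hom_post {x y z : C.Obj} (f : x ⟶ y) (g : y ⟶ z) :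
    UHom.hom (f ≫ g) = UHom.hom f ≫ C.post x g := (C.hom_post f g).symm

theorem comp_hom_pre {x y z : C.Obj} (f : x ⟶ y) (g : y ⟶ z) :
    UHom.hom (f ≫ g) = UHom.hom g ≫ C.pre f z := (C.hom_pre f g).symm

@[ext] theorem hom_ext {C : ECat.{w} B} {x y : C.Obj} (f g : x ⟶ y)
    (h : UHom.hom f = UHom.hom g) : f = g := UHom.ext h

theorem post_id (x y : C.Obj) : C.post x (𝟙 y) = 𝟙 _ := C.id_comp x y

theorem pre_id (x y : C.Obj) : C.pre (𝟙 x) y = 𝟙 _ := C.comp_id x y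

theorem post_post (x : C.Obj) {y z t : C.Obj} (f : y ⟶ z) (g : z ⟶ t) :
    C.post x f ≫ C.post x g = C.post x (f ≫ g) := by
  nth_rw 1 [post]
  simp only [Category.assoc, ← post_comp]
  nth_rw 2 [post]
  rw [ comp_hom_post, comp_whiskerRight, Category.assoc]

theorem pre_pre {x y z : C.Obj} (f : x ⟶ y) (g : y ⟶ z) (t : C.Obj) :
    C.pre g t ≫ C.pre f t = C.pre (f ≫ g) t := by
  nth_rw 1 [pre]
  simp only [Category.assoc, ← pre_comp]
  nth_rw 2 [pre]
  rw [comp_hom_pre, MonoidalCategory.whiskerLeft_comp, Category.assoc]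

theorem pre_post_comm {x y z t : C.Obj} (f : x ⟶ y) (g : z ⟶ t) :
    C.pre f z ≫ C.post x g = C.post y g ≫ C.pre f t := by
  rw [pre]
  simp only [Category.assoc, ← post_comp]
  rw [whisker_exchange_assoc, pre]
  simp

end ECat

theorem ECat.id_id_comp (C : ECat.{w₁} B) (x : C.Obj) :
    (λ_ (𝟙_ B)).inv ≫ (C.id x ⊗ₘ C.id x) ≫ C.comp x x x = C.id x :=
  congrArg ECat.UHom.hom (Category.id_comp (𝟙 x))

theorem pull_left {X X' X'' Y Z : B} (a : X ⟶ X') (b : X' ⟶ X'') (c : Y ⟶ Z) :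
    (a ≫ b ⊗ₘ c) = a ▷ Y ≫ (b ⊗ₘ c) := by
  rw [← tensorHom_id, tensorHom_comp_tensorHom, Category.id_comp]

theorem pull_right {X X' X'' Y Z : B} (a : X ⟶ X') (b : X' ⟶ X'') (c : Y ⟶ Z) :
    (c ⊗ₘ a ≫ b) = Y ◁ a ≫ (c ⊗ₘ b) := by
  rw [← id_tensorHom, tensorHom_comp_tensorHom, Category.id_comp]

theorem push_left {X X' X'' Y Z : B} (a : X ⟶ X') (b : X' ⟶ X'') (c : Y ⟶ Z) :
    (a ≫ b ⊗ₘ c) = (a ⊗ₘ c) ≫ b ▷ Z := by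
  rw [← tensorHom_id, tensorHom_comp_tensorHom, Category.comp_id]

theorem push_right {X X' X'' Y Z : B} (a : X ⟶ X') (b : X' ⟶ X'') (c : Y ⟶ Z) :
    (c ⊗ₘ a ≫ b) = (c ⊗ₘ a) ≫ Z ◁ b := by
  rw [← id_tensorHom, tensorHom_comp_tensorHom, Category.comp_id]

theorem unit_assoc {X Y Z : B} (f : 𝟙_ B ⟶ X) (g : 𝟙_ B ⟶ Y) (h : 𝟙_ B ⟶ Z) :
    ((λ_ (𝟙_ B)).inv ≫ ((λ_ (𝟙_ B)).inv ≫ (f ⊗ₘ g) ⊗ₘ h)) ≫ (α_ X Y Z).hom =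
      (λ_ (𝟙_ B)).inv ≫ (f ⊗ₘ ((λ_ (𝟙_ B)).inv ≫ (g ⊗ₘ h))) := by
  have e : ((λ_ (𝟙_ B)).inv ≫ (f ⊗ₘ g) ⊗ₘ h) =
      (λ_ (𝟙_ B)).inv ▷ 𝟙_ B ≫ ((f ⊗ₘ g) ⊗ₘ h) := pull_left _ _ _
  have e' : (f ⊗ₘ ((λ_ (𝟙_ B)).inv ≫ (g ⊗ₘ h))) =
      𝟙_ B ◁ (λ_ (𝟙_ B)).inv ≫ (f ⊗ₘ (g ⊗ₘ h)) := pull_right _ _ _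
  rw [e, e']
  simp only [Category.assoc]
  rw [MonoidalCategory.associator_naturality]
  simp only [← Category.assoc]
  congr 1
  monoidal

/-- An enriched functor. -/
structure EFunctor (C : ECat.{w₁} B) (D : ECat.{w₂} B) where
  obj : C.Obj → D.Obj
  map : ∀ x y, C.Hom x y ⟶ D.Hom (obj x) (obj y)
  map_id : ∀ x, C.id x ≫ map x x = D.id (obj x)
  map_comp : ∀ x y z, C.comp x y z ≫ map x z =
    (map y z ⊗ₘ map x y) ≫ D.comp (obj x) (obj y) (obj z)

namespace EFunctor

variable {C : ECat.{w₁} B} {D : ECat.{w₂} B} {E : ECat.{w₃} B}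

/-- The identity enriched functor. -/
abbrev id (C : ECat.{w₁} B) : EFunctor C C where
  obj x := x
  map _ _ := 𝟙 _
  map_id _ := by simp
  map_comp _ _ _ := by simp

/-- Composition of enriched functors: first `F`, then `G`. -/
abbrev comp (F : EFunctor C D) (G : EFunctor D E) : EFunctor C E where
  obj x := G.obj (F.obj x)
  map x y := F.map x y ≫ G.map _ _
  map_id x := by rw [← Category.assoc, F.map_id, G.map_id]
  map_comp x y z := by
    rw [← Category.assoc, F.map_comp, Category.assoc, G.map_comp, tensorHom_comp_tensorHom_assoc]

theorem map_post (F : EFunctor C D) (x : C.Obj) {y z : C.Obj} (g : C.UHom y z) :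
    C.post x g ≫ F.map x z = F.map x y ≫ D.post _ ⟨g.hom ≫ F.map y z⟩ := by
  simp only [ECat.post, Category.assoc, F.map_comp, leftUnitor_inv_naturality_assoc,
    MonoidalCategory.tensorHom_def, comp_whiskerRight]
  rw [whisker_exchange_assoc, whisker_exchange_assoc]

theorem map_pre (F : EFunctor C D) {x y : C.Obj} (f : C.UHom x y) (z : C.Obj) :
    C.pre f z ≫ F.map x z = F.map y z ≫ D.pre ⟨f.hom ≫ F.map x y⟩ _ := by
  simp only [ECat.pre, Category.assoc, F.map_comp, rightUnitor_inv_naturality_assoc,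
    MonoidalCategory.tensorHom_def', MonoidalCategory.whiskerLeft_comp]
  rw [← whisker_exchange_assoc, ← whisker_exchange_assoc]

/-- The functor between underlying categories induced by an enriched functor. -/
abbrev und (F : EFunctor C D) : C.Obj ⥤ D.Obj where
  obj := F.obj
  map {x y} f := ⟨ECat.UHom.hom f ≫ F.map x y⟩
  map_id x := ECat.hom_ext _ _ (F.map_id x)
  map_comp {x y z} f g := by
    apply ECat.hom_ext
    dsimp
    rw [ECat.comp_hom_post, ECat.comp_hom_post, Category.assoc, map_post, Category.assoc]

@[simp] theorem und_obj (F : EFunctor C D) (x : C.Obj) : F.und.obj x = F.obj x := rfl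

theorem und_map_hom (F : EFunctor C D) {x y : C.Obj} (f : x ⟶ y) :
    ECat.UHom.hom (F.und.map f) = ECat.UHom.hom f ≫ F.map x y := rfl

theorem map_post_und (F : EFunctor C D) (x : C.Obj) {y z : C.Obj} (g : y ⟶ z) :
    C.post x g ≫ F.map x z = F.map x y ≫ D.post _ (F.und.map g) := F.map_post x g

theorem map_pre_und (F : EFunctor C D) {x y : C.Obj} (f : x ⟶ y) (z : C.Obj) :
    C.pre f z ≫ F.map x z = F.map y z ≫ D.pre (F.und.map f) _ := F.map_pre f z

end EFunctor

/-- A family of morphisms `F x ⟶ G x` of the underlying category is an enriched natural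
transformation `F ⟶ G` if the squares comparing `F` and `G` on hom objects commute. -/
def IsENat {C : ECat.{w₁} B} {D : ECat.{w₂} B} (F G : EFunctor C D)
    (ξ : ∀ x, F.obj x ⟶ G.obj x) : Prop :=
  ∀ x y, F.map x y ≫ D.post _ (ξ y) = G.map x y ≫ D.pre (ξ x) _

theorem IsENat.naturality {C : ECat.{w₁} B} {D : ECat.{w₂} B} {F G : EFunctor C D}
    {ξ : ∀ x, F.obj x ⟶ G.obj x} (h : IsENat F G ξ) {x y : C.Obj} (f : x ⟶ y) :
    F.und.map f ≫ ξ y = ξ x ≫ G.und.map f := by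
  apply ECat.hom_ext
  rw [ECat.comp_hom_post, ECat.comp_hom_pre, EFunctor.und_map_hom, EFunctor.und_map_hom,
    Category.assoc, Category.assoc, h]

/-- An enriched natural isomorphism. -/
structure ENatIso {C : ECat.{w₁} B} {D : ECat.{w₂} B} (F G : EFunctor C D) where
  app : ∀ x, F.obj x ≅ G.obj x
  nat : IsENat F G (fun x => (app x).hom)

end Basic

section Braided

variable {B : Type u} [Category.{v} B] [MonoidalCategory B] [BraidedCategory B]

/-! ## Coherence of the interchange `1 ⊗ c⁻¹ ⊗ 1`

Mathlib's `tensorδ W Y X Z : (W ⊗ X) ⊗ (Y ⊗ Z) ⟶ (W ⊗ Y) ⊗ (X ⊗ Z)` is `1 ⊗ c⁻¹ ⊗ 1`, where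
`c⁻¹ : X ⊗ Y ⟶ Y ⊗ X` is the inverse of the braiding `c : Y ⊗ X ⟶ X ⊗ Y`. -/

theorem tensorδ_natural {W W' X X' Y Y' Z Z' : B} (f : W ⟶ W') (g : X ⟶ X') (h : Y ⟶ Y')
    (k : Z ⟶ Z') : ((f ⊗ₘ g) ⊗ₘ (h ⊗ₘ k)) ≫ tensorδ W' Y' X' Z' =
      tensorδ W Y X Z ≫ ((f ⊗ₘ h) ⊗ₘ (g ⊗ₘ k)) :=
  @tensorμ_natural B _ _ (reverseBraiding B) _ _ _ _ _ _ _ _ f g h k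

theorem tensorδ_left_unit (X Y : B) :
    (λ_ (X ⊗ Y)).inv ≫ (λ_ (𝟙_ B)).inv ▷ (X ⊗ Y) ≫ tensorδ (𝟙_ B) X (𝟙_ B) Y =
      ((λ_ X).inv ⊗ₘ (λ_ Y).inv) := by
  have h : (λ_ (X ⊗ Y)).hom = ((λ_ (𝟙_ B)).inv ▷ (X ⊗ Y)) ≫ tensorδ (𝟙_ B) X (𝟙_ B) Y ≫
      ((λ_ X).hom ⊗ₘ (λ_ Y).hom) := @tensor_left_unitality B _ _ (reverseBraiding B) X Y
  rw [Iso.inv_comp_eq, h]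
  simp

theorem tensorδ_right_unit (X Y : B) :
    (ρ_ (X ⊗ Y)).inv ≫ (X ⊗ Y) ◁ (λ_ (𝟙_ B)).inv ≫ tensorδ X (𝟙_ B) Y (𝟙_ B) =
      ((ρ_ X).inv ⊗ₘ (ρ_ Y).inv) := by
  have h : (ρ_ (X ⊗ Y)).hom = ((X ⊗ Y) ◁ (λ_ (𝟙_ B)).inv) ≫ tensorδ X (𝟙_ B) Y (𝟙_ B) ≫
      ((ρ_ X).hom ⊗ₘ (ρ_ Y).hom) := @tensor_right_unitality B _ _ (reverseBraiding B) X Y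
  rw [Iso.inv_comp_eq, h]
  simp

theorem tensorδ_assoc (X₁ X₂ Y₁ Y₂ Z₁ Z₂ : B) :
    tensorδ X₁ Y₁ X₂ Y₂ ▷ (Z₁ ⊗ Z₂) ≫ tensorδ (X₁ ⊗ Y₁) Z₁ (X₂ ⊗ Y₂) Z₂ ≫
        ((α_ X₁ Y₁ Z₁).hom ⊗ₘ (α_ X₂ Y₂ Z₂).hom) =
      (α_ (X₁ ⊗ X₂) (Y₁ ⊗ Y₂) (Z₁ ⊗ Z₂)).hom ≫
        (X₁ ⊗ X₂) ◁ tensorδ Y₁ Z₁ Y₂ Z₂ ≫ tensorδ X₁ (Y₁ ⊗ Z₁) X₂ (Y₂ ⊗ Z₂) :=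
  @tensor_associativity B _ _ (reverseBraiding B) X₁ X₂ Y₁ Y₂ Z₁ Z₂

theorem tensorδ_leftUnitor (X Y : B) :
    ((λ_ X).inv ⊗ₘ (λ_ Y).inv) ≫ tensorδ (𝟙_ B) (𝟙_ B) X Y =
      (λ_ (X ⊗ Y)).inv ≫ (λ_ (𝟙_ B)).inv ▷ (X ⊗ Y) := by
  have h : ((λ_ X).hom ⊗ₘ (λ_ Y).hom) = tensorδ (𝟙_ B) (𝟙_ B) X Y ≫
      ((λ_ (𝟙_ B)).hom ▷ (X ⊗ Y)) ≫ (λ_ (X ⊗ Y)).hom :=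
    @leftUnitor_monoidal B _ _ (reverseBraiding B) X Y
  rw [← cancel_mono ((λ_ (𝟙_ B)).hom ▷ (X ⊗ Y)), ← cancel_mono (λ_ (X ⊗ Y)).hom]
  simp only [Category.assoc]
  rw [← h]
  simp

theorem tensorδ_rightUnitor (X Y : B) :
    ((ρ_ X).inv ⊗ₘ (ρ_ Y).inv) ≫ tensorδ X Y (𝟙_ B) (𝟙_ B) =
      (ρ_ (X ⊗ Y)).inv ≫ (X ⊗ Y) ◁ (λ_ (𝟙_ B)).inv := by
  have h : ((ρ_ X).hom ⊗ₘ (ρ_ Y).hom) = tensorδ X Y (𝟙_ B) (𝟙_ B) ≫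
      ((X ⊗ Y) ◁ (λ_ (𝟙_ B)).hom) ≫ (ρ_ (X ⊗ Y)).hom :=
    @rightUnitor_monoidal B _ _ (reverseBraiding B) X Y
  rw [← cancel_mono ((X ⊗ Y) ◁ (λ_ (𝟙_ B)).hom), ← cancel_mono (ρ_ (X ⊗ Y)).hom]
  simp only [Category.assoc]
  rw [← h]
  simp

theorem tensorδ_associator (X₁ X₂ X₃ Y₁ Y₂ Y₃ : B) :
    tensorδ (X₁ ⊗ X₂) (Y₁ ⊗ Y₂) X₃ Y₃ ≫ tensorδ X₁ Y₁ X₂ Y₂ ▷ (X₃ ⊗ Y₃) ≫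
        (α_ (X₁ ⊗ Y₁) (X₂ ⊗ Y₂) (X₃ ⊗ Y₃)).hom =
      ((α_ X₁ X₂ X₃).hom ⊗ₘ (α_ Y₁ Y₂ Y₃).hom) ≫
        tensorδ X₁ Y₁ (X₂ ⊗ X₃) (Y₂ ⊗ Y₃) ≫ (X₁ ⊗ Y₁) ◁ tensorδ X₂ Y₂ X₃ Y₃ :=
  @associator_monoidal B _ _ (reverseBraiding B) X₁ X₂ X₃ Y₁ Y₂ Y₃

theorem tensorδ_natural_left {W W' X X' : B} (f : W ⟶ W') (g : X ⟶ X') (Y Z : B) :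
    (f ⊗ₘ g) ▷ (Y ⊗ Z) ≫ tensorδ W' Y X' Z = tensorδ W Y X Z ≫ (f ▷ Y ⊗ₘ g ▷ Z) :=
  @tensorμ_natural_left B _ _ (reverseBraiding B) _ _ _ _ f g Y Z

theorem tensorδ_natural_right (W X : B) {Y Y' Z Z' : B} (h : Y ⟶ Y') (k : Z ⟶ Z') :
    (W ⊗ X) ◁ (h ⊗ₘ k) ≫ tensorδ W Y' X Z' = tensorδ W Y X Z ≫ (W ◁ h ⊗ₘ X ◁ k) :=
  @tensorμ_natural_right B _ _ (reverseBraiding B) W X _ _ _ _ h k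

theorem tensorδ_post {X X' Y Y' P Q : B} (f : 𝟙_ B ⟶ X) (g : 𝟙_ B ⟶ Y) (m : X ⊗ X' ⟶ P)
    (n : Y ⊗ Y' ⟶ Q) :
    (λ_ (X' ⊗ Y')).inv ≫ ((λ_ (𝟙_ B)).inv ≫ (f ⊗ₘ g)) ▷ (X' ⊗ Y') ≫ tensorδ X X' Y Y' ≫ (m ⊗ₘ n) =
      ((λ_ X').inv ≫ f ▷ X' ≫ m) ⊗ₘ ((λ_ Y').inv ≫ g ▷ Y' ≫ n) := by
  rw [comp_whiskerRight, Category.assoc, reassoc_of% (tensorδ_natural_left f g X' Y'),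
    reassoc_of% (tensorδ_left_unit X' Y')]
  simp only [tensorHom_comp_tensorHom]

theorem tensorδ_pre {X X' Y Y' P Q : B} (f : 𝟙_ B ⟶ X') (g : 𝟙_ B ⟶ Y') (m : X ⊗ X' ⟶ P)
    (n : Y ⊗ Y' ⟶ Q) :
    (ρ_ (X ⊗ Y)).inv ≫ (X ⊗ Y) ◁ ((λ_ (𝟙_ B)).inv ≫ (f ⊗ₘ g)) ≫ tensorδ X X' Y Y' ≫ (m ⊗ₘ n) =
      ((ρ_ X).inv ≫ X ◁ f ≫ m) ⊗ₘ ((ρ_ Y).inv ≫ Y ◁ g ≫ n) := by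
  rw [MonoidalCategory.whiskerLeft_comp, Category.assoc,
    reassoc_of% (tensorδ_natural_right X Y f g), reassoc_of% (tensorδ_right_unit X Y)]
  simp only [tensorHom_comp_tensorHom]

theorem tensorδ_prodAssoc {X₁ X₂ X₃ Y₁ Y₂ Y₃ P Q R : B} (c : X₁ ⊗ Y₁ ⟶ P) (d : X₂ ⊗ Y₂ ⟶ Q)
    (e : X₃ ⊗ Y₃ ⟶ R) :
    (tensorδ (X₁ ⊗ X₂) (Y₁ ⊗ Y₂) X₃ Y₃ ≫ (tensorδ X₁ Y₁ X₂ Y₂ ≫ (c ⊗ₘ d) ⊗ₘ e)) ≫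
        (α_ P Q R).hom =
      ((α_ X₁ X₂ X₃).hom ⊗ₘ (α_ Y₁ Y₂ Y₃).hom) ≫ tensorδ X₁ Y₁ (X₂ ⊗ X₃) (Y₂ ⊗ Y₃) ≫
        (c ⊗ₘ (tensorδ X₂ Y₂ X₃ Y₃ ≫ (d ⊗ₘ e))) := by
  have h1 : (tensorδ X₁ Y₁ X₂ Y₂ ≫ (c ⊗ₘ d) ⊗ₘ e) =
      tensorδ X₁ Y₁ X₂ Y₂ ▷ (X₃ ⊗ Y₃) ≫ ((c ⊗ₘ d) ⊗ₘ e) := pull_left _ _ _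
  have h2 : (c ⊗ₘ (tensorδ X₂ Y₂ X₃ Y₃ ≫ (d ⊗ₘ e))) =
      (X₁ ⊗ Y₁) ◁ tensorδ X₂ Y₂ X₃ Y₃ ≫ (c ⊗ₘ (d ⊗ₘ e)) := pull_right _ _ _
  rw [h1, h2]
  simp only [Category.assoc]
  rw [MonoidalCategory.associator_naturality,
    reassoc_of% (tensorδ_associator X₁ X₂ X₃ Y₁ Y₂ Y₃)]

/-! ## Cartesian products of enriched categories -/

/-- Pairs of objects, the objects of a product of enriched categories. -/
structure PairObj (X : Type w₁) (Y : Type w₂) where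
  fst : X
  snd : Y

/-- The Cartesian product of enriched categories; its composition law uses the inverse braiding. -/
abbrev ECat.prod (C : ECat.{w₁} B) (D : ECat.{w₂} B) : ECat.{max w₁ w₂} B where
  Obj := PairObj C.Obj D.Obj
  Hom p q := C.Hom p.fst q.fst ⊗ D.Hom p.snd q.snd
  id p := (λ_ (𝟙_ B)).inv ≫ (C.id p.fst ⊗ₘ D.id p.snd)
  comp p q r :=
    tensorδ (C.Hom q.fst r.fst) (C.Hom p.fst q.fst) (D.Hom q.snd r.snd) (D.Hom p.snd q.snd) ≫
      (C.comp p.fst q.fst r.fst ⊗ₘ D.comp p.snd q.snd r.snd)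
  comp_id p q := by
    rw [tensorδ_pre, C.comp_id, D.comp_id, id_tensorHom_id]
  id_comp p q := by
    rw [tensorδ_post, C.id_comp, D.id_comp, id_tensorHom_id]
  assoc p q r s := by
    simp only [comp_whiskerRight, MonoidalCategory.whiskerLeft_comp, Category.assoc]
    rw [reassoc_of% (tensorδ_natural_left (C.comp q.fst r.fst s.fst) (D.comp q.snd r.snd s.snd)),
      reassoc_of% (tensorδ_natural_right (C.Hom r.fst s.fst) (D.Hom r.snd s.snd)),
      tensorHom_comp_tensorHom, tensorHom_comp_tensorHom, C.assoc, D.assoc,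
      ← tensorHom_comp_tensorHom, reassoc_of% (tensorδ_assoc (C.Hom r.fst s.fst))]

/-- The morphism `(x, y) ⟶ (x', y')` in the underlying category of a product given by a pair of
morphisms. -/
def ECat.pairHom {C : ECat.{w₁} B} {D : ECat.{w₂} B} {x x' : C.Obj} {y y' : D.Obj}
    (f : C.UHom x x') (g : D.UHom y y') : (C.prod D).UHom ⟨x, y⟩ ⟨x', y'⟩ where
  hom := (λ_ (𝟙_ B)).inv ≫ (f.hom ⊗ₘ g.hom)

theorem ECat.prod_id (C : ECat.{w₁} B) (D : ECat.{w₂} B) (x : C.Obj) (y : D.Obj) :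
    (C.prod D).id ⟨x, y⟩ = (λ_ (𝟙_ B)).inv ≫ (C.id x ⊗ₘ D.id y) := rfl

theorem ECat.prod_comp (C : ECat.{w₁} B) (D : ECat.{w₂} B) (x x' x'' : C.Obj) (y y' y'' : D.Obj) :
    (C.prod D).comp ⟨x, y⟩ ⟨x', y'⟩ ⟨x'', y''⟩ =
      tensorδ (C.Hom x' x'') (C.Hom x x') (D.Hom y' y'') (D.Hom y y') ≫
        (C.comp x x' x'' ⊗ₘ D.comp y y' y'') := rfl

theorem ECat.prod_post {C : ECat.{w₁} B} {D : ECat.{w₂} B} (p : (C.prod D).Obj) {x x' : C.Obj}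
    {y y' : D.Obj} (f : C.UHom x x') (g : D.UHom y y') :
    (C.prod D).post p (ECat.pairHom f g) = (C.post p.fst f ⊗ₘ D.post p.snd g) :=
  tensorδ_post f.hom g.hom _ _

theorem ECat.prod_pre {C : ECat.{w₁} B} {D : ECat.{w₂} B} (p : (C.prod D).Obj) {x x' : C.Obj}
    {y y' : D.Obj} (f : C.UHom x x') (g : D.UHom y y') :
    (C.prod D).pre (ECat.pairHom f g) p = (C.pre f p.fst ⊗ₘ D.pre g p.snd) :=
  tensorδ_pre f.hom g.hom _ _

namespace EFunctor

/-- The product of enriched functors. -/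
abbrev prod {C : ECat.{w₁} B} {D : ECat.{w₂} B} {C' : ECat.{w₃} B} {D' : ECat.{w₄} B}
    (F : EFunctor C D) (G : EFunctor C' D') : EFunctor (C.prod C') (D.prod D') where
  obj p := ⟨F.obj p.fst, G.obj p.snd⟩
  map p q := F.map p.fst q.fst ⊗ₘ G.map p.snd q.snd
  map_id p := by rw [Category.assoc, tensorHom_comp_tensorHom, F.map_id, G.map_id]
  map_comp p q r := by
    rw [Category.assoc, tensorHom_comp_tensorHom, F.map_comp, G.map_comp,
      reassoc_of% (tensorδ_natural (F.map q.fst r.fst) (G.map q.snd r.snd) (F.map p.fst q.fst)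
        (G.map p.snd q.snd)), tensorHom_comp_tensorHom]

/-- The functor `y ↦ (c, y)`. -/
abbrev insL {C : ECat.{w₁} B} (c : C.Obj) (D : ECat.{w₂} B) : EFunctor D (C.prod D) where
  obj y := ⟨c, y⟩
  map y y' := (λ_ _).inv ≫ C.id c ▷ D.Hom y y'
  map_id y := by
    rw [leftUnitor_inv_naturality_assoc, whisker_exchange, ECat.prod_id,
      MonoidalCategory.tensorHom_def]
  map_comp x y z := by
    rw [← tensorHom_comp_tensorHom, ← tensorHom_id, ← tensorHom_id, ← tensorHom_id,
      Category.assoc, ECat.prod_comp,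
      reassoc_of% (tensorδ_natural (C.id c) (𝟙 (D.Hom y z)) (C.id c) (𝟙 (D.Hom x y))),
      reassoc_of% (tensorδ_leftUnitor (D.Hom y z) (D.Hom x y)),
      tensorHom_comp_tensorHom, id_tensorHom_id, Category.id_comp, ← tensorHom_id,
      tensorHom_comp_tensorHom, Category.id_comp, C.id_id_comp, leftUnitor_inv_naturality_assoc,
      ← id_tensorHom, tensorHom_comp_tensorHom, Category.id_comp, Category.comp_id]

/-- The functor `x ↦ (x, d)`. -/
abbrev insR (C : ECat.{w₁} B) {D : ECat.{w₂} B} (d : D.Obj) : EFunctor C (C.prod D) where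
  obj x := ⟨x, d⟩
  map x x' := (ρ_ _).inv ≫ C.Hom x x' ◁ D.id d
  map_id y := by
    rw [rightUnitor_inv_naturality_assoc, ← whisker_exchange, ECat.prod_id,
      MonoidalCategory.tensorHom_def', unitors_inv_equal]
  map_comp x y z := by
    rw [← tensorHom_comp_tensorHom, ← id_tensorHom, ← id_tensorHom, ← id_tensorHom,
      Category.assoc, ECat.prod_comp,
      reassoc_of% (tensorδ_natural (𝟙 (C.Hom y z)) (D.id d) (𝟙 (C.Hom x y)) (D.id d)),
      reassoc_of% (tensorδ_rightUnitor (C.Hom y z) (C.Hom x y)),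
      tensorHom_comp_tensorHom, id_tensorHom_id, Category.id_comp, ← id_tensorHom,
      tensorHom_comp_tensorHom, Category.id_comp, D.id_id_comp, rightUnitor_inv_naturality_assoc,
      ← tensorHom_id, tensorHom_comp_tensorHom, Category.id_comp, Category.comp_id]

/-- The canonical functor `(C × D) × E ⟶ C × (D × E)`. -/
abbrev prodAssoc (C : ECat.{w₁} B) (D : ECat.{w₂} B) (E : ECat.{w₃} B) :
    EFunctor ((C.prod D).prod E) (C.prod (D.prod E)) where
  obj p := ⟨p.fst.fst, ⟨p.fst.snd, p.snd⟩⟩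
  map p q := (α_ _ _ _).hom
  map_id p := by
    exact unit_assoc (C.id p.fst.fst) (D.id p.fst.snd) (E.id p.snd)
  map_comp p q r := by
    exact tensorδ_prodAssoc (C.comp p.fst.fst q.fst.fst r.fst.fst)
      (D.comp p.fst.snd q.fst.snd r.fst.snd) (E.comp p.snd q.snd r.snd)

end EFunctor

end Braided

section Monoidal

variable {B : Type u} [Category.{v} B] [MonoidalCategory B] [BraidedCategory B]

namespace EFunctor

variable {C : ECat.{w₁} B} {D : ECat.{w₂} B} {E : ECat.{w₃} B}

/-- The action of an enriched functor of two variables on a pair of morphisms of the underlying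
categories. -/
def map₂ (T : EFunctor (C.prod D) E) {x x' : C.Obj} {y y' : D.Obj} (f : x ⟶ x') (g : y ⟶ y') :
    T.obj ⟨x, y⟩ ⟶ T.obj ⟨x', y'⟩ :=
  ⟨(ECat.pairHom f g).hom ≫ T.map ⟨x, y⟩ ⟨x', y'⟩⟩

theorem map₂_hom (T : EFunctor (C.prod D) E) {x x' : C.Obj} {y y' : D.Obj} (f : x ⟶ x')
    (g : y ⟶ y') : ECat.UHom.hom (T.map₂ f g) =
      (λ_ (𝟙_ B)).inv ≫ (ECat.UHom.hom f ⊗ₘ ECat.UHom.hom g) ≫ T.map ⟨x, y⟩ ⟨x', y'⟩ :=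
  Category.assoc _ _ _

theorem post_map₂ (T : EFunctor (C.prod D) E) (x : C.Obj) (y : D.Obj) {x' x'' : C.Obj}
    {y' y'' : D.Obj} (f : x' ⟶ x'') (g : y' ⟶ y'') :
    (C.post x f ⊗ₘ D.post y g) ≫ T.map ⟨x, y⟩ ⟨x'', y''⟩ =
      T.map ⟨x, y⟩ ⟨x', y'⟩ ≫ E.post _ (T.map₂ f g) := by
  exact (congrArg (· ≫ T.map ⟨x, y⟩ ⟨x'', y''⟩) (ECat.prod_post ⟨x, y⟩ f g)).symm.trans
    (T.map_post ⟨x, y⟩ (ECat.pairHom f g))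

theorem pre_map₂ (T : EFunctor (C.prod D) E) (x : C.Obj) (y : D.Obj) {x' x'' : C.Obj}
    {y' y'' : D.Obj} (f : x' ⟶ x'') (g : y' ⟶ y'') :
    (C.pre f x ⊗ₘ D.pre g y) ≫ T.map ⟨x', y'⟩ ⟨x, y⟩ =
      T.map ⟨x'', y''⟩ ⟨x, y⟩ ≫ E.pre (T.map₂ f g) _ := by
  exact (congrArg (· ≫ T.map ⟨x', y'⟩ ⟨x, y⟩) (ECat.prod_pre ⟨x, y⟩ f g)).symm.trans
    (T.map_pre (ECat.pairHom f g) ⟨x, y⟩)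

theorem map₂_id (T : EFunctor (C.prod D) E) (x : C.Obj) (y : D.Obj) :
    T.map₂ (𝟙 x) (𝟙 y) = 𝟙 (T.obj ⟨x, y⟩) :=
  ECat.hom_ext _ _ (T.map_id ⟨x, y⟩)

theorem map₂_comp (T : EFunctor (C.prod D) E) {x x' x'' : C.Obj} {y y' y'' : D.Obj}
    (f : x ⟶ x') (f' : x' ⟶ x'') (g : y ⟶ y') (g' : y' ⟶ y'') :
    T.map₂ (f ≫ f') (g ≫ g') = T.map₂ f g ≫ T.map₂ f' g' := by
  apply ECat.hom_ext
  rw [ECat.comp_hom_post, map₂_hom, map₂_hom, Category.assoc, Category.assoc, ← post_map₂,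
    ECat.comp_hom_post, ECat.comp_hom_post, tensorHom_comp_tensorHom_assoc]

end EFunctor

/-! ## Enriched monoidal categories -/

/-- A monoidal structure on an enriched category over the braided monoidal category `B`. The
triangle and pentagon axioms are those of the underlying category. -/
structure EMonStr (C : ECat.{w} B) where
  unit : C.Obj
  tensor : EFunctor (C.prod C) C
  leftUnitor : ENatIso ((EFunctor.insL unit C).comp tensor) (EFunctor.id C)
  rightUnitor : ENatIso ((EFunctor.insR C unit).comp tensor) (EFunctor.id C)
  associator : ENatIso ((tensor.prod (EFunctor.id C)).comp tensor)
    ((EFunctor.prodAssoc C C C).comp (((EFunctor.id C).prod tensor).comp tensor))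
  triangle : ∀ x y : C.Obj,
    (associator.app ⟨⟨x, unit⟩, y⟩).hom ≫ tensor.map₂ (𝟙 x) (leftUnitor.app y).hom =
      tensor.map₂ (rightUnitor.app x).hom (𝟙 y)
  pentagon : ∀ x y z t : C.Obj,
    tensor.map₂ (associator.app ⟨⟨x, y⟩, z⟩).hom (𝟙 t) ≫
        (associator.app ⟨⟨x, tensor.obj ⟨y, z⟩⟩, t⟩).hom ≫
          tensor.map₂ (𝟙 x) (associator.app ⟨⟨y, z⟩, t⟩).hom =
      (associator.app ⟨⟨tensor.obj ⟨x, y⟩, z⟩, t⟩).hom ≫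
        (associator.app ⟨⟨x, y⟩, tensor.obj ⟨z, t⟩⟩).hom

/-- A monoidal category enriched over the braided monoidal category `B`. -/
structure EMonCat (B : Type u) [Category.{v} B] [MonoidalCategory B] [BraidedCategory B] extends
    toECat : ECat.{w} B, EMonStr toECat

namespace EMonCat

variable (M : EMonCat.{w} B)

instance instMonoidalCategoryStructObj : MonoidalCategoryStruct M.Obj where
  tensorObj x y := M.tensor.obj ⟨x, y⟩
  whiskerLeft x _ _ f := M.tensor.map₂ (𝟙 x) f
  whiskerRight f y := M.tensor.map₂ f (𝟙 y)
  tensorHom f g := M.tensor.map₂ f g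
  tensorUnit := M.unit
  associator x y z := M.associator.app ⟨⟨x, y⟩, z⟩
  leftUnitor x := M.leftUnitor.app x
  rightUnitor x := M.rightUnitor.app x

/-- The tensor product on hom objects. -/
def ten (x x' y y' : M.Obj) : M.Hom x x' ⊗ M.Hom y y' ⟶ M.Hom (x ⊗ y) (x' ⊗ y') :=
  M.tensor.map ⟨x, y⟩ ⟨x', y'⟩

/-- The action of `z ⊗ -` on hom objects. -/
def lw (z x y : M.Obj) : M.Hom x y ⟶ M.Hom (z ⊗ x) (z ⊗ y) :=
  ((EFunctor.insL z M.toECat).comp M.tensor).map x y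

/-- The action of `- ⊗ z` on hom objects. -/
def rw (z x y : M.Obj) : M.Hom x y ⟶ M.Hom (x ⊗ z) (y ⊗ z) :=
  ((EFunctor.insR M.toECat z).comp M.tensor).map x y

theorem tensorHom_hom {x x' y y' : M.Obj} (f : x ⟶ x') (g : y ⟶ y') :
    ECat.UHom.hom (f ⊗ₘ g) =
      (λ_ (𝟙_ B)).inv ≫ (ECat.UHom.hom f ⊗ₘ ECat.UHom.hom g) ≫ M.ten x x' y y' :=
  M.tensor.map₂_hom f g

theorem ten_post {x x' x'' y y' y'' : M.Obj} (f : x' ⟶ x'') (g : y' ⟶ y'') :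
    (M.post x f ⊗ₘ M.post y g) ≫ M.ten x x'' y y'' = M.ten x x' y y' ≫ M.post _ (f ⊗ₘ g) :=
  M.tensor.post_map₂ x y f g

theorem ten_pre {x x' x'' y y' y'' : M.Obj} (f : x ⟶ x') (g : y ⟶ y') :
    (M.pre f x'' ⊗ₘ M.pre g y'') ≫ M.ten x x'' y y'' = M.ten x' x'' y' y'' ≫ M.pre (f ⊗ₘ g) _ :=
  M.tensor.pre_map₂ x'' y'' f g

theorem associator_nat (x x' y y' z z' : M.Obj) :
    M.ten x x' y y' ▷ M.Hom z z' ≫ M.ten (x ⊗ y) (x' ⊗ y') z z' ≫ M.post _ (α_ x' y' z').hom =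
      (α_ _ _ _).hom ≫ M.Hom x x' ◁ M.ten y y' z z' ≫ M.ten x x' (y ⊗ z) (y' ⊗ z') ≫
        M.pre (α_ x y z).hom _ := by
  have h := M.associator.nat ⟨⟨x, y⟩, z⟩ ⟨⟨x', y'⟩, z'⟩
  simp only [tensorHom_id, id_tensorHom, Category.assoc] at h
  exact h

theorem leftUnitor_nat (x y : M.Obj) :
    M.lw (𝟙_ M.Obj) x y ≫ M.post _ (λ_ y).hom = M.pre (λ_ x).hom y :=
  (M.leftUnitor.nat x y).trans (Category.id_comp _)

theorem rightUnitor_nat (x y : M.Obj) :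
    M.rw (𝟙_ M.Obj) x y ≫ M.post _ (ρ_ y).hom = M.pre (ρ_ x).hom y :=
  (M.rightUnitor.nat x y).trans (Category.id_comp _)

theorem lw_eq (z x y : M.Obj) :
    M.lw z x y = (λ_ _).inv ≫ M.id z ▷ M.Hom x y ≫ M.ten z z x y := Category.assoc _ _ _

theorem rw_eq (z x y : M.Obj) :
    M.rw z x y = (ρ_ _).inv ≫ M.Hom x y ◁ M.id z ≫ M.ten x y z z := Category.assoc _ _ _

theorem hom_lw (z : M.Obj) {x y : M.Obj} (f : x ⟶ y) :
    ECat.UHom.hom f ≫ M.lw z x y = ECat.UHom.hom (z ◁ f) := by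
  rw [lw_eq, leftUnitor_inv_naturality_assoc, whisker_exchange_assoc]
  refine Eq.trans ?_ (M.tensor.map₂_hom (𝟙 z) f).symm
  rw [MonoidalCategory.tensorHom_def, Category.assoc]
  rfl

theorem hom_rw (z : M.Obj) {x y : M.Obj} (f : x ⟶ y) :
    ECat.UHom.hom f ≫ M.rw z x y = ECat.UHom.hom (f ▷ z) := by
  rw [rw_eq, rightUnitor_inv_naturality_assoc, ← whisker_exchange_assoc]
  refine Eq.trans ?_ (M.tensor.map₂_hom f (𝟙 z)).symm
  rw [MonoidalCategory.tensorHom_def', Category.assoc, unitors_inv_equal]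
  rfl

/-- The monoidal structure of the underlying category. -/
instance instMonoidalCategoryObj : MonoidalCategory M.Obj :=
  MonoidalCategory.ofTensorHom
    (id_tensorHom_id := fun x y => M.tensor.map₂_id x y)
    (tensorHom_comp_tensorHom := fun f g h k => (M.tensor.map₂_comp f h g k).symm)
    (associator_naturality := fun {x y z x' y' z'} f g h => by
      apply ECat.hom_ext
      rw [ECat.comp_hom_post, ECat.comp_hom_pre, tensorHom_hom, tensorHom_hom, tensorHom_hom,
        tensorHom_hom]
      have e := unit_assoc (ECat.UHom.hom f) (ECat.UHom.hom g) (ECat.UHom.hom h)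
      have a := M.associator_nat x x' y y' z z'
      simp only [← Category.assoc _ _ (M.ten _ _ _ _)]
      rw [push_left _ (M.ten x x' y y'), push_right _ (M.ten y y' z z')]
      simp only [Category.assoc] at e ⊢
      rw [a, reassoc_of% e])
    (leftUnitor_naturality := fun {x y} f => by
      apply ECat.hom_ext
      rw [ECat.comp_hom_post, ECat.comp_hom_pre, ← leftUnitor_nat, ← Category.assoc, hom_lw]
      rfl)
    (rightUnitor_naturality := fun {x y} f => by
      apply ECat.hom_ext
      rw [ECat.comp_hom_post, ECat.comp_hom_pre, ← rightUnitor_nat, ← Category.assoc, hom_rw]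
      rfl)
    (pentagon := fun x y z t => M.pentagon x y z t)
    (triangle := fun x y => M.triangle x y)

end EMonCat

end Monoidal

section BraidedMonoidal

variable {B : Type u} [Category.{v} B] [MonoidalCategory B] [BraidedCategory B]

/-! ## Enriched braided monoidal categories -/

namespace EFunctor

variable {C : ECat.{w₁} B} {D : ECat.{w₂} B} {E : ECat.{w₃} B}

/-- The action on hom objects of `F^rev (y, x) = F (x, y)`. -/
abbrev revMap (F : EFunctor (C.prod D) E) (p q : (D.prod C).Obj) :
    (D.prod C).Hom p q ⟶ E.Hom (F.obj ⟨p.snd, p.fst⟩) (F.obj ⟨q.snd, q.fst⟩) :=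
  (β_ (D.Hom p.fst q.fst) (C.Hom p.snd q.snd)).hom ≫ F.map ⟨p.snd, p.fst⟩ ⟨q.snd, q.fst⟩

/-- `F : C × D ⟶ E` is commutative if `F^rev` is an enriched functor `D × C ⟶ E`. -/
structure IsCommutative (F : EFunctor (C.prod D) E) : Prop where
  map_id : ∀ p : (D.prod C).Obj, (D.prod C).id p ≫ F.revMap p p = E.id (F.obj ⟨p.snd, p.fst⟩)
  map_comp : ∀ p q r : (D.prod C).Obj, (D.prod C).comp p q r ≫ F.revMap p r =
    (F.revMap q r ⊗ₘ F.revMap p q) ≫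
      E.comp (F.obj ⟨p.snd, p.fst⟩) (F.obj ⟨q.snd, q.fst⟩) (F.obj ⟨r.snd, r.fst⟩)

/-- The enriched functor `F^rev : D × C ⟶ E` of a commutative enriched functor. -/
abbrev rev (F : EFunctor (C.prod D) E) (h : F.IsCommutative) : EFunctor (D.prod C) E where
  obj p := F.obj ⟨p.snd, p.fst⟩
  map p q := F.revMap p q
  map_id := h.map_id
  map_comp := h.map_comp

end EFunctor

/-- A braiding on an enriched monoidal category. The hexagon axioms are those of the underlying
category. -/
structure EBraidStr (M : EMonCat.{w} B) where
  comm : M.tensor.IsCommutative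
  braiding : ENatIso M.tensor (M.tensor.rev comm)
  hexagon_forward : ∀ x y z : M.Obj,
    (α_ x y z).hom ≫ (braiding.app ⟨x, y ⊗ z⟩).hom ≫ (α_ y z x).hom =
      (braiding.app ⟨x, y⟩).hom ▷ z ≫ (α_ y x z).hom ≫ y ◁ (braiding.app ⟨x, z⟩).hom
  hexagon_reverse : ∀ x y z : M.Obj,
    (α_ x y z).inv ≫ (braiding.app ⟨x ⊗ y, z⟩).hom ≫ (α_ z x y).inv =
      x ◁ (braiding.app ⟨y, z⟩).hom ≫ (α_ x z y).inv ≫ (braiding.app ⟨x, z⟩).hom ▷ y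

/-- A braided monoidal category enriched over `B`. -/
structure EBraidedCat (B : Type u) [Category.{v} B] [MonoidalCategory B] [BraidedCategory B] extends
    toEMonCat : EMonCat.{w} B, EBraidStr toEMonCat

theorem EBraidedCat.braiding_nat (M : EBraidedCat.{w} B) (x x' y y' : M.Obj) :
    M.ten x x' y y' ≫ M.post _ (M.braiding.app ⟨x', y'⟩).hom =
      (β_ _ _).hom ≫ M.ten y y' x x' ≫ M.pre (M.braiding.app ⟨x, y⟩).hom _ :=
  (M.braiding.nat ⟨x, y⟩ ⟨x', y'⟩).trans (Category.assoc _ _ _)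

theorem EBraidedCat.braiding_naturality (M : EBraidedCat.{w} B) {x x' y y' : M.Obj}
    (f : x ⟶ x') (g : y ⟶ y') :
    (f ⊗ₘ g) ≫ (M.braiding.app ⟨x', y'⟩).hom = (M.braiding.app ⟨x, y⟩).hom ≫ (g ⊗ₘ f) := by
  apply ECat.hom_ext
  rw [ECat.comp_hom_post, ECat.comp_hom_pre, EMonCat.tensorHom_hom, EMonCat.tensorHom_hom]
  simp only [Category.assoc]
  rw [M.braiding_nat, BraidedCategory.braiding_naturality_assoc]
  simp only [braiding_tensorUnit_left, Category.assoc, Iso.inv_hom_id_assoc]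
  rw [unitors_inv_equal]
  rfl

/-- The braiding of the underlying monoidal category. -/
instance EBraidedCat.instBraidedCategoryObj (M : EBraidedCat.{w} B) : BraidedCategory M.Obj where
  braiding x y := M.braiding.app ⟨x, y⟩
  braiding_naturality_left {x y} f z := by
    rw [← tensorHom_id, ← id_tensorHom]
    exact M.braiding_naturality f (𝟙 z)
  braiding_naturality_right x {y z} f := by
    rw [← tensorHom_id, ← id_tensorHom]
    exact M.braiding_naturality (𝟙 x) f
  hexagon_forward := M.hexagon_forward
  hexagon_reverse := M.hexagon_reverse

/-- An enriched braided monoidal functor: an enriched functor, with the structure of a braided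
monoidal functor on the underlying functor whose comparison isomorphisms
`F x ⊗ F y ⟶ F (x ⊗ y)` are enriched natural. -/
structure EBraidedFunctor (C : EBraidedCat.{w₁} B) (D : EBraidedCat.{w₂} B) where
  functor : EFunctor C.toECat D.toECat
  braided : functor.und.Braided
  μ_nat : IsENat ((functor.prod functor).comp D.tensor) (C.tensor.comp functor)
    (fun p => Functor.LaxMonoidal.μ functor.und p.fst p.snd)

attribute [instance] EBraidedFunctor.braided

/-- An equivalence of enriched braided monoidal categories: enriched braided monoidal functors in
both directions whose composites are isomorphic to the identity functors by enriched monoidal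
natural isomorphisms. -/
structure EBraidedEquiv (C : EBraidedCat.{w₁} B) (D : EBraidedCat.{w₂} B) where
  F : EBraidedFunctor C D
  G : EBraidedFunctor D C
  unitIso : 𝟭 C.Obj ≅ F.functor.und ⋙ G.functor.und
  unit_nat : IsENat (EFunctor.id C.toECat) (F.functor.comp G.functor) (fun x => unitIso.hom.app x)
  unit_monoidal : NatTrans.IsMonoidal unitIso.hom
  counitIso : G.functor.und ⋙ F.functor.und ≅ 𝟭 D.Obj
  counit_nat : IsENat (G.functor.comp F.functor) (EFunctor.id D.toECat)
    (fun x => counitIso.hom.app x)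
  counit_monoidal : NatTrans.IsMonoidal counitIso.hom

end BraidedMonoidal

section Squares

variable {B : Type u} [Category.{v} B] [MonoidalCategory B]

/-- For `f : T ⟶ Hom a b`, `g : T ⟶ Hom a' b'` and morphisms `ξ : a ⟶ a'`, `ζ : b ⟶ b'` of the
underlying category, the identity `ζ ∘ f = g ∘ ξ`. -/
def Sq (C : ECat.{w} B) {T : B} {a b a' b' : C.Obj} (f : T ⟶ C.Hom a b) (g : T ⟶ C.Hom a' b')
    (ξ : a ⟶ a') (ζ : b ⟶ b') : Prop :=
  f ≫ C.post a ζ = g ≫ C.pre ξ b'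

namespace Sq

variable {C : ECat.{w} B} {T S : B}

theorem refl {a b : C.Obj} (f : T ⟶ C.Hom a b) : Sq C f f (𝟙 a) (𝟙 b) := by
  rw [Sq, ECat.post_id, ECat.pre_id]

theorem trans {a b a' b' a'' b'' : C.Obj} {f : T ⟶ C.Hom a b} {g : T ⟶ C.Hom a' b'}
    {h : T ⟶ C.Hom a'' b''} {ξ : a ⟶ a'} {ζ : b ⟶ b'} {ξ' : a' ⟶ a''} {ζ' : b' ⟶ b''}
    (p : Sq C f g ξ ζ) (q : Sq C g h ξ' ζ') : Sq C f h (ξ ≫ ξ') (ζ ≫ ζ') := by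
  rw [Sq] at *
  rw [← ECat.post_post, reassoc_of% p, ECat.pre_post_comm, reassoc_of% q, ECat.pre_pre]

theorem symm {a b a' b' : C.Obj} {f : T ⟶ C.Hom a b} {g : T ⟶ C.Hom a' b'}
    {ξ : a ≅ a'} {ζ : b ≅ b'} (p : Sq C f g ξ.hom ζ.hom) : Sq C g f ξ.inv ζ.inv := by
  rw [Sq] at *
  have h := congrArg (fun k => k ≫ C.post a ζ.inv ≫ C.pre ξ.inv b) p
  simp only [Category.assoc] at h
  rw [reassoc_of% (C.post_post a ζ.hom ζ.inv), Iso.hom_inv_id, ECat.post_id, Category.id_comp,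
    ← C.pre_post_comm ξ.inv ζ.inv, reassoc_of% (C.pre_pre ξ.inv ξ.hom b'), Iso.inv_hom_id,
    ECat.pre_id, Category.id_comp] at h
  exact h.symm

theorem precomp {a b a' b' : C.Obj} {f : T ⟶ C.Hom a b} {g : T ⟶ C.Hom a' b'}
    {ξ : a ⟶ a'} {ζ : b ⟶ b'} (k : S ⟶ T) (p : Sq C f g ξ ζ) : Sq C (k ≫ f) (k ≫ g) ξ ζ := by
  rw [Sq] at *
  rw [Category.assoc, p, Category.assoc]

theorem vcomp {a b c a' b' c' : C.Obj} {f : T ⟶ C.Hom a b} {g : T ⟶ C.Hom a' b'}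
    {f₁ : S ⟶ C.Hom b c} {g₁ : S ⟶ C.Hom b' c'} {ξ : a ⟶ a'} {ζ : b ⟶ b'} {ω : c ⟶ c'}
    (p : Sq C f g ξ ζ) (q : Sq C f₁ g₁ ζ ω) :
    Sq C ((f₁ ⊗ₘ f) ≫ C.comp a b c) ((g₁ ⊗ₘ g) ≫ C.comp a' b' c') ξ ω := by
  rw [Sq] at *
  rw [Category.assoc, Category.assoc, ← ECat.post_comp, ← ECat.pre_comp,
    ← reassoc_of% (push_left f₁ (C.post b ω) f), q, push_left, Category.assoc, ECat.pre_post,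
    ← reassoc_of% (push_right f (C.post a ζ) g₁), p, push_right, Category.assoc]

theorem map {D : ECat.{w₁} B} (F : EFunctor C D) {a b a' b' : C.Obj} {f : T ⟶ C.Hom a b}
    {g : T ⟶ C.Hom a' b'} {ξ : a ⟶ a'} {ζ : b ⟶ b'} (p : Sq C f g ξ ζ) :
    Sq D (f ≫ F.map a b) (g ≫ F.map a' b') (F.und.map ξ) (F.und.map ζ) := by
  rw [Sq] at *
  rw [Category.assoc, Category.assoc, ← EFunctor.map_post_und, reassoc_of% p,
    EFunctor.map_pre_und]

theorem of_map {D : ECat.{w₁} B} (F : EFunctor C D) {a b a' b' : C.Obj} {f : T ⟶ C.Hom a b}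
    {g : T ⟶ C.Hom a' b'} {ξ : a ⟶ a'} {ζ : b ⟶ b'} [Mono (F.map a b')]
    (p : Sq D (f ≫ F.map a b) (g ≫ F.map a' b') (F.und.map ξ) (F.und.map ζ)) : Sq C f g ξ ζ := by
  rw [Sq] at *
  rw [Category.assoc, Category.assoc, ← EFunctor.map_post_und, ← EFunctor.map_pre_und] at p
  rw [← cancel_mono (F.map a b'), Category.assoc, Category.assoc, p]

end Sq

theorem pre_iso_cancel {C : ECat.{w} B} {T : B} {a a' b : C.Obj} (ξ : a ≅ a')
    {f g : T ⟶ C.Hom a' b} (h : f ≫ C.pre ξ.hom b = g ≫ C.pre ξ.hom b) : f = g := by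
  have h' := congrArg (fun k => k ≫ C.pre ξ.inv b) h
  simpa only [Category.assoc, ECat.pre_pre, Iso.inv_hom_id, ECat.pre_id, Category.comp_id] using h'

theorem id_whisker_comp (C : ECat.{w} B) (x y : C.Obj) :
    C.id y ▷ C.Hom x y ≫ C.comp x y y = (λ_ _).hom := by
  rw [← cancel_epi (λ_ (C.Hom x y)).inv, C.id_comp, Iso.inv_hom_id]

theorem whisker_id_comp (C : ECat.{w} B) (x y : C.Obj) :
    C.Hom x y ◁ C.id x ≫ C.comp x x y = (ρ_ _).hom := by
  rw [← cancel_epi (ρ_ (C.Hom x y)).inv, C.comp_id, Iso.inv_hom_id]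

end Squares

section SquaresTensor

variable {B : Type u} [Category.{v} B] [MonoidalCategory B] [BraidedCategory B]

theorem isCommutative_of_sq {C : ECat.{w} B} (T : EFunctor (C.prod C) C)
    (ξ : ∀ x y : C.Obj, T.obj ⟨x, y⟩ ≅ T.obj ⟨y, x⟩)
    (h : ∀ x x' y y', Sq C (T.map ⟨x, y⟩ ⟨x', y'⟩) (T.revMap ⟨x, y⟩ ⟨x', y'⟩)
      (ξ x y).hom (ξ x' y').hom) : T.IsCommutative where
  map_id p := by
    apply pre_iso_cancel (ξ p.fst p.snd)
    have e := Sq.precomp ((C.prod C).id p) (h p.fst p.fst p.snd p.snd)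
    rw [Sq] at e
    have e' := congrArg ECat.UHom.hom (Category.id_comp (ξ p.fst p.snd).hom)
    have e'' := congrArg ECat.UHom.hom (Category.comp_id (ξ p.fst p.snd).hom)
    rw [ECat.comp_hom_post, ECat.id_hom] at e'
    rw [ECat.comp_hom_pre, ECat.id_hom] at e''
    have i := T.map_id p
    refine e.symm.trans (Eq.trans ?_ (e'.trans e''.symm))
    rw [← i]
  map_comp p q r := by
    apply pre_iso_cancel (ξ p.fst p.snd)
    have e := Sq.precomp ((C.prod C).comp p q r) (h p.fst r.fst p.snd r.snd)
    have e' := Sq.vcomp (h p.fst q.fst p.snd q.snd) (h q.fst r.fst q.snd r.snd)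
    have i := T.map_comp p q r
    rw [Sq] at e e'
    refine e.symm.trans (Eq.trans ?_ e')
    exact congrArg (· ≫ C.post _ (ξ r.fst r.snd).hom) i

namespace EMonCat

variable (M : EMonCat.{w} B)

theorem lw_comp (z x y t : M.Obj) :
    M.comp x y t ≫ M.lw z x t = (M.lw z y t ⊗ₘ M.lw z x y) ≫ M.comp _ _ _ :=
  ((EFunctor.insL z M.toECat).comp M.tensor).map_comp x y t

theorem rw_comp (z x y t : M.Obj) :
    M.comp x y t ≫ M.rw z x t = (M.rw z y t ⊗ₘ M.rw z x y) ≫ M.comp _ _ _ :=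
  ((EFunctor.insR M.toECat z).comp M.tensor).map_comp x y t

theorem swap_right (X Y : B) :
    ((ρ_ X).inv ⊗ₘ (λ_ Y).inv) ≫ tensorδ X (𝟙_ B) (𝟙_ B) Y ≫ ((ρ_ X).hom ⊗ₘ (λ_ Y).hom) =
      𝟙 (X ⊗ Y) := by
  simp only [tensorδ, braiding_inv_tensorUnit_left]
  monoidal

theorem swap_left (X Y : B) :
    ((λ_ Y).inv ⊗ₘ (ρ_ X).inv) ≫ tensorδ (𝟙_ B) X Y (𝟙_ B) ≫ ((λ_ X).hom ⊗ₘ (ρ_ Y).hom) =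
      (β_ X Y).inv := by
  simp only [tensorδ]
  monoidal

theorem rw_lw_comp (x x' y y' : M.Obj) :
    (M.rw y' x x' ⊗ₘ M.lw x y y') ≫ M.comp _ _ _ = M.ten x x' y y' := by
  have h := M.tensor.map_comp ⟨x, y⟩ ⟨x, y'⟩ ⟨x', y'⟩
  have e : (((ρ_ _).inv ≫ M.Hom x x' ◁ M.id y') ⊗ₘ ((λ_ _).inv ≫ M.id x ▷ M.Hom y y')) ≫
      (M.toECat.prod M.toECat).comp ⟨x, y⟩ ⟨x, y'⟩ ⟨x', y'⟩ = 𝟙 _ := by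
    rw [ECat.prod_comp, ← tensorHom_comp_tensorHom, Category.assoc, ← id_tensorHom,
      ← tensorHom_id, reassoc_of% (tensorδ_natural (𝟙 (M.Hom x x')) (M.id y') (M.id x)
        (𝟙 (M.Hom y y'))), tensorHom_comp_tensorHom, id_tensorHom, tensorHom_id, id_whisker_comp,
      whisker_id_comp, swap_right]
  calc _ = (((ρ_ _).inv ≫ M.Hom x x' ◁ M.id y') ⊗ₘ ((λ_ _).inv ≫ M.id x ▷ M.Hom y y')) ≫
      (M.ten x x' y' y' ⊗ₘ M.ten x x y y') ≫ M.comp _ _ _ := by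
        rw [tensorHom_comp_tensorHom_assoc]; rfl
    _ = _ := by
      refine (congrArg (fun k => _ ≫ k) h.symm).trans ?_
      exact (Category.assoc _ _ _).symm.trans
        ((congrArg (· ≫ M.ten x x' y y') e).trans (Category.id_comp _))

theorem lw_rw_comp (x x' y y' : M.Obj) :
    (M.lw x' y y' ⊗ₘ M.rw y x x') ≫ M.comp _ _ _ = (β_ _ _).inv ≫ M.ten x x' y y' := by
  have h := M.tensor.map_comp ⟨x, y⟩ ⟨x', y⟩ ⟨x', y'⟩
  have e : (((λ_ _).inv ≫ M.id x' ▷ M.Hom y y') ⊗ₘ ((ρ_ _).inv ≫ M.Hom x x' ◁ M.id y)) ≫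
      (M.toECat.prod M.toECat).comp ⟨x, y⟩ ⟨x', y⟩ ⟨x', y'⟩ = (β_ _ _).inv := by
    rw [ECat.prod_comp, ← tensorHom_comp_tensorHom, Category.assoc, ← id_tensorHom,
      ← tensorHom_id, reassoc_of% (tensorδ_natural (M.id x') (𝟙 (M.Hom y y')) (𝟙 (M.Hom x x'))
        (M.id y)), tensorHom_comp_tensorHom, id_tensorHom, tensorHom_id, id_whisker_comp,
      whisker_id_comp, swap_left]
  calc _ = (((λ_ _).inv ≫ M.id x' ▷ M.Hom y y') ⊗ₘ ((ρ_ _).inv ≫ M.Hom x x' ◁ M.id y)) ≫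
      (M.ten x' x' y y' ⊗ₘ M.ten x x' y y) ≫ M.comp _ _ _ := by
        rw [tensorHom_comp_tensorHom_assoc]; rfl
    _ = _ := by
      refine (congrArg (fun k => _ ≫ k) h.symm).trans ?_
      exact (Category.assoc _ _ _).symm.trans (congrArg (· ≫ M.ten x x' y y') e)

end EMonCat

end SquaresTensor

section CenterAux

variable {B : Type u} [Category.{v} B] [MonoidalCategory B] [BraidedCategory B]

namespace EMonCat

variable (M : EMonCat.{w} B)

variable {M} in
theorem sq_ten {T S : B} {a b a' b' c d c' d' : M.Obj} {f : T ⟶ M.Hom a b} {g : T ⟶ M.Hom a' b'}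
    {ξ : a ⟶ a'} {ζ : b ⟶ b'} {f₁ : S ⟶ M.Hom c d} {g₁ : S ⟶ M.Hom c' d'} {ξ₁ : c ⟶ c'}
    {ζ₁ : d ⟶ d'} (p : Sq M.toECat f g ξ ζ) (q : Sq M.toECat f₁ g₁ ξ₁ ζ₁) :
    Sq M.toECat ((f ⊗ₘ f₁) ≫ M.ten a b c d) ((g ⊗ₘ g₁) ≫ M.ten a' b' c' d') (ξ ⊗ₘ ξ₁)
      (ζ ⊗ₘ ζ₁) := by
  rw [Sq] at *
  rw [Category.assoc, Category.assoc, ← ten_post, ← ten_pre, tensorHom_comp_tensorHom_assoc,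
    tensorHom_comp_tensorHom_assoc, p, q]

variable {M} in
theorem sq_lw {T : B} {a b a' b' : M.Obj} {f : T ⟶ M.Hom a b} {g : T ⟶ M.Hom a' b'}
    {ξ : a ⟶ a'} {ζ : b ⟶ b'} (p : Sq M.toECat f g ξ ζ) (z : M.Obj) :
    Sq M.toECat (f ≫ M.lw z a b) (g ≫ M.lw z a' b') (z ◁ ξ) (z ◁ ζ) := by
  have h := Sq.map ((EFunctor.insL z M.toECat).comp M.tensor) p
  have e : ∀ {x y : M.Obj} (k : x ⟶ y),
      ((EFunctor.insL z M.toECat).comp M.tensor).und.map k = z ◁ k :=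
    fun k => ECat.hom_ext _ _ (M.hom_lw z k)
  rw [e, e] at h
  exact h

variable {M} in
theorem sq_rw {T : B} {a b a' b' : M.Obj} {f : T ⟶ M.Hom a b} {g : T ⟶ M.Hom a' b'}
    {ξ : a ⟶ a'} {ζ : b ⟶ b'} (p : Sq M.toECat f g ξ ζ) (z : M.Obj) :
    Sq M.toECat (f ≫ M.rw z a b) (g ≫ M.rw z a' b') (ξ ▷ z) (ζ ▷ z) := by
  have h := Sq.map ((EFunctor.insR M.toECat z).comp M.tensor) p
  have e : ∀ {x y : M.Obj} (k : x ⟶ y),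
      ((EFunctor.insR M.toECat z).comp M.tensor).und.map k = k ▷ z :=
    fun k => ECat.hom_ext _ _ (M.hom_rw z k)
  rw [e, e] at h
  exact h

theorem sq_assoc (x x' y y' z z' : M.Obj) :
    Sq M.toECat (M.ten x x' y y' ▷ M.Hom z z' ≫ M.ten (x ⊗ y) (x' ⊗ y') z z')
      ((α_ _ _ _).hom ≫ M.Hom x x' ◁ M.ten y y' z z' ≫ M.ten x x' (y ⊗ z) (y' ⊗ z'))
      (α_ x y z).hom (α_ x' y' z').hom := by
  rw [Sq]
  simp only [Category.assoc]
  exact M.associator_nat x x' y y' z z'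

theorem sq_assoc_rw (x x' y y' z : M.Obj) :
    Sq M.toECat (M.ten x x' y y' ≫ M.rw z _ _) (M.Hom x x' ◁ M.rw z y y' ≫ M.ten x x' _ _)
      (α_ x y z).hom (α_ x' y' z).hom := by
  convert Sq.precomp ((ρ_ _).inv ≫ (M.Hom x x' ⊗ M.Hom y y') ◁ M.id z)
    (M.sq_assoc x x' y y' z z) using 1
  · rw [rw_eq, rightUnitor_inv_naturality_assoc, Category.assoc, ← whisker_exchange_assoc]
  · rw [rw_eq]
    simp

theorem sq_assoc_mid (x x' y y' z : M.Obj) :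
    Sq M.toECat (M.rw z x x' ▷ M.Hom y y' ≫ M.ten _ _ y y')
      (M.Hom x x' ◁ M.lw z y y' ≫ M.ten x x' _ _) (α_ x z y).hom (α_ x' z y').hom := by
  convert Sq.precomp (((ρ_ _).inv ≫ M.Hom x x' ◁ M.id z) ▷ M.Hom y y')
    (M.sq_assoc x x' z z y y') using 1
  · rw [rw_eq]
    simp
  · rw [lw_eq]
    simp

theorem sq_assoc_lw (x x' y y' z : M.Obj) :
    Sq M.toECat (M.lw z x x' ▷ M.Hom y y' ≫ M.ten _ _ y y')
      (M.ten x x' y y' ≫ M.lw z _ _) (α_ z x y).hom (α_ z x' y').hom := by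
  convert Sq.precomp (((λ_ _).inv ≫ M.id z ▷ M.Hom x x') ▷ M.Hom y y')
    (M.sq_assoc z z x x' y y') using 1
  · rw [lw_eq]
    simp
  · rw [lw_eq, leftUnitor_inv_naturality_assoc, whisker_exchange_assoc]
    simp

theorem id_lw (x y : M.Obj) : M.id y ≫ M.lw x y y = M.id (x ⊗ y) :=
  ((EFunctor.insL x M.toECat).comp M.tensor).map_id y

theorem id_rw (x y : M.Obj) : M.id x ≫ M.rw y x x = M.id (x ⊗ y) :=
  ((EFunctor.insR M.toECat y).comp M.tensor).map_id x

theorem sq_lw_tensor (x y z z' : M.Obj) :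
    Sq M.toECat (M.lw (x ⊗ y) z z') (M.lw y z z' ≫ M.lw x _ _) (α_ x y z).hom (α_ x y z').hom := by
  convert Sq.precomp ((λ_ _).inv ≫ M.id y ▷ M.Hom z z') (M.sq_assoc_lw y y z z' x) using 1
  · rw [lw_eq, Category.assoc, ← comp_whiskerRight_assoc, id_lw]
  · rw [M.lw_eq y]
    simp only [Category.assoc]

theorem sq_lw_rw (x y y' z : M.Obj) :
    Sq M.toECat (M.lw x y y' ≫ M.rw z _ _) (M.rw z y y' ≫ M.lw x _ _) (α_ x y z).hom
      (α_ x y' z).hom := by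
  convert Sq.precomp ((ρ_ _).inv ≫ M.Hom y y' ◁ M.id z) (M.sq_assoc_lw y y' z z x) using 1
  · rw [rw_eq, rightUnitor_inv_naturality_assoc, Category.assoc, ← whisker_exchange_assoc]
  · rw [M.rw_eq z]
    simp only [Category.assoc]

theorem sq_rw_tensor (x x' y z : M.Obj) :
    Sq M.toECat (M.rw y x x' ≫ M.rw z _ _) (M.rw (y ⊗ z) x x') (α_ x y z).hom
      (α_ x' y z).hom := by
  convert Sq.precomp ((ρ_ _).inv ≫ M.Hom x x' ◁ M.id y) (M.sq_assoc_rw x x' y y z) using 1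
  · rw [M.rw_eq y]
    simp only [Category.assoc]
  · rw [M.rw_eq (y ⊗ z), Category.assoc, ← MonoidalCategory.whiskerLeft_comp_assoc, id_rw]

end EMonCat

end CenterAux

section Center

variable {B : Type u} [Category.{v} B] [MonoidalCategory B] [BraidedCategory B]

/-! ## The Drinfeld center -/

/-- `B` admits equalizers, and the intersection of arbitrarily many subobjects of any object of `B`
exists: a morphism factors through the intersection if and only if it factors through each of the
subobjects. -/
class HasIntersections (B : Type u) [Category.{v} B] : Prop where
  hasEqualizers : HasEqualizers B
  exists_intersection : ∀ {X : B} (S : Set (Subobject X)), ∃ m : Subobject X,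
    ∀ {T : B} (f : T ⟶ X), m.Factors f ↔ ∀ s ∈ S, s.Factors f

/-- The intersection of a set of subobjects. -/
def intersection [HasIntersections B] {X : B} (S : Set (Subobject X)) : Subobject X :=
  (HasIntersections.exists_intersection S).choose

theorem intersection_factors_iff [HasIntersections B] {X : B} (S : Set (Subobject X)) {T : B}
    (f : T ⟶ X) : (intersection S).Factors f ↔ ∀ s ∈ S, s.Factors f :=
  (HasIntersections.exists_intersection S).choose_spec f

/-- The objects of the Drinfeld center: objects `x` with a half-braiding `x ⊗ - ≅ - ⊗ x` of the
underlying monoidal category that is an enriched natural isomorphism. -/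
structure ZObj (M : EMonCat.{w} B) where
  obj : M.Obj
  half : HalfBraiding obj
  nat : IsENat ((EFunctor.insL obj M.toECat).comp M.tensor)
    ((EFunctor.insR M.toECat obj).comp M.tensor) (fun z => (half.β z).hom)

namespace ZObj

variable {M : EMonCat.{w} B}

/-- The underlying object of the Drinfeld center of the underlying monoidal category. -/
abbrev toCenter (X : ZObj M) : Center M.Obj := ⟨X.obj, X.half⟩

theorem sq (X : ZObj M) (z z' : M.Obj) :
    Sq M.toECat (M.lw X.obj z z') (M.rw X.obj z z') (X.half.β z).hom (X.half.β z').hom :=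
  X.nat z z'

/-- The tensor product of half-braidings. -/
abbrev tensor (X Y : ZObj M) : ZObj M where
  obj := X.obj ⊗ Y.obj
  half := (Center.tensorObj X.toCenter Y.toCenter).2
  nat z z' := by
    have h1 := M.sq_lw_tensor X.obj Y.obj z z'
    have h2 := EMonCat.sq_lw (Y.sq z z') X.obj
    have h3 := Sq.symm (M.sq_lw_rw X.obj z z' Y.obj)
    have h4 := EMonCat.sq_rw (X.sq z z') Y.obj
    have h5 := M.sq_rw_tensor z z' X.obj Y.obj
    exact h1.trans (h2.trans (h3.trans (h4.trans h5)))

/-- The unit object with its canonical half-braiding. -/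
abbrev unit (M : EMonCat.{w} B) : ZObj M where
  obj := 𝟙_ M.Obj
  half := (Center.tensorUnit (C := M.Obj)).2
  nat z z' := by
    have h1 : Sq M.toECat (M.lw (𝟙_ M.Obj) z z') (𝟙 _) (λ_ z).hom (λ_ z').hom := by
      rw [Sq, EMonCat.leftUnitor_nat, Category.id_comp]
    have h2 : Sq M.toECat (M.rw (𝟙_ M.Obj) z z') (𝟙 _) (ρ_ z).hom (ρ_ z').hom := by
      rw [Sq, EMonCat.rightUnitor_nat, Category.id_comp]
    exact h1.trans h2.symm

variable (X Y W : ZObj M)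

/-- The hom objects of the Drinfeld center: the intersection, over all `z`, of the equalizers of the
two morphisms `Hom x y ⟶ Hom (x ⊗ z) (z ⊗ y)` given by `(z ⊗ -) ∘ b_{x,z}` and
`b_{y,z} ∘ (- ⊗ z)`. -/
def homSub [HasIntersections B] : Subobject (M.Hom X.obj Y.obj) :=
  haveI := HasIntersections.hasEqualizers (B := B)
  intersection (Set.range fun z : M.Obj =>
    equalizerSubobject
      (M.lw z X.obj Y.obj ≫ M.pre (X.half.β z).hom (z ⊗ Y.obj))
      (M.rw z X.obj Y.obj ≫ M.post (X.obj ⊗ z) (Y.half.β z).hom))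

theorem homSub_factors_iff [HasIntersections B] {T : B} (f : T ⟶ M.Hom X.obj Y.obj) :
    (X.homSub Y).Factors f ↔ ∀ z, Sq M.toECat (f ≫ M.rw z _ _) (f ≫ M.lw z _ _)
      (X.half.β z).hom (Y.half.β z).hom := by
  haveI := HasIntersections.hasEqualizers (B := B)
  rw [homSub, intersection_factors_iff]
  simp only [Set.mem_range, forall_exists_index, forall_apply_eq_imp_iff,
    equalizerSubobject_factors_iff, Sq, Category.assoc]
  exact forall_congr' fun z => eq_comm

variable [HasIntersections B]

/-- The inclusion of the hom object of the center. -/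
abbrev ι : ((X.homSub Y : Subobject _) : B) ⟶ M.Hom X.obj Y.obj := (X.homSub Y).arrow

theorem sq_ι (z : M.Obj) : Sq M.toECat (X.ι Y ≫ M.rw z _ _) (X.ι Y ≫ M.lw z _ _)
    (X.half.β z).hom (Y.half.β z).hom :=
  (X.homSub_factors_iff Y _).1 (Subobject.factors_self _) z

theorem factors_id : (X.homSub X).Factors (M.id X.obj) := by
  rw [homSub_factors_iff]
  intro z
  rw [EMonCat.id_lw, EMonCat.id_rw, Sq]
  have e := congrArg ECat.UHom.hom (Category.id_comp (X.half.β z).hom)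
  have e' := congrArg ECat.UHom.hom (Category.comp_id (X.half.β z).hom)
  rw [ECat.comp_hom_post] at e
  rw [ECat.comp_hom_pre] at e'
  exact e.trans e'.symm

theorem factors_comp :
    (X.homSub W).Factors ((Y.ι W ⊗ₘ X.ι Y) ≫ M.comp X.obj Y.obj W.obj) := by
  rw [homSub_factors_iff]
  intro z
  rw [Category.assoc, Category.assoc, EMonCat.rw_comp, EMonCat.lw_comp,
    tensorHom_comp_tensorHom_assoc, tensorHom_comp_tensorHom_assoc]
  exact Sq.vcomp (X.sq_ι Y z) (Y.sq_ι W z)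

theorem factors_ten (X X' Y Y' : ZObj M) :
    ((X.tensor Y).homSub (X'.tensor Y')).Factors
      ((X.ι X' ⊗ₘ Y.ι Y') ≫ M.ten X.obj X'.obj Y.obj Y'.obj) := by
  rw [homSub_factors_iff]
  intro z
  have h1 := Sq.precomp (X.ι X' ⊗ₘ Y.ι Y') (M.sq_assoc_rw X.obj X'.obj Y.obj Y'.obj z)
  have h2 := EMonCat.sq_ten (Sq.refl (X.ι X')) (Y.sq_ι Y' z)
  have h3 := Sq.precomp (X.ι X' ⊗ₘ Y.ι Y')
    (Sq.symm (M.sq_assoc_mid X.obj X'.obj Y.obj Y'.obj z))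
  have h4 := EMonCat.sq_ten (X.sq_ι X' z) (Sq.refl (Y.ι Y'))
  have h5 := Sq.precomp (X.ι X' ⊗ₘ Y.ι Y') (M.sq_assoc_lw X.obj X'.obj Y.obj Y'.obj z)
  rw [id_tensorHom, id_tensorHom, push_right, push_right, Category.assoc, Category.assoc] at h2
  rw [tensorHom_id, tensorHom_id, push_left, push_left, Category.assoc, Category.assoc] at h4
  rw [Category.assoc, Category.assoc]
  exact h1.trans (h2.trans (h3.trans (h4.trans h5)))

end ZObj

end Center

section CenterCat

variable {B : Type u} [Category.{v} B] [MonoidalCategory B] [BraidedCategory B]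
  [HasIntersections B] (M : EMonCat.{w} B)

/-- The Drinfeld center as an enriched category: identities and composition are restricted from
`M`. -/
abbrev ZCat : ECat.{max v w} B where
  Obj := ZObj M
  Hom X Y := ((X.homSub Y : Subobject _) : B)
  id X := (X.homSub X).factorThru (M.id X.obj) X.factors_id
  comp X Y W := (X.homSub W).factorThru ((Y.ι W ⊗ₘ X.ι Y) ≫ M.comp X.obj Y.obj W.obj)
    (X.factors_comp Y W)
  comp_id X Y := by
    rw [← cancel_mono (X.ι Y)]
    simp only [Category.assoc, Subobject.factorThru_arrow, Category.id_comp]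
    rw [← reassoc_of% (pull_right ((X.homSub X).factorThru (M.id X.obj) X.factors_id) (X.ι X)
      (X.ι Y)), Subobject.factorThru_arrow, MonoidalCategory.tensorHom_def, Category.assoc,
      ← rightUnitor_inv_naturality_assoc, M.comp_id, Category.comp_id]
  id_comp X Y := by
    rw [← cancel_mono (X.ι Y)]
    simp only [Category.assoc, Subobject.factorThru_arrow, Category.id_comp]
    rw [← reassoc_of% (pull_left ((Y.homSub Y).factorThru (M.id Y.obj) Y.factors_id) (Y.ι Y)
      (X.ι Y)), Subobject.factorThru_arrow, MonoidalCategory.tensorHom_def', Category.assoc,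
      ← leftUnitor_inv_naturality_assoc, M.id_comp, Category.comp_id]
  assoc X Y W V := by
    rw [← cancel_mono (X.ι V)]
    simp only [Category.assoc, Subobject.factorThru_arrow]
    rw [← reassoc_of% (pull_left ((Y.homSub V).factorThru _ (Y.factors_comp W V)) (Y.ι V)
      (X.ι Y)), ← reassoc_of% (pull_right ((X.homSub W).factorThru _ (X.factors_comp Y W)) (X.ι W)
      (W.ι V)), Subobject.factorThru_arrow, Subobject.factorThru_arrow, push_left, push_right,
      Category.assoc, Category.assoc, M.assoc, ← MonoidalCategory.associator_naturality_assoc]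

instance : Category.{v} (ZObj M) := ECat.instCategoryObj (ZCat M)

/-- The forgetful functor from the Drinfeld center. -/
abbrev zForget : EFunctor (ZCat M) M.toECat where
  obj X := X.obj
  map X Y := X.ι Y
  map_id X := Subobject.factorThru_arrow _ _ (ZObj.factors_id X)
  map_comp X Y W := Subobject.factorThru_arrow _ _ (ZObj.factors_comp X Y W)

variable {M}

/-- Morphisms of the underlying category that intertwine the half-braidings are morphisms of the
Drinfeld center. -/
theorem ZObj.factors_of_comm {X Y : ZObj M} (f : X.obj ⟶ Y.obj)
    (h : ∀ z, f ▷ z ≫ (Y.half.β z).hom = (X.half.β z).hom ≫ z ◁ f) :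
    (X.homSub Y).Factors (ECat.UHom.hom f) := by
  rw [homSub_factors_iff]
  intro z
  rw [EMonCat.hom_lw, EMonCat.hom_rw, Sq, ← ECat.comp_hom_post, ← ECat.comp_hom_pre, h]

/-- The morphism of the Drinfeld center given by a morphism intertwining the half-braidings. -/
def zHom {X Y : ZObj M} (f : X.toCenter ⟶ Y.toCenter) : (ZCat M).UHom X Y :=
  ⟨(X.homSub Y).factorThru (ECat.UHom.hom f.f) (ZObj.factors_of_comm f.f f.comm)⟩

theorem zForget_zHom {X Y : ZObj M} (f : X.toCenter ⟶ Y.toCenter) :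
    (zForget M).und.map (X := X) (Y := Y) (zHom f) = f.f :=
  ECat.hom_ext _ _ (Subobject.factorThru_arrow _ _ (ZObj.factors_of_comm f.f f.comm))

instance : (zForget M).und.Faithful where
  map_injective {X Y} f g h := by
    apply ECat.hom_ext
    rw [← cancel_mono (X.ι Y)]
    exact congrArg ECat.UHom.hom h

/-- The isomorphism of the Drinfeld center given by an isomorphism intertwining the
half-braidings. -/
def zIso {X Y : ZObj M} (f : X.toCenter ≅ Y.toCenter) : @Iso (ZCat M).Obj _ X Y where
  hom := zHom f.hom
  inv := zHom f.inv
  hom_inv_id := by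
    apply (zForget M).und.map_injective
    rw [Functor.map_comp, zForget_zHom, zForget_zHom, CategoryTheory.Functor.map_id]
    exact congrArg Center.Hom.f f.hom_inv_id
  inv_hom_id := by
    apply (zForget M).und.map_injective
    rw [Functor.map_comp, zForget_zHom, zForget_zHom, CategoryTheory.Functor.map_id]
    exact congrArg Center.Hom.f f.inv_hom_id

variable (M)

/-- The tensor product of the Drinfeld center. -/
abbrev zTensor : EFunctor ((ZCat M).prod (ZCat M)) (ZCat M) where
  obj p := p.fst.tensor p.snd
  map p q := ((p.fst.tensor p.snd).homSub (q.fst.tensor q.snd)).factorThru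
    ((p.fst.ι q.fst ⊗ₘ p.snd.ι q.snd) ≫ M.ten p.fst.obj q.fst.obj p.snd.obj q.snd.obj)
    (ZObj.factors_ten p.fst q.fst p.snd q.snd)
  map_id p := by
    rw [← cancel_mono ((p.fst.tensor p.snd).ι (p.fst.tensor p.snd))]
    simp only [Category.assoc, Subobject.factorThru_arrow]
    rw [tensorHom_comp_tensorHom_assoc, Subobject.factorThru_arrow, Subobject.factorThru_arrow]
    exact (Category.assoc _ _ _).symm.trans (M.tensor.map_id ⟨p.fst.obj, p.snd.obj⟩)
  map_comp p q r := by
    rw [← cancel_mono ((p.fst.tensor p.snd).ι (r.fst.tensor r.snd))]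
    simp only [Category.assoc, Subobject.factorThru_arrow]
    rw [tensorHom_comp_tensorHom_assoc, Subobject.factorThru_arrow, Subobject.factorThru_arrow,
      tensorHom_comp_tensorHom_assoc, Subobject.factorThru_arrow, Subobject.factorThru_arrow,
      ← tensorHom_comp_tensorHom, Category.assoc, ← reassoc_of% tensorδ_natural,
      ← tensorHom_comp_tensorHom, Category.assoc]
    refine congrArg (fun k => _ ≫ k) ?_
    exact (Category.assoc _ _ _).symm.trans
      (M.tensor.map_comp ⟨p.fst.obj, p.snd.obj⟩ ⟨q.fst.obj, q.snd.obj⟩ ⟨r.fst.obj, r.snd.obj⟩)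

theorem zTensor_map_arrow (p q : ((ZCat M).prod (ZCat M)).Obj) :
    (zTensor M).map p q ≫ (zForget M).map _ _ =
      (p.fst.ι q.fst ⊗ₘ p.snd.ι q.snd) ≫ M.ten p.fst.obj q.fst.obj p.snd.obj q.snd.obj :=
  Subobject.factorThru_arrow _ _ (ZObj.factors_ten p.fst q.fst p.snd q.snd)

theorem zForget_map₂ {X X' Y Y' : (ZCat M).Obj} (f : X ⟶ X') (g : Y ⟶ Y') :
    (zForget M).und.map ((zTensor M).map₂ f g) =
      (zForget M).und.map f ⊗ₘ (zForget M).und.map g := by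
  apply ECat.hom_ext
  rw [EFunctor.und_map_hom, EFunctor.map₂_hom, EMonCat.tensorHom_hom, Category.assoc,
    Category.assoc, zTensor_map_arrow, tensorHom_comp_tensorHom_assoc]

theorem zForget_zIso {X Y : ZObj M} (f : X.toCenter ≅ Y.toCenter) :
    (zForget M).und.map (zIso f).hom = f.hom.f := zForget_zHom f.hom

theorem Sq.of_zForget {T : B} {a b a' b' : ZObj M} {f : T ⟶ (ZCat M).Hom a b}
    {g : T ⟶ (ZCat M).Hom a' b'} {ξ : a ⟶ a'} {ζ : b ⟶ b'} {F : T ⟶ M.Hom a.obj b.obj}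
    {G : T ⟶ M.Hom a'.obj b'.obj} {Ξ : a.obj ⟶ a'.obj} {Z : b.obj ⟶ b'.obj}
    (hf : f ≫ a.ι b = F) (hg : g ≫ a'.ι b' = G) (hξ : (zForget M).und.map ξ = Ξ)
    (hζ : (zForget M).und.map ζ = Z) (p : Sq M.toECat F G Ξ Z) : Sq (ZCat M) f g ξ ζ := by
  subst hf hg hξ hζ
  exact Sq.of_map (zForget M) p

variable {M}

/-- The left unitor of the Drinfeld center. -/
def zLeftUnitor (X : ZObj M) : (ZObj.unit M).tensor X ≅ X :=
  zIso (Center.leftUnitor X.toCenter)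

/-- The right unitor of the Drinfeld center. -/
def zRightUnitor (X : ZObj M) : X.tensor (ZObj.unit M) ≅ X :=
  zIso (Center.rightUnitor X.toCenter)

/-- The associator of the Drinfeld center. -/
def zAssociator (X Y Z : ZObj M) : (X.tensor Y).tensor Z ≅ X.tensor (Y.tensor Z) :=
  zIso (Center.associator X.toCenter Y.toCenter Z.toCenter)

theorem zForget_leftUnitor (X : ZObj M) :
    (zForget M).und.map (zLeftUnitor X).hom = (λ_ X.obj).hom := zForget_zIso M _

theorem zForget_rightUnitor (X : ZObj M) :
    (zForget M).und.map (zRightUnitor X).hom = (ρ_ X.obj).hom := zForget_zIso M _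

theorem zForget_associator (X Y Z : ZObj M) :
    (zForget M).und.map (zAssociator X Y Z).hom = (α_ X.obj Y.obj Z.obj).hom := zForget_zIso M _

theorem zForget_associator_inv (X Y Z : ZObj M) :
    (zForget M).und.map (zAssociator X Y Z).inv = (α_ X.obj Y.obj Z.obj).inv := by
  rw [← cancel_epi (α_ X.obj Y.obj Z.obj).hom, Iso.hom_inv_id, ← zForget_associator,
    ← CategoryTheory.Functor.map_comp, Iso.hom_inv_id, CategoryTheory.Functor.map_id]

variable (M)

theorem zLeftUnitor_nat : IsENat ((EFunctor.insL (ZObj.unit M) (ZCat M)).comp (zTensor M))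
    (EFunctor.id (ZCat M)) (fun X => (zLeftUnitor X).hom) := fun X Y => by
  refine Sq.of_zForget M (F := X.ι Y ≫ M.lw (𝟙_ M.Obj) X.obj Y.obj) (G := X.ι Y) ?_
    (Category.id_comp _) (zForget_leftUnitor X) (zForget_leftUnitor Y) ?_
  · dsimp only
    rw [Category.assoc, Subobject.factorThru_arrow, Category.assoc, ← reassoc_of% pull_left,
      Subobject.factorThru_arrow, EMonCat.lw_eq, MonoidalCategory.tensorHom_def', Category.assoc,
      leftUnitor_inv_naturality_assoc]
  · rw [Sq, Category.assoc, EMonCat.leftUnitor_nat]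

theorem zRightUnitor_nat : IsENat ((EFunctor.insR (ZCat M) (ZObj.unit M)).comp (zTensor M))
    (EFunctor.id (ZCat M)) (fun X => (zRightUnitor X).hom) := fun X Y => by
  refine Sq.of_zForget M (F := X.ι Y ≫ M.rw (𝟙_ M.Obj) X.obj Y.obj) (G := X.ι Y) ?_
    (Category.id_comp _) (zForget_rightUnitor X) (zForget_rightUnitor Y) ?_
  · dsimp only
    rw [Category.assoc, Subobject.factorThru_arrow, Category.assoc, ← reassoc_of% pull_right,
      Subobject.factorThru_arrow, EMonCat.rw_eq, MonoidalCategory.tensorHom_def, Category.assoc,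
      rightUnitor_inv_naturality_assoc]
  · rw [Sq, Category.assoc, EMonCat.rightUnitor_nat]

theorem zAssociator_nat : IsENat (((zTensor M).prod (EFunctor.id (ZCat M))).comp (zTensor M))
    ((EFunctor.prodAssoc (ZCat M) (ZCat M) (ZCat M)).comp
      (((EFunctor.id (ZCat M)).prod (zTensor M)).comp (zTensor M)))
    (fun p => (zAssociator p.fst.fst p.fst.snd p.snd).hom) := fun p q => by
  refine Sq.of_zForget M ?_ ?_ (zForget_associator _ _ _) (zForget_associator _ _ _)
    (Sq.precomp ((p.fst.fst.ι q.fst.fst ⊗ₘ p.fst.snd.ι q.fst.snd) ⊗ₘ p.snd.ι q.snd)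
      (M.sq_assoc p.fst.fst.obj q.fst.fst.obj p.fst.snd.obj q.fst.snd.obj p.snd.obj q.snd.obj))
  · dsimp only
    rw [Category.assoc, Subobject.factorThru_arrow, tensorHom_comp_tensorHom_assoc,
      Subobject.factorThru_arrow, Category.id_comp, push_left, Category.assoc]
  · dsimp only
    rw [Category.assoc, Category.assoc, Subobject.factorThru_arrow, tensorHom_comp_tensorHom_assoc,
      Subobject.factorThru_arrow, Category.id_comp, push_right, Category.assoc,
      MonoidalCategory.associator_naturality_assoc]

theorem zTriangle (X Y : ZObj M) :
    (zAssociator X (ZObj.unit M) Y).hom ≫ (zTensor M).map₂ (𝟙 X) (zLeftUnitor Y).hom =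
      (zTensor M).map₂ (zRightUnitor X).hom (𝟙 Y) := by
  apply (zForget M).und.map_injective
  rw [CategoryTheory.Functor.map_comp, zForget_map₂, zForget_map₂, zForget_associator,
    zForget_leftUnitor, zForget_rightUnitor, CategoryTheory.Functor.map_id,
    CategoryTheory.Functor.map_id, id_tensorHom, tensorHom_id]
  exact MonoidalCategory.triangle X.obj Y.obj

theorem zPentagon (X Y Z W : ZObj M) :
    (zTensor M).map₂ (zAssociator X Y Z).hom (𝟙 W) ≫ (zAssociator X (Y.tensor Z) W).hom ≫
        (zTensor M).map₂ (𝟙 X) (zAssociator Y Z W).hom =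
      (zAssociator (X.tensor Y) Z W).hom ≫ (zAssociator X Y (Z.tensor W)).hom := by
  apply (zForget M).und.map_injective
  rw [CategoryTheory.Functor.map_comp, CategoryTheory.Functor.map_comp,
    CategoryTheory.Functor.map_comp, zForget_map₂, zForget_map₂, zForget_associator,
    zForget_associator, zForget_associator, zForget_associator, zForget_associator,
    CategoryTheory.Functor.map_id, CategoryTheory.Functor.map_id, id_tensorHom, tensorHom_id]
  exact MonoidalCategory.pentagon X.obj Y.obj Z.obj W.obj

/-- The Drinfeld center of an enriched monoidal category as an enriched monoidal category; the
tensor product, the unitors and the associator are restricted from `M`. -/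
abbrev zMonCat : EMonCat.{max v w} B where
  toECat := ZCat M
  unit := ZObj.unit M
  tensor := zTensor M
  leftUnitor := ⟨zLeftUnitor, zLeftUnitor_nat M⟩
  rightUnitor := ⟨zRightUnitor, zRightUnitor_nat M⟩
  associator := ⟨fun p => zAssociator p.fst.fst p.fst.snd p.snd, zAssociator_nat M⟩
  triangle := zTriangle M
  pentagon := zPentagon M

/-- The braiding `b_{x,y}` of the Drinfeld center. -/
def zBraiding (X Y : ZObj M) : X.tensor Y ≅ Y.tensor X :=
  zIso (Center.braiding X.toCenter Y.toCenter)

theorem zForget_braiding (X Y : ZObj M) :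
    (zForget M).und.map (zBraiding M X Y).hom = (X.half.β Y.obj).hom := zForget_zIso M _

theorem zBraiding_sq (X X' Y Y' : ZObj M) :
    Sq (ZCat M) ((zTensor M).map ⟨X, Y⟩ ⟨X', Y'⟩) ((zTensor M).revMap ⟨X, Y⟩ ⟨X', Y'⟩)
      (zBraiding M X Y).hom (zBraiding M X' Y').hom := by
  have h1 : Sq M.toECat (Y.ι Y' ≫ M.lw X'.obj Y.obj Y'.obj) (Y.ι Y' ≫ M.rw X'.obj Y.obj Y'.obj)
    (X'.half.β Y.obj).hom (X'.half.β Y'.obj).hom := Sq.precomp (Y.ι Y') (X'.sq Y.obj Y'.obj)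
  have h2 := Sq.precomp (β_ _ _).hom (Sq.vcomp (X.sq_ι X' Y.obj) h1)
  rw [← tensorHom_comp_tensorHom, Category.assoc, EMonCat.lw_rw_comp,
    ← tensorHom_comp_tensorHom, Category.assoc, EMonCat.rw_lw_comp,
    ← BraidedCategory.braiding_naturality_assoc, ← BraidedCategory.braiding_naturality_assoc,
    Iso.hom_inv_id_assoc] at h2
  refine Sq.of_zForget M (zTensor_map_arrow M _ _) ?_ (zForget_braiding M X Y)
    (zForget_braiding M X' Y') h2
  dsimp only
  rw [Category.assoc, Subobject.factorThru_arrow, BraidedCategory.braiding_naturality_assoc]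

theorem zHexagon_forward (X Y Z : ZObj M) :
    (zAssociator X Y Z).hom ≫ (zBraiding M X (Y.tensor Z)).hom ≫ (zAssociator Y Z X).hom =
      (zTensor M).map₂ (zBraiding M X Y).hom (𝟙 Z) ≫ (zAssociator Y X Z).hom ≫
        (zTensor M).map₂ (𝟙 Y) (zBraiding M X Z).hom := by
  apply (zForget M).und.map_injective
  rw [CategoryTheory.Functor.map_comp, CategoryTheory.Functor.map_comp,
    CategoryTheory.Functor.map_comp, CategoryTheory.Functor.map_comp, zForget_map₂, zForget_map₂,
    zForget_associator, zForget_associator, zForget_associator, zForget_braiding,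
    zForget_braiding, zForget_braiding,
    CategoryTheory.Functor.map_id, CategoryTheory.Functor.map_id, id_tensorHom, tensorHom_id]
  exact congrArg Center.Hom.f (BraidedCategory.hexagon_forward X.toCenter Y.toCenter Z.toCenter)

theorem zHexagon_reverse (X Y Z : ZObj M) :
    (zAssociator X Y Z).inv ≫ (zBraiding M (X.tensor Y) Z).hom ≫ (zAssociator Z X Y).inv =
      (zTensor M).map₂ (𝟙 X) (zBraiding M Y Z).hom ≫ (zAssociator X Z Y).inv ≫
        (zTensor M).map₂ (zBraiding M X Z).hom (𝟙 Y) := by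
  apply (zForget M).und.map_injective
  rw [CategoryTheory.Functor.map_comp, CategoryTheory.Functor.map_comp,
    CategoryTheory.Functor.map_comp, CategoryTheory.Functor.map_comp, zForget_map₂, zForget_map₂,
    zForget_associator_inv, zForget_associator_inv, zForget_associator_inv, zForget_braiding,
    zForget_braiding, zForget_braiding,
    CategoryTheory.Functor.map_id, CategoryTheory.Functor.map_id, id_tensorHom, tensorHom_id]
  have h := congrArg Center.Hom.f
    (BraidedCategory.hexagon_reverse X.toCenter Y.toCenter Z.toCenter)
  simp only [Center.comp_f, Center.associator_inv_f, Center.whiskerLeft_f,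
    Center.whiskerRight_f] at h
  exact h

/-- The Drinfeld center of an enriched monoidal category, with the braiding `b_{x,y}`. -/
def center : EBraidedCat.{max v w} B where
  toEMonCat := zMonCat M
  comm := isCommutative_of_sq (zTensor M) (zBraiding M) (zBraiding_sq M)
  braiding := ⟨fun p => zBraiding M p.fst p.snd, fun p q => zBraiding_sq M p.fst q.fst p.snd q.snd⟩
  hexagon_forward := zHexagon_forward M
  hexagon_reverse := zHexagon_reverse M

end CenterCat

section SelfEnrichment

variable {B : Type u} [Category.{v} B] [MonoidalCategory B]

/-! ## The canonical self-enrichment of a rigid braided monoidal category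

The left dual of `x`, with unit `𝟙 ⟶ x ⊗ x*` and counit `x* ⊗ x ⟶ 𝟙`, is written `xᘁ` in
Mathlib. -/

/-- The objects of the self-enrichment: the objects of `B`. -/
@[ext]
structure SObj (B : Type u) where
  of : B

namespace SelfEnr

section Rigid

variable [RightRigidCategory B]

/-- The evaluation `(y ⊗ x*) ⊗ x ⟶ y` given by the counit `x* ⊗ x ⟶ 𝟙`. -/
def ev (x y : B) : (y ⊗ xᘁ) ⊗ x ⟶ y := (α_ _ _ _).hom ≫ y ◁ ε_ x xᘁ ≫ (ρ_ y).hom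

theorem ext {T x y : B} {f g : T ⟶ y ⊗ xᘁ} (h : f ▷ x ≫ ev x y = g ▷ x ≫ ev x y) : f = g :=
  (tensorRightHomEquiv T x xᘁ y).symm.injective h

theorem ev_nat (x : B) {y z : B} (f : y ⟶ z) : (f ▷ (xᘁ : B)) ▷ x ≫ ev x z = ev x y ≫ f := by
  simp only [ev, Category.assoc]
  rw [associator_naturality_left_assoc, ← whisker_exchange_assoc, rightUnitor_naturality]

/-- The composition law `(z ⊗ y*) ⊗ (y ⊗ x*) ⟶ z ⊗ x*` induced by the counit `y* ⊗ y ⟶ 𝟙`. -/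
def comp (x y z : B) : (z ⊗ yᘁ) ⊗ (y ⊗ xᘁ) ⟶ z ⊗ xᘁ := (α_ _ y xᘁ).inv ≫ ev y z ▷ (xᘁ : B)

theorem comp_ev (x y z : B) : comp x y z ▷ x ≫ ev x z =
    (α_ _ _ _).hom ≫ (z ⊗ yᘁ) ◁ ev x y ≫ ev y z := by
  rw [comp, comp_whiskerRight, Category.assoc, ev_nat, ← Category.assoc, ← Category.assoc]
  congr 1
  simp only [ev]
  monoidal

theorem id_ev (x : B) : η_ x xᘁ ▷ x ≫ ev x x = (λ_ x).hom := by
  simp [ev]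

theorem comp_id (x y : B) :
    (ρ_ (y ⊗ xᘁ)).inv ≫ (y ⊗ xᘁ) ◁ η_ x xᘁ ≫ comp x x y = 𝟙 _ := by
  apply ext
  simp only [comp_whiskerRight, Category.assoc, comp_ev]
  rw [associator_naturality_middle_assoc, ← MonoidalCategory.whiskerLeft_comp_assoc, id_ev]
  simp

theorem id_comp (x y : B) :
    (λ_ (y ⊗ xᘁ)).inv ≫ η_ y yᘁ ▷ (y ⊗ xᘁ) ≫ comp x y y = 𝟙 _ := by
  apply ext
  simp only [comp_whiskerRight, Category.assoc, comp_ev]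
  rw [associator_naturality_left_assoc, ← whisker_exchange_assoc, id_ev]
  simp

theorem assoc (x y z t : B) : comp y z t ▷ (y ⊗ xᘁ) ≫ comp x y t =
    (α_ _ _ _).hom ≫ (t ⊗ zᘁ) ◁ comp x y z ≫ comp x z t := by
  apply ext
  simp only [comp_whiskerRight, Category.assoc, comp_ev]
  rw [associator_naturality_left_assoc, ← whisker_exchange_assoc, comp_ev,
    associator_naturality_middle_assoc, ← MonoidalCategory.whiskerLeft_comp_assoc, comp_ev]
  simp only [MonoidalCategory.whiskerLeft_comp, Category.assoc]
  rw [associator_naturality_right_assoc, MonoidalCategory.pentagon_assoc]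

/-- The canonical self-enrichment of a rigid monoidal category: `Hom x y = y ⊗ x*`. -/
abbrev eCat (B : Type u) [Category.{v} B] [MonoidalCategory B] [RightRigidCategory B] :
    ECat.{u} B where
  Obj := SObj B
  Hom x y := y.of ⊗ x.ofᘁ
  id x := η_ x.of x.ofᘁ
  comp x y z := comp x.of y.of z.of
  comp_id x y := comp_id x.of y.of
  id_comp x y := id_comp x.of y.of
  assoc x y z t := assoc x.of y.of z.of t.of

instance : Category.{v} (SObj B) := ECat.instCategoryObj (eCat B)

/-- The morphism `𝟙 ⟶ y ⊗ x*` corresponding to a morphism `x ⟶ y` of `B`. -/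
def name {x y : SObj B} (f : x.of ⟶ y.of) : x ⟶ y := ⟨η_ x.of x.ofᘁ ≫ f ▷ (x.ofᘁ : B)⟩

theorem name_ev {x y : SObj B} (f : x.of ⟶ y.of) :
    ECat.UHom.hom (name f) ▷ x.of ≫ ev x.of y.of = (λ_ x.of).hom ≫ f := by
  rw [name, comp_whiskerRight, Category.assoc, ev_nat, ← Category.assoc, id_ev]

theorem post_ev (x : SObj B) {y z : SObj B} (f : y.of ⟶ z.of) :
    (eCat B).post x (name f) ▷ x.of ≫ ev x.of z.of = ev x.of y.of ≫ f := by
  simp only [ECat.post, comp_whiskerRight, Category.assoc, comp_ev]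
  rw [associator_naturality_left_assoc, ← whisker_exchange_assoc, name_ev]
  simp

theorem pre_ev {x y : SObj B} (f : x.of ⟶ y.of) (z : SObj B) :
    (eCat B).pre (name f) z ▷ x.of ≫ ev x.of z.of = (z.of ⊗ y.ofᘁ) ◁ f ≫ ev y.of z.of := by
  simp only [ECat.pre, comp_whiskerRight, Category.assoc, comp_ev]
  rw [associator_naturality_middle_assoc, ← MonoidalCategory.whiskerLeft_comp_assoc, name_ev]
  simp

theorem name_comp {x y z : SObj B} (f : x.of ⟶ y.of) (g : y.of ⟶ z.of) :
    name f ≫ name g = name (f ≫ g) := by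
  apply ECat.hom_ext (C := eCat B)
  apply ext
  rw [ECat.comp_hom_post (eCat B), comp_whiskerRight, Category.assoc, post_ev, ← Category.assoc,
    name_ev, name_ev, Category.assoc]

theorem name_id (x : SObj B) : name (𝟙 x.of) = 𝟙 x := by
  apply ECat.hom_ext (C := eCat B)
  rw [name, ECat.id_hom, id_whiskerRight, Category.comp_id]

/-- Isomorphisms of `B` as isomorphisms of the underlying category of the self-enrichment. -/
def nameIso {x y : SObj B} (f : x.of ≅ y.of) : x ≅ y where
  hom := name f.hom
  inv := name f.inv
  hom_inv_id := by rw [name_comp, Iso.hom_inv_id, name_id]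
  inv_hom_id := by rw [name_comp, Iso.inv_hom_id, name_id]

end Rigid

section BraidedRigid

variable [BraidedCategory B] [RightRigidCategory B]

theorem braiding_counit (x w : B) :
    (β_ (xᘁ : B) w).hom ▷ x ≫ (α_ _ _ _).hom ≫ w ◁ ε_ x xᘁ ≫ (ρ_ w).hom =
      (α_ _ _ _).hom ≫ (xᘁ : B) ◁ (β_ x w).inv ≫ (α_ _ _ _).inv ≫ ε_ x xᘁ ▷ w ≫ (λ_ w).hom := by
  have h := BraidedCategory.braiding_naturality_left (ε_ x xᘁ) w
  rw [braiding_tensor_left_hom, braiding_tensorUnit_left] at h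
  have h' := congrArg (fun k => k ≫ (ρ_ w).hom) h
  simp only [Category.assoc, Iso.inv_hom_id, Category.comp_id] at h'
  rw [h']
  simp

/-- The tensor product `(x' ⊗ x*) ⊗ (y' ⊗ y*) ⟶ (x' ⊗ y') ⊗ (x ⊗ y)*` on hom objects, given by
`1 ⊗ c_{x*, y' ⊗ y*}` and the canonical isomorphism `y* ⊗ x* ≅ (x ⊗ y)*`. -/
def ten (x x' y y' : B) : (x' ⊗ xᘁ) ⊗ (y' ⊗ yᘁ) ⟶ (x' ⊗ y') ⊗ (x ⊗ y)ᘁ :=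
  (α_ _ _ _).hom ≫ x' ◁ ((β_ (xᘁ : B) (y' ⊗ yᘁ)).hom ≫ (α_ _ _ _).hom) ≫ (α_ _ _ _).inv ≫
    (x' ⊗ y') ◁ (rightDualTensorIso x y).inv

theorem dual_counit (x y : B) : (rightDualTensorIso x y).inv ▷ (x ⊗ y) ≫ ε_ (x ⊗ y) (x ⊗ y)ᘁ =
    𝟙 _ ⊗≫ (yᘁ : B) ◁ (ε_ x xᘁ ▷ y) ⊗≫ ε_ y yᘁ := by
  have h := @rightAdjointMate_comp_evaluation B _ _ (x ⊗ y) (x ⊗ y) _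
    (@HasRightDual.mk _ _ _ _ (yᘁ ⊗ xᘁ) ExactPairing.tensor) (𝟙 _)
  refine h.trans ?_
  rw [MonoidalCategory.whiskerLeft_id, Category.id_comp]
  rfl

theorem ten_ev (x x' y y' : B) : ten x x' y y' ▷ (x ⊗ y) ≫ ev (x ⊗ y) (x' ⊗ y') =
    tensorδ (x' ⊗ xᘁ) x (y' ⊗ yᘁ) y ≫ (ev x x' ⊗ₘ ev y y') := by
  calc ten x x' y y' ▷ (x ⊗ y) ≫ ev (x ⊗ y) (x' ⊗ y') =
      𝟙 _ ⊗≫ (x' ◁ ((β_ (xᘁ : B) (y' ⊗ yᘁ)).hom)) ▷ (x ⊗ y) ⊗≫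
        (x' ⊗ y') ◁ ((rightDualTensorIso x y).inv ▷ (x ⊗ y) ≫ ε_ (x ⊗ y) (x ⊗ y)ᘁ) ⊗≫ 𝟙 _ := by
        simp only [ten, ev]; monoidal
    _ = 𝟙 _ ⊗≫ x' ◁ ((β_ (xᘁ : B) (y' ⊗ yᘁ)).hom ▷ x ≫ (α_ _ _ _).hom ≫
          (y' ⊗ (yᘁ : B)) ◁ ε_ x xᘁ ≫ (ρ_ _).hom) ▷ y ⊗≫ x' ◁ (y' ◁ ε_ y yᘁ) ⊗≫ 𝟙 _ := by
        rw [dual_counit]; monoidal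
    _ = 𝟙 _ ⊗≫ (x' ⊗ (xᘁ : B)) ◁ (β_ x (y' ⊗ (yᘁ : B))).inv ▷ y ⊗≫
          (x' ◁ ε_ x xᘁ ▷ ((y' ⊗ (yᘁ : B)) ⊗ y) ≫ x' ◁ (𝟙_ B ◁ (ev y y'))) ⊗≫ 𝟙 _ := by
        rw [braiding_counit]; simp only [ev]; monoidal
    _ = _ := by
        rw [MonoidalCategory.tensorHom_def]
        simp only [tensorδ, ev]
        monoidal

end BraidedRigid

end SelfEnr

end SelfEnrichment

section SelfEnrichmentMonoidal

variable {B : Type u} [Category.{v} B] [MonoidalCategory B] [BraidedCategory B]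
  [RightRigidCategory B]

namespace SelfEnr

theorem ten_id (x y : B) :
    ((λ_ (𝟙_ B)).inv ≫ (η_ x xᘁ ⊗ₘ η_ y yᘁ)) ≫ ten x x y y = η_ (x ⊗ y) (x ⊗ y)ᘁ := by
  apply ext
  rw [comp_whiskerRight, Category.assoc, ten_ev, id_ev]
  have h := tensorδ_post (η_ x xᘁ) (η_ y yᘁ) (ev x x) (ev y y)
  rw [id_ev, id_ev, Iso.inv_hom_id, Iso.inv_hom_id, id_tensorHom_id, Iso.inv_comp_eq,
    Category.comp_id] at h
  exact h

theorem ten_comp (x x' x'' y y' y'' : B) :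
    (tensorδ (x'' ⊗ x'ᘁ) (x' ⊗ xᘁ) (y'' ⊗ y'ᘁ) (y' ⊗ yᘁ) ≫ (comp x x' x'' ⊗ₘ comp y y' y'')) ≫
        ten x x'' y y'' =
      (ten x' x'' y' y'' ⊗ₘ ten x x' y y') ≫ comp (x ⊗ y) (x' ⊗ y') (x'' ⊗ y'') := by
  apply ext
  simp only [comp_whiskerRight, Category.assoc]
  rw [ten_ev, reassoc_of% (tensorδ_natural_left (comp x x' x'') (comp y y' y'') x y),
    tensorHom_comp_tensorHom, comp_ev, comp_ev, ← tensorHom_comp_tensorHom,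
    reassoc_of% (tensorδ_assoc (x'' ⊗ (x'ᘁ : B)) (y'' ⊗ (y'ᘁ : B)) (x' ⊗ (xᘁ : B))
      (y' ⊗ (yᘁ : B)) x y), comp_ev, MonoidalCategory.tensorHom_def' (ten x' x'' y' y''), comp_whiskerRight,
    Category.assoc, associator_naturality_left_assoc, associator_naturality_middle_assoc,
    ← whisker_exchange_assoc, ← MonoidalCategory.whiskerLeft_comp_assoc, ten_ev, ten_ev,
    MonoidalCategory.whiskerLeft_comp, Category.assoc,
    reassoc_of% (tensorδ_natural_right (x'' ⊗ (x'ᘁ : B)) (y'' ⊗ (y'ᘁ : B)) (ev x x') (ev y y')),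
    tensorHom_comp_tensorHom]

/-- The tensor product of the self-enrichment. -/
abbrev tensor (B : Type u) [Category.{v} B] [MonoidalCategory B] [BraidedCategory B]
    [RightRigidCategory B] : EFunctor ((eCat B).prod (eCat B)) (eCat B) where
  obj p := ⟨p.fst.of ⊗ p.snd.of⟩
  map p q := ten p.fst.of q.fst.of p.snd.of q.snd.of
  map_id p := ten_id p.fst.of p.snd.of
  map_comp p q r := ten_comp p.fst.of q.fst.of r.fst.of p.snd.of q.snd.of r.snd.of

theorem map₂_name {x x' y y' : SObj B} (f : x.of ⟶ x'.of) (g : y.of ⟶ y'.of) :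
    (tensor B).map₂ (name f) (name g) =
      name (x := ⟨x.of ⊗ y.of⟩) (y := ⟨x'.of ⊗ y'.of⟩) (f ⊗ₘ g) := by
  apply ECat.hom_ext (C := eCat B)
  apply ext
  rw [name_ev, EFunctor.map₂_hom]
  simp only [comp_whiskerRight, Category.assoc]
  rw [ten_ev]
  have h := tensorδ_post (ECat.UHom.hom (name f)) (ECat.UHom.hom (name g)) (ev x.of x'.of)
    (ev y.of y'.of)
  rw [name_ev, name_ev, Iso.inv_hom_id_assoc, Iso.inv_hom_id_assoc, Iso.inv_comp_eq,
    comp_whiskerRight, Category.assoc] at h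
  exact h

/-- The unit `𝟙 ⟶ x ⊗ x*` of the duality. -/
abbrev u (x : B) : 𝟙_ B ⟶ x ⊗ xᘁ := η_ x xᘁ

theorem leftUnitor_nat (x y : B) :
    (((λ_ (y ⊗ xᘁ)).inv ≫ u (𝟙_ B) ▷ (y ⊗ xᘁ)) ≫ ten (𝟙_ B) (𝟙_ B) x y) ▷ (𝟙_ B ⊗ x) ≫
      ev (𝟙_ B ⊗ x) (𝟙_ B ⊗ y) ≫ (λ_ y).hom = (y ⊗ (xᘁ : B)) ◁ (λ_ x).hom ≫ ev x y := by
  have h := tensorδ_leftUnitor (y ⊗ (xᘁ : B)) x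
  rw [MonoidalCategory.tensorHom_def', Category.assoc] at h
  simp only [comp_whiskerRight, Category.assoc]
  rw [reassoc_of% (ten_ev (𝟙_ B) (𝟙_ B) x y), ← tensorHom_id (u _),
    reassoc_of% (tensorδ_natural_left (u (𝟙_ B)) (𝟙 (y ⊗ (xᘁ : B))) (𝟙_ B) x),
    tensorHom_comp_tensorHom_assoc, id_ev, id_whiskerRight, Category.id_comp,
    MonoidalCategory.tensorHom_def, Category.assoc, leftUnitor_naturality,
    ← cancel_epi ((y ⊗ (xᘁ : B)) ◁ (λ_ x).inv), reassoc_of% h]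
  simp

theorem rightUnitor_nat (x y : B) :
    (((ρ_ (y ⊗ xᘁ)).inv ≫ (y ⊗ (xᘁ : B)) ◁ u (𝟙_ B)) ≫ ten x y (𝟙_ B) (𝟙_ B)) ▷
      (x ⊗ 𝟙_ B) ≫ ev (x ⊗ 𝟙_ B) (y ⊗ 𝟙_ B) ≫ (ρ_ y).hom =
        (y ⊗ (xᘁ : B)) ◁ (ρ_ x).hom ≫ ev x y := by
  have h := tensorδ_rightUnitor (y ⊗ (xᘁ : B)) x
  rw [MonoidalCategory.tensorHom_def', Category.assoc] at h
  simp only [comp_whiskerRight, Category.assoc]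
  rw [reassoc_of% (ten_ev x y (𝟙_ B) (𝟙_ B)), ← id_tensorHom _ (u _),
    reassoc_of% (tensorδ_natural_left (𝟙 (y ⊗ (xᘁ : B))) (u (𝟙_ B)) x (𝟙_ B)),
    tensorHom_comp_tensorHom_assoc, id_ev, id_whiskerRight, Category.id_comp,
    MonoidalCategory.tensorHom_def', Category.assoc, rightUnitor_naturality,
    ← cancel_epi ((y ⊗ (xᘁ : B)) ◁ (ρ_ x).inv), reassoc_of% h]
  simp

theorem associator_nat (x x' y y' z z' : B) :
    ((ten x x' y y' ⊗ₘ 𝟙 (z' ⊗ (zᘁ : B))) ≫ ten (x ⊗ y) (x' ⊗ y') z z') ▷ ((x ⊗ y) ⊗ z) ≫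
        ev ((x ⊗ y) ⊗ z) ((x' ⊗ y') ⊗ z') ≫ (α_ x' y' z').hom =
      ((α_ _ _ _).hom ≫ (𝟙 (x' ⊗ (xᘁ : B)) ⊗ₘ ten y y' z z') ≫
        ten x x' (y ⊗ z) (y' ⊗ z')) ▷ ((x ⊗ y) ⊗ z) ≫ _ ◁ (α_ x y z).hom ≫
          ev (x ⊗ (y ⊗ z)) (x' ⊗ (y' ⊗ z')) := by
  have h := tensorδ_prodAssoc (ev x x') (ev y y') (ev z z')
  simp only [comp_whiskerRight, Category.assoc] at h ⊢
  rw [reassoc_of% (ten_ev (x ⊗ y) (x' ⊗ y') z z'),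
    reassoc_of% (tensorδ_natural_left (ten x x' y y') (𝟙 (z' ⊗ (zᘁ : B)))),
    tensorHom_comp_tensorHom_assoc, ten_ev, id_whiskerRight, Category.id_comp, h,
    ← whisker_exchange_assoc, ten_ev, ← whisker_exchange_assoc,
    reassoc_of% (tensorδ_natural_left (𝟙 (x' ⊗ (xᘁ : B))) (ten y y' z z')),
    tensorHom_comp_tensorHom, ten_ev, id_whiskerRight, Category.id_comp,
    MonoidalCategory.tensorHom_def (α_ _ _ _).hom, Category.assoc]

theorem sq_name {T : B} {a b a' b' : SObj B} {f : T ⟶ (eCat B).Hom a b}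
    {g : T ⟶ (eCat B).Hom a' b'} {ξ : a.of ≅ a'.of} {ζ : b.of ≅ b'.of}
    (h : f ▷ a.of ≫ ev a.of b.of ≫ ζ.hom = g ▷ a.of ≫ _ ◁ ξ.hom ≫ ev a'.of b'.of) :
    Sq (eCat B) f g (nameIso ξ).hom (nameIso ζ).hom := by
  apply ext
  rw [comp_whiskerRight, comp_whiskerRight, Category.assoc, Category.assoc]
  refine Eq.trans (congrArg (CategoryStruct.comp (f ▷ a.of)) (post_ev a ζ.hom)) (h.trans ?_)
  exact (congrArg (CategoryStruct.comp (g ▷ a.of)) (pre_ev ξ.hom b')).symm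

theorem triangle (x y : SObj B) :
    name (x := ⟨(x.of ⊗ 𝟙_ B) ⊗ y.of⟩) (y := ⟨x.of ⊗ (𝟙_ B ⊗ y.of)⟩) (α_ _ _ _).hom ≫
        (tensor B).map₂ (𝟙 x) (name (x := ⟨𝟙_ B ⊗ y.of⟩) (λ_ y.of).hom) =
      (tensor B).map₂ (name (x := ⟨x.of ⊗ 𝟙_ B⟩) (ρ_ x.of).hom) (𝟙 y) := by
  rw [← name_id x, ← name_id y, map₂_name, map₂_name, name_comp, id_tensorHom, tensorHom_id,
    MonoidalCategory.triangle]

theorem pentagon (x y z t : SObj B) :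
    (tensor B).map₂ (name (x := ⟨(x.of ⊗ y.of) ⊗ z.of⟩) (y := ⟨x.of ⊗ (y.of ⊗ z.of)⟩)
          (α_ _ _ _).hom) (𝟙 t) ≫
        name (x := ⟨(x.of ⊗ (y.of ⊗ z.of)) ⊗ t.of⟩) (y := ⟨x.of ⊗ ((y.of ⊗ z.of) ⊗ t.of)⟩)
          (α_ _ _ _).hom ≫
        (tensor B).map₂ (𝟙 x) (name (x := ⟨(y.of ⊗ z.of) ⊗ t.of⟩)
          (y := ⟨y.of ⊗ (z.of ⊗ t.of)⟩) (α_ _ _ _).hom) =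
      name (x := ⟨((x.of ⊗ y.of) ⊗ z.of) ⊗ t.of⟩) (y := ⟨(x.of ⊗ y.of) ⊗ (z.of ⊗ t.of)⟩)
          (α_ _ _ _).hom ≫
        name (x := ⟨(x.of ⊗ y.of) ⊗ (z.of ⊗ t.of)⟩)
          (y := ⟨x.of ⊗ (y.of ⊗ (z.of ⊗ t.of))⟩) (α_ _ _ _).hom := by
  rw [← name_id x, ← name_id t, map₂_name, map₂_name, name_comp, name_comp, name_comp,
    id_tensorHom, tensorHom_id, MonoidalCategory.pentagon]

end SelfEnr

/-- The canonical self-enrichment `B♯` of a rigid braided monoidal category `B` as an enriched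
monoidal category; the unitors and the associator are those of `B`. -/
def selfEnr (B : Type u) [Category.{v} B] [MonoidalCategory B] [BraidedCategory B]
    [RightRigidCategory B] : EMonCat.{u} B where
  toECat := SelfEnr.eCat B
  unit := ⟨𝟙_ B⟩
  tensor := SelfEnr.tensor B
  leftUnitor :=
    { app := fun x => SelfEnr.nameIso (x := ⟨𝟙_ B ⊗ x.of⟩) (λ_ x.of)
      nat := fun x y => by
        apply SelfEnr.sq_name
        exact (SelfEnr.leftUnitor_nat x.of y.of).trans (by simp) }
  rightUnitor :=
    { app := fun x => SelfEnr.nameIso (x := ⟨x.of ⊗ 𝟙_ B⟩) (ρ_ x.of)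
      nat := fun x y => by
        apply SelfEnr.sq_name
        exact (SelfEnr.rightUnitor_nat x.of y.of).trans (by simp) }
  associator :=
    { app := fun p => SelfEnr.nameIso (x := ⟨(p.fst.fst.of ⊗ p.fst.snd.of) ⊗ p.snd.of⟩)
        (y := ⟨p.fst.fst.of ⊗ (p.fst.snd.of ⊗ p.snd.of)⟩) (α_ _ _ _)
      nat := fun p q => by
        apply SelfEnr.sq_name
        exact SelfEnr.associator_nat p.fst.fst.of q.fst.fst.of p.fst.snd.of q.fst.snd.of p.snd.of
          q.snd.of }
  triangle := SelfEnr.triangle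
  pentagon := SelfEnr.pentagon

end SelfEnrichmentMonoidal

section VectorSpaces

variable {B : Type u} [Category.{v} B] [MonoidalCategory B]

/-! ## A linear braided monoidal category as enriched over itself through vector spaces

A finite-dimensional vector space `V` is regarded as the object `V · 𝟙`, a direct sum of `dim V`
copies of the tensor unit. -/

section Copower

variable [Preadditive B] [Linear ℂ B] [HasFiniteBiproducts B]

/-- The object `V · 𝟙` for a finite-dimensional vector space `V`. -/
def vecObj (B : Type u) [Category.{v} B] [MonoidalCategory B] [Preadditive B] [Linear ℂ B]
    [HasFiniteBiproducts B] (V : Type w) [AddCommGroup V] [Module ℂ V] : B :=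
  ⨁ fun _ : Fin (Module.finrank ℂ V) => 𝟙_ B

variable {V : Type w₁} [AddCommGroup V] [Module ℂ V] [Module.Finite ℂ V]
variable {W : Type w₂} [AddCommGroup W] [Module ℂ W] [Module.Finite ℂ W]

section

variable (B : Type u) [Category.{v} B] [MonoidalCategory B] [Preadditive B] [Linear ℂ B]
    [HasFiniteBiproducts B] (V : Type w) [AddCommGroup V] [Module ℂ V]

/-- The inclusions of the summands of `V · 𝟙`. -/
def vecι (i : Fin (Module.finrank ℂ V)) : 𝟙_ B ⟶ vecObj B V := biproduct.ι (fun _ => 𝟙_ B) i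

/-- The projections to the summands of `V · 𝟙`. -/
def vecπ (i : Fin (Module.finrank ℂ V)) : vecObj B V ⟶ 𝟙_ B := biproduct.π (fun _ => 𝟙_ B) i

theorem vecι_π_self (i : Fin (Module.finrank ℂ V)) : vecι B V i ≫ vecπ B V i = 𝟙 _ :=
  biproduct.ι_π_self _ _

theorem vecι_π_ne {i j : Fin (Module.finrank ℂ V)} (h : i ≠ j) : vecι B V i ≫ vecπ B V j = 0 :=
  biproduct.ι_π_ne _ h

theorem vec_total : ∑ i, vecπ B V i ≫ vecι B V i = 𝟙 (vecObj B V) := biproduct.total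

/-- The universal linear map `V ⟶ Hom(𝟙, V · 𝟙)`. -/
def vecPt [Module.Finite ℂ V] : V →ₗ[ℂ] (𝟙_ B ⟶ vecObj B V) where
  toFun x := ∑ i, (Module.finBasis ℂ V).repr x i • vecι B V i
  map_add' x y := by simp [add_smul, Finset.sum_add_distrib]
  map_smul' c x := by simp [mul_smul, Finset.smul_sum]

theorem vecPt_apply [Module.Finite ℂ V] (x : V) :
    vecPt B V x = ∑ i, (Module.finBasis ℂ V).repr x i • vecι B V i := rfl

end

/-- The morphism `V · 𝟙 ⟶ Y` given by a linear map `V ⟶ Hom(𝟙, Y)`. -/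
def vecDesc {Y : B} (φ : V →ₗ[ℂ] (𝟙_ B ⟶ Y)) : vecObj B V ⟶ Y :=
  ∑ i, vecπ B V i ≫ φ (Module.finBasis ℂ V i)

theorem vecPt_π (x : V) (i : Fin (Module.finrank ℂ V)) :
    vecPt B V x ≫ vecπ B V i = (Module.finBasis ℂ V).repr x i • 𝟙 (𝟙_ B) := by
  rw [vecPt_apply, Preadditive.sum_comp]
  simp only [Linear.smul_comp]
  rw [Finset.sum_eq_single i]
  · rw [vecι_π_self]
  · intro j _ hj
    rw [vecι_π_ne B V hj, smul_zero]
  · simp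

theorem vecPt_desc {Y : B} (φ : V →ₗ[ℂ] (𝟙_ B ⟶ Y)) (x : V) :
    vecPt B V x ≫ vecDesc φ = φ x := by
  rw [vecDesc, Preadditive.comp_sum]
  simp only [reassoc_of% (vecPt_π x), Linear.smul_comp, Category.id_comp]
  conv_rhs => rw [← (Module.finBasis ℂ V).sum_repr x]
  simp only [map_sum, map_smul]

theorem vecPt_basis (i : Fin (Module.finrank ℂ V)) :
    vecPt B V (Module.finBasis ℂ V i) = vecι B V i := by
  rw [vecPt_apply]
  simp only [Module.Basis.repr_self]
  rw [Finset.sum_eq_single i]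
  · simp
  · intro j _ hj
    rw [Finsupp.single_eq_of_ne hj, zero_smul]
  · simp

/-- A family of morphisms `𝟙 ⟶ X` such that the identity of `X` is a finite sum of morphisms that
factor through members of the family. -/
def SplitGen {X : B} {I : Type w} (P : I → (𝟙_ B ⟶ X)) : Prop :=
  ∃ (n : ℕ) (q : Fin n → (X ⟶ 𝟙_ B)) (i : Fin n → I), ∑ j, q j ≫ P (i j) = 𝟙 X

theorem SplitGen.ext {X Y : B} {I : Type w} {P : I → (𝟙_ B ⟶ X)} (h : SplitGen P) {f g : X ⟶ Y}
    (e : ∀ i, P i ≫ f = P i ≫ g) : f = g := by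
  obtain ⟨n, q, i, hq⟩ := h
  rw [← Category.id_comp f, ← Category.id_comp g, ← hq, Preadditive.sum_comp,
    Preadditive.sum_comp]
  simp only [Category.assoc, e]

theorem splitGen_vecPt : SplitGen (fun x : V => vecPt B V x) :=
  ⟨_, vecπ B V, fun j => Module.finBasis ℂ V j, by
    simp only [vecPt_basis]
    exact vec_total B V⟩

theorem SplitGen.tensor [MonoidalPreadditive B] {X Y : B} {I : Type w₁} {J : Type w₂}
    {P : I → (𝟙_ B ⟶ X)} {Q : J → (𝟙_ B ⟶ Y)} (hP : SplitGen P) (hQ : SplitGen Q) :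
    SplitGen (fun k : I × J => (λ_ (𝟙_ B)).inv ≫ (P k.1 ⊗ₘ Q k.2)) := by
  obtain ⟨n, q, i, hq⟩ := hP
  obtain ⟨m, r, j, hr⟩ := hQ
  refine ⟨n * m, fun k => (q (finProdFinEquiv.symm k).1 ⊗ₘ r (finProdFinEquiv.symm k).2) ≫
    (λ_ (𝟙_ B)).hom, fun k => (i (finProdFinEquiv.symm k).1, j (finProdFinEquiv.symm k).2), ?_⟩
  rw [← id_tensorHom_id, ← hq, ← hr]
  simp only [Category.assoc, Iso.hom_inv_id_assoc, tensorHom_comp_tensorHom]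
  rw [Equiv.sum_comp finProdFinEquiv.symm
    (fun k : Fin n × Fin m => q k.1 ≫ P (i k.1) ⊗ₘ r k.2 ≫ Q (j k.2)), Fintype.sum_prod_type,
    sum_tensor]
  simp only [tensor_sum]

/-- The morphism `V · 𝟙 ⊗ W · 𝟙 ⟶ Y` given by a bilinear map `V × W ⟶ Hom(𝟙, Y)`. -/
def vecDesc₂ {Y : B} (φ : V →ₗ[ℂ] W →ₗ[ℂ] (𝟙_ B ⟶ Y)) : vecObj B V ⊗ vecObj B W ⟶ Y :=
  ∑ i, (vecπ B V i ⊗ₘ vecDesc (φ (Module.finBasis ℂ V i))) ≫ (λ_ Y).hom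

theorem vecPt_desc₂ [MonoidalPreadditive B] [MonoidalLinear ℂ B] {Y : B}
    (φ : V →ₗ[ℂ] W →ₗ[ℂ] (𝟙_ B ⟶ Y)) (x : V) (y : W) :
    ((λ_ (𝟙_ B)).inv ≫ (vecPt B V x ⊗ₘ vecPt B W y)) ≫ vecDesc₂ φ = φ x y := by
  rw [vecDesc₂, Preadditive.comp_sum]
  simp only [Category.assoc, tensorHom_comp_tensorHom_assoc, vecPt_π, vecPt_desc]
  conv_rhs => rw [← (Module.finBasis ℂ V).sum_repr x]
  rw [map_sum, LinearMap.sum_apply]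
  refine Finset.sum_congr rfl fun i _ => ?_
  rw [map_smul, LinearMap.smul_apply, MonoidalCategory.tensorHom_def,
    MonoidalLinear.smul_whiskerRight]
  simp

end Copower

end VectorSpaces

section VecEnrichment

/-- The objects of the enrichment through vector spaces: the objects of `B`. -/
@[ext]
structure VObj (B : Type u) where
  of : B

namespace VecEnr

variable {B : Type u} [Category.{v} B] [MonoidalCategory B] [Preadditive B] [Linear ℂ B]
  [MonoidalPreadditive B] [MonoidalLinear ℂ B] [HasFiniteBiproducts B]
  [∀ X Y : B, Module.Finite ℂ (X ⟶ Y)]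

/-- The hom object `Hom(x, y) · 𝟙`. -/
abbrev hom (x y : B) : B := vecObj B (x ⟶ y)

/-- The morphism `𝟙 ⟶ Hom(x, y) · 𝟙` corresponding to a morphism `x ⟶ y` of `B`. -/
abbrev pt {x y : B} (f : x ⟶ y) : 𝟙_ B ⟶ hom x y := vecPt B (x ⟶ y) f

/-- The composition law: `g ⊗ f ↦ g ∘ f` on morphisms `f : x ⟶ y` and `g : y ⟶ z`. -/
def comp (x y z : B) : hom y z ⊗ hom x y ⟶ hom x z :=
  vecDesc₂ ((Linear.comp (S := ℂ) x y z).flip.compr₂ (vecPt B (x ⟶ z)))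

theorem comp_pt {x y z : B} (f : x ⟶ y) (g : y ⟶ z) :
    ((λ_ (𝟙_ B)).inv ≫ (pt g ⊗ₘ pt f)) ≫ comp x y z = pt (f ≫ g) :=
  vecPt_desc₂ _ g f

/-- The tensor product: `f ⊗ g ↦ f ⊗ g` on morphisms `f : x ⟶ x'` and `g : y ⟶ y'`. -/
def ten (x x' y y' : B) : hom x x' ⊗ hom y y' ⟶ hom (x ⊗ y) (x' ⊗ y') :=
  vecDesc₂ ((LinearMap.mk₂ ℂ (fun (f : x ⟶ x') (g : y ⟶ y') => f ⊗ₘ g)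
    (fun f f' g => by simp [MonoidalCategory.tensorHom_def, MonoidalPreadditive.add_whiskerRight])
    (fun c f g => by simp [MonoidalCategory.tensorHom_def, MonoidalLinear.smul_whiskerRight])
    (fun f g g' => by simp [MonoidalCategory.tensorHom_def, MonoidalPreadditive.whiskerLeft_add])
    (fun c f g => by simp [MonoidalCategory.tensorHom_def, MonoidalLinear.whiskerLeft_smul])).compr₂
      (vecPt B (x ⊗ y ⟶ x' ⊗ y')))

theorem ten_pt {x x' y y' : B} (f : x ⟶ x') (g : y ⟶ y') :
    ((λ_ (𝟙_ B)).inv ≫ (pt f ⊗ₘ pt g)) ≫ ten x x' y y' = pt (f ⊗ₘ g) :=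
  vecPt_desc₂ _ f g

theorem gen (x y : B) : SplitGen (fun f : x ⟶ y => pt f) := splitGen_vecPt

theorem comp_id (x y : B) :
    (ρ_ (hom x y)).inv ≫ hom x y ◁ pt (𝟙 x) ≫ comp x x y = 𝟙 _ := by
  apply (gen x y).ext
  intro f
  have h := comp_pt (𝟙 x) f
  rw [Category.id_comp, MonoidalCategory.tensorHom_def, Category.assoc, Category.assoc,
    unitors_inv_equal] at h
  rw [rightUnitor_inv_naturality_assoc, h, Category.comp_id]

theorem id_comp (x y : B) :
    (λ_ (hom x y)).inv ≫ pt (𝟙 y) ▷ hom x y ≫ comp x y y = 𝟙 _ := by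
  apply (gen x y).ext
  intro f
  have h := comp_pt f (𝟙 y)
  rw [Category.comp_id, MonoidalCategory.tensorHom_def', Category.assoc, Category.assoc] at h
  rw [leftUnitor_inv_naturality_assoc, h, Category.comp_id]

theorem probe_left {X X' Y Z : B} (a : 𝟙_ B ⟶ X) (b : 𝟙_ B ⟶ Y) (f : X ⟶ X') (k : X' ⊗ Y ⟶ Z) :
    ((λ_ (𝟙_ B)).inv ≫ (a ⊗ₘ b)) ≫ f ▷ Y ≫ k = ((λ_ (𝟙_ B)).inv ≫ (a ≫ f ⊗ₘ b)) ≫ k := by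
  rw [push_left]
  simp only [Category.assoc]

theorem probe_right {X Y Y' Z : B} (a : 𝟙_ B ⟶ X) (b : 𝟙_ B ⟶ Y) (f : Y ⟶ Y') (k : X ⊗ Y' ⟶ Z) :
    ((λ_ (𝟙_ B)).inv ≫ (a ⊗ₘ b)) ≫ X ◁ f ≫ k = ((λ_ (𝟙_ B)).inv ≫ (a ⊗ₘ b ≫ f)) ≫ k := by
  rw [push_right]
  simp only [Category.assoc]

theorem assoc (x y z t : B) : comp y z t ▷ hom x y ≫ comp x y t =
    (α_ _ _ _).hom ≫ hom z t ◁ comp x y z ≫ comp x z t := by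
  apply (((gen z t).tensor (gen y z)).tensor (gen x y)).ext
  rintro ⟨⟨h, g⟩, f⟩
  dsimp only
  rw [probe_left, comp_pt, comp_pt, ← Category.assoc ((λ_ (𝟙_ B)).inv ≫ _), unit_assoc,
    probe_right, comp_pt, comp_pt, Category.assoc]

/-- The linear category `B` as enriched over itself: `Hom x y = Hom(x, y) · 𝟙`. -/
abbrev eCat (B : Type u) [Category.{v} B] [MonoidalCategory B] [Preadditive B] [Linear ℂ B]
    [MonoidalPreadditive B] [MonoidalLinear ℂ B] [HasFiniteBiproducts B]
    [∀ X Y : B, Module.Finite ℂ (X ⟶ Y)] : ECat.{u} B where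
  Obj := VObj B
  Hom x y := hom x.of y.of
  id x := pt (𝟙 x.of)
  comp x y z := comp x.of y.of z.of
  comp_id x y := comp_id x.of y.of
  id_comp x y := id_comp x.of y.of
  assoc x y z t := assoc x.of y.of z.of t.of

instance : Category.{v} (VObj B) := ECat.instCategoryObj (eCat B)

/-- Morphisms of `B` as morphisms of the underlying category of the enrichment. -/
def name {x y : VObj B} (f : x.of ⟶ y.of) : x ⟶ y := ⟨pt f⟩

theorem name_comp {x y z : VObj B} (f : x.of ⟶ y.of) (g : y.of ⟶ z.of) :
    name f ≫ name g = name (f ≫ g) :=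
  ECat.hom_ext (C := eCat B) _ _ ((Category.assoc _ _ _).symm.trans (comp_pt f g))

theorem name_id (x : VObj B) : name (𝟙 x.of) = 𝟙 x := rfl

theorem pt_post (x : VObj B) {y z : VObj B} (k : x.of ⟶ y.of) (f : y.of ⟶ z.of) :
    pt k ≫ (eCat B).post x (name f) = pt (k ≫ f) :=
  (ECat.comp_hom_post (eCat B) (name k) (name f)).symm.trans
    (congrArg ECat.UHom.hom (name_comp k f))

theorem pt_pre {x y : VObj B} (f : x.of ⟶ y.of) {z : VObj B} (k : y.of ⟶ z.of) :
    pt k ≫ (eCat B).pre (name f) z = pt (f ≫ k) :=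
  (ECat.comp_hom_pre (eCat B) (name f) (name k)).symm.trans
    (congrArg ECat.UHom.hom (name_comp f k))

/-- Isomorphisms of `B` as isomorphisms of the underlying category of the enrichment. -/
def nameIso {x y : VObj B} (f : x.of ≅ y.of) : x ≅ y where
  hom := name f.hom
  inv := name f.inv
  hom_inv_id := by rw [name_comp, Iso.hom_inv_id, name_id]
  inv_hom_id := by rw [name_comp, Iso.inv_hom_id, name_id]

theorem sq_name {T : B} {I : Type w} {P : I → (𝟙_ B ⟶ T)} (hP : SplitGen P) {a b a' b' : VObj B}
    {f : T ⟶ (eCat B).Hom a b} {g : T ⟶ (eCat B).Hom a' b'} {ξ : a.of ≅ a'.of} {ζ : b.of ≅ b'.of}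
    (F : I → (a.of ⟶ b.of)) (G : I → (a'.of ⟶ b'.of)) (hF : ∀ i, P i ≫ f = pt (F i))
    (hG : ∀ i, P i ≫ g = pt (G i)) (h : ∀ i, F i ≫ ζ.hom = ξ.hom ≫ G i) :
    Sq (eCat B) f g (nameIso ξ).hom (nameIso ζ).hom := by
  apply hP.ext
  intro i
  rw [← Category.assoc, ← Category.assoc, hF, hG]
  exact (pt_post a (F i) ζ.hom).trans ((congrArg pt (h i)).trans (pt_pre ξ.hom (G i)).symm)

section Braided

variable [BraidedCategory B]

theorem probe_tensorδ {X Y Z W : B} (a : 𝟙_ B ⟶ X) (b : 𝟙_ B ⟶ Y) (c : 𝟙_ B ⟶ Z)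
    (d : 𝟙_ B ⟶ W) :
    ((λ_ (𝟙_ B)).inv ≫ ((λ_ (𝟙_ B)).inv ≫ (a ⊗ₘ b) ⊗ₘ (λ_ (𝟙_ B)).inv ≫ (c ⊗ₘ d))) ≫
        tensorδ X Z Y W =
      (λ_ (𝟙_ B)).inv ≫ ((λ_ (𝟙_ B)).inv ≫ (a ⊗ₘ c) ⊗ₘ (λ_ (𝟙_ B)).inv ≫ (b ⊗ₘ d)) := by
  have h := tensorδ_leftUnitor (𝟙_ B) (𝟙_ B)
  rw [← tensorHom_comp_tensorHom, ← tensorHom_comp_tensorHom, Category.assoc, Category.assoc,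
    tensorδ_natural, reassoc_of% h]
  simp only [← Category.assoc]
  congr 1
  rw [MonoidalCategory.tensorHom_def']
  simp only [Category.assoc]
  monoidal

/-- The tensor product of the enrichment. -/
abbrev tensor (B : Type u) [Category.{v} B] [MonoidalCategory B] [Preadditive B] [Linear ℂ B]
    [MonoidalPreadditive B] [MonoidalLinear ℂ B] [HasFiniteBiproducts B]
    [∀ X Y : B, Module.Finite ℂ (X ⟶ Y)] [BraidedCategory B] :
    EFunctor ((eCat B).prod (eCat B)) (eCat B) where
  obj p := ⟨p.fst.of ⊗ p.snd.of⟩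
  map p q := ten p.fst.of q.fst.of p.snd.of q.snd.of
  map_id p := by rw [ten_pt, id_tensorHom_id]
  map_comp p q r := by
    apply (((gen q.fst.of r.fst.of).tensor (gen q.snd.of r.snd.of)).tensor
      ((gen p.fst.of q.fst.of).tensor (gen p.snd.of q.snd.of))).ext
    rintro ⟨⟨f', g'⟩, ⟨f, g⟩⟩
    dsimp only
    rw [← Category.assoc, ← Category.assoc, probe_tensorδ, Category.assoc _ _ (comp _ _ _ ⊗ₘ _),
      tensorHom_comp_tensorHom, comp_pt, comp_pt, ten_pt, ← Category.assoc,
      Category.assoc _ _ (ten _ _ _ _ ⊗ₘ _), tensorHom_comp_tensorHom, ten_pt, ten_pt, comp_pt,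
      tensorHom_comp_tensorHom]

theorem map₂_name {x x' y y' : VObj B} (f : x.of ⟶ x'.of) (g : y.of ⟶ y'.of) :
    (tensor B).map₂ (name f) (name g) =
      name (x := ⟨x.of ⊗ y.of⟩) (y := ⟨x'.of ⊗ y'.of⟩) (f ⊗ₘ g) :=
  ECat.hom_ext (C := eCat B) _ _ (ten_pt f g)

theorem triangle (x y : VObj B) :
    name (x := ⟨(x.of ⊗ 𝟙_ B) ⊗ y.of⟩) (y := ⟨x.of ⊗ (𝟙_ B ⊗ y.of)⟩) (α_ _ _ _).hom ≫
        (tensor B).map₂ (𝟙 x) (name (x := ⟨𝟙_ B ⊗ y.of⟩) (λ_ y.of).hom) =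
      (tensor B).map₂ (name (x := ⟨x.of ⊗ 𝟙_ B⟩) (ρ_ x.of).hom) (𝟙 y) := by
  rw [← name_id x, ← name_id y, map₂_name, map₂_name, name_comp, id_tensorHom, tensorHom_id,
    MonoidalCategory.triangle]

theorem pentagon (x y z t : VObj B) :
    (tensor B).map₂ (name (x := ⟨(x.of ⊗ y.of) ⊗ z.of⟩) (y := ⟨x.of ⊗ (y.of ⊗ z.of)⟩)
          (α_ _ _ _).hom) (𝟙 t) ≫
        name (x := ⟨(x.of ⊗ (y.of ⊗ z.of)) ⊗ t.of⟩) (y := ⟨x.of ⊗ ((y.of ⊗ z.of) ⊗ t.of)⟩)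
          (α_ _ _ _).hom ≫
        (tensor B).map₂ (𝟙 x) (name (x := ⟨(y.of ⊗ z.of) ⊗ t.of⟩)
          (y := ⟨y.of ⊗ (z.of ⊗ t.of)⟩) (α_ _ _ _).hom) =
      name (x := ⟨((x.of ⊗ y.of) ⊗ z.of) ⊗ t.of⟩) (y := ⟨(x.of ⊗ y.of) ⊗ (z.of ⊗ t.of)⟩)
          (α_ _ _ _).hom ≫
        name (x := ⟨(x.of ⊗ y.of) ⊗ (z.of ⊗ t.of)⟩)
          (y := ⟨x.of ⊗ (y.of ⊗ (z.of ⊗ t.of))⟩) (α_ _ _ _).hom := by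
  rw [← name_id x, ← name_id t, map₂_name, map₂_name, name_comp, name_comp, name_comp,
    id_tensorHom, tensorHom_id, MonoidalCategory.pentagon]

/-- The linear monoidal category `B` as a monoidal category enriched over itself. -/
abbrev monCat (B : Type u) [Category.{v} B] [MonoidalCategory B] [Preadditive B] [Linear ℂ B]
    [MonoidalPreadditive B] [MonoidalLinear ℂ B] [HasFiniteBiproducts B]
    [∀ X Y : B, Module.Finite ℂ (X ⟶ Y)] [BraidedCategory B] : EMonCat.{u} B where
  toECat := eCat B
  unit := ⟨𝟙_ B⟩
  tensor := tensor B
  leftUnitor :=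
    { app := fun x => nameIso (x := ⟨𝟙_ B ⊗ x.of⟩) (λ_ x.of)
      nat := fun x y => by
        refine sq_name (gen x.of y.of) (fun f => 𝟙 (𝟙_ B) ⊗ₘ f) (fun f => f) ?_ ?_ ?_
        · intro f
          rw [← ten_pt, MonoidalCategory.tensorHom_def']
          simp only [Category.assoc, leftUnitor_inv_naturality_assoc]
        · intro f
          exact Category.comp_id _
        · intro f
          simp }
  rightUnitor :=
    { app := fun x => nameIso (x := ⟨x.of ⊗ 𝟙_ B⟩) (ρ_ x.of)
      nat := fun x y => by
        refine sq_name (gen x.of y.of) (fun f => f ⊗ₘ 𝟙 (𝟙_ B)) (fun f => f) ?_ ?_ ?_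
        · intro f
          rw [← ten_pt, MonoidalCategory.tensorHom_def, unitors_inv_equal]
          simp only [Category.assoc, rightUnitor_inv_naturality_assoc]
        · intro f
          exact Category.comp_id _
        · intro f
          simp }
  associator :=
    { app := fun p => nameIso (x := ⟨(p.fst.fst.of ⊗ p.fst.snd.of) ⊗ p.snd.of⟩)
        (y := ⟨p.fst.fst.of ⊗ (p.fst.snd.of ⊗ p.snd.of)⟩) (α_ _ _ _)
      nat := fun p q => by
        refine sq_name (((gen p.fst.fst.of q.fst.fst.of).tensor
          (gen p.fst.snd.of q.fst.snd.of)).tensor (gen p.snd.of q.snd.of))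
          (fun k => (k.1.1 ⊗ₘ k.1.2) ⊗ₘ k.2) (fun k => k.1.1 ⊗ₘ (k.1.2 ⊗ₘ k.2)) ?_ ?_ ?_
        · rintro ⟨⟨f, g⟩, h⟩
          dsimp only
          rw [tensorHom_id, probe_left, ten_pt, ten_pt]
        · rintro ⟨⟨f, g⟩, h⟩
          dsimp only
          rw [← Category.assoc, unit_assoc, id_tensorHom, probe_right, ten_pt, ten_pt]
        · rintro ⟨⟨f, g⟩, h⟩
          exact MonoidalCategory.associator_naturality f g h }
  triangle := triangle
  pentagon := pentagon

theorem braiding_sq (x x' y y' : VObj B) :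
    Sq (eCat B) ((tensor B).map ⟨x, y⟩ ⟨x', y'⟩) ((tensor B).revMap ⟨x, y⟩ ⟨x', y'⟩)
      (nameIso (x := ⟨x.of ⊗ y.of⟩) (y := ⟨y.of ⊗ x.of⟩) (β_ x.of y.of)).hom
      (nameIso (x := ⟨x'.of ⊗ y'.of⟩) (y := ⟨y'.of ⊗ x'.of⟩) (β_ x'.of y'.of)).hom := by
  refine sq_name ((gen x.of x'.of).tensor (gen y.of y'.of)) (fun k => k.1 ⊗ₘ k.2)
    (fun k => k.2 ⊗ₘ k.1) ?_ ?_ ?_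
  · rintro ⟨f, g⟩
    exact ten_pt f g
  · rintro ⟨f, g⟩
    dsimp only
    rw [Category.assoc, BraidedCategory.braiding_naturality_assoc, ← ten_pt]
    simp only [braiding_tensorUnit_left, Category.assoc, Iso.inv_hom_id_assoc]
    rw [unitors_inv_equal]
  · rintro ⟨f, g⟩
    exact BraidedCategory.braiding_naturality f g

theorem hexagon_forward (x y z : VObj B) :
    name (x := ⟨(x.of ⊗ y.of) ⊗ z.of⟩) (y := ⟨x.of ⊗ (y.of ⊗ z.of)⟩) (α_ _ _ _).hom ≫
        name (y := ⟨(y.of ⊗ z.of) ⊗ x.of⟩) (β_ x.of (y.of ⊗ z.of)).hom ≫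
        name (y := ⟨y.of ⊗ (z.of ⊗ x.of)⟩) (α_ _ _ _).hom =
      (tensor B).map₂ (name (x := ⟨x.of ⊗ y.of⟩) (y := ⟨y.of ⊗ x.of⟩) (β_ x.of y.of).hom) (𝟙 z) ≫
        name (x := ⟨(y.of ⊗ x.of) ⊗ z.of⟩) (y := ⟨y.of ⊗ (x.of ⊗ z.of)⟩) (α_ _ _ _).hom ≫
        (tensor B).map₂ (𝟙 y)
          (name (x := ⟨x.of ⊗ z.of⟩) (y := ⟨z.of ⊗ x.of⟩) (β_ x.of z.of).hom) := by
  rw [← name_id z, ← name_id y, map₂_name, map₂_name, name_comp, name_comp, name_comp, name_comp,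
    id_tensorHom, tensorHom_id, BraidedCategory.hexagon_forward]

theorem hexagon_reverse (x y z : VObj B) :
    name (x := ⟨x.of ⊗ (y.of ⊗ z.of)⟩) (y := ⟨(x.of ⊗ y.of) ⊗ z.of⟩) (α_ _ _ _).inv ≫
        name (y := ⟨z.of ⊗ (x.of ⊗ y.of)⟩) (β_ (x.of ⊗ y.of) z.of).hom ≫
        name (y := ⟨(z.of ⊗ x.of) ⊗ y.of⟩) (α_ _ _ _).inv =
      (tensor B).map₂ (𝟙 x) (name (x := ⟨y.of ⊗ z.of⟩) (y := ⟨z.of ⊗ y.of⟩) (β_ y.of z.of).hom) ≫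
        name (x := ⟨x.of ⊗ (z.of ⊗ y.of)⟩) (y := ⟨(x.of ⊗ z.of) ⊗ y.of⟩) (α_ _ _ _).inv ≫
        (tensor B).map₂
          (name (x := ⟨x.of ⊗ z.of⟩) (y := ⟨z.of ⊗ x.of⟩) (β_ x.of z.of).hom) (𝟙 y) := by
  rw [← name_id x, ← name_id y, map₂_name, map₂_name, name_comp, name_comp, name_comp, name_comp,
    id_tensorHom, tensorHom_id, BraidedCategory.hexagon_reverse]

end Braided

end VecEnr

/-- A linear braided monoidal category `B` with finite-dimensional hom spaces as a braided monoidal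
category enriched over itself: the hom objects are `Hom(x, y) · 𝟙`, and the identities, the
composition, the tensor product, the unitors, the associator and the braiding are those of `B`. -/
def vecEnr (B : Type u) [Category.{v} B] [MonoidalCategory B] [Preadditive B] [Linear ℂ B]
    [MonoidalPreadditive B] [MonoidalLinear ℂ B] [HasFiniteBiproducts B]
    [∀ X Y : B, Module.Finite ℂ (X ⟶ Y)] [BraidedCategory B] : EBraidedCat.{u} B where
  toEMonCat := VecEnr.monCat B
  comm := isCommutative_of_sq (VecEnr.tensor B)
    (fun x y => VecEnr.nameIso (x := ⟨x.of ⊗ y.of⟩) (y := ⟨y.of ⊗ x.of⟩) (β_ x.of y.of))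
    VecEnr.braiding_sq
  braiding :=
    { app := fun p => VecEnr.nameIso (x := ⟨p.fst.of ⊗ p.snd.of⟩) (y := ⟨p.snd.of ⊗ p.fst.of⟩)
        (β_ p.fst.of p.snd.of)
      nat := fun p q => VecEnr.braiding_sq p.fst q.fst p.snd q.snd }
  hexagon_forward := VecEnr.hexagon_forward
  hexagon_reverse := VecEnr.hexagon_reverse

end VecEnrichment


section Fusion

/-! ## Nondegenerate braided fusion categories -/

attribute [local instance] CategoryTheory.Abelian.hasFiniteBiproducts

/-- An abelian `ℂ`-linear monoidal category is fusion (rigidity and the bilinearity of `⊗` being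
stated by the classes `RigidCategory`, `MonoidalPreadditive` and `MonoidalLinear`) if it is
semisimple with finitely many simple objects up to isomorphism, finite-dimensional hom spaces and
simple tensor unit. -/
class IsFusion (B : Type u) [Category.{v} B] [Abelian B] [Linear ℂ B] [MonoidalCategory B]
    [MonoidalPreadditive B] [MonoidalLinear ℂ B] [RigidCategory B] : Prop where
  semisimple : ∀ X : B, ∃ (n : ℕ) (S : Fin n → B), (∀ i, Simple (S i)) ∧ Nonempty (X ≅ ⨁ S)
  finite_simples : ∃ (n : ℕ) (S : Fin n → B), (∀ i, Simple (S i)) ∧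
    ∀ X : B, Simple X → ∃ i, Nonempty (X ≅ S i)
  finite_dim : ∀ X Y : B, FiniteDimensional ℂ (X ⟶ Y)
  simple_unit : Simple (𝟙_ B)

/-- A simple object that braids trivially with every object is isomorphic to the tensor unit. -/
def IsNondegenerate (B : Type u) [Category.{v} B] [HasZeroMorphisms B] [MonoidalCategory B]
    [BraidedCategory B] : Prop :=
  ∀ X : B, Simple X → (∀ Y : B, (β_ X Y).hom ≫ (β_ Y X).hom = 𝟙 (X ⊗ Y)) → Nonempty (X ≅ 𝟙_ B)

section Intersections

variable {B : Type u} [Category.{v} B] [Abelian B] [Linear ℂ B]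

/-- The maps from `S` to `X` that factor through the subobject `m` of `X`. -/
def factorsSubmodule (S : B) {X : B} (m : Subobject X) : Submodule ℂ (S ⟶ X) where
  carrier := {f | m.Factors f}
  add_mem' := fun {f g} hf hg => Subobject.factors_add f g hf hg
  zero_mem' := Subobject.factors_zero
  smul_mem' := fun c f hf => by
    change m.Factors (c • f)
    rw [← m.factorThru_arrow f hf, ← Linear.smul_comp]
    exact Subobject.factors_comp_arrow _

theorem exists_intersection_of_fusion [MonoidalCategory B] [MonoidalPreadditive B]
    [MonoidalLinear ℂ B] [RigidCategory B] [IsFusion B] {X : B} (S : Set (Subobject X)) :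
    ∃ m : Subobject X, ∀ {T : B} (f : T ⟶ X), m.Factors f ↔ ∀ s ∈ S, s.Factors f := by
  obtain ⟨n, G, -, hG⟩ := IsFusion.finite_simples (B := B)
  have hfd : ∀ X Y : B, FiniteDimensional ℂ (X ⟶ Y) := IsFusion.finite_dim
  let V : Subobject X → ∀ k : Fin n, Submodule ℂ (G k ⟶ X) := fun m k => factorsSubmodule (G k) m
  have hV : ∀ m m' : Subobject X, V m ≤ V m' ↔ m ≤ m' := by
    intro m m'
    refine ⟨fun h => ?_, fun h k f hf => Subobject.factors_of_le f h hf⟩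
    apply Subobject.le_of_factors
    obtain ⟨r, A, hA, ⟨e⟩⟩ := IsFusion.semisimple (m : B)
    have key : ∀ i, m'.Factors (biproduct.ι A i ≫ e.inv ≫ m.arrow) := by
      intro i
      obtain ⟨k, ⟨j⟩⟩ := hG (A i) (hA i)
      have h₁ : m.Factors (j.inv ≫ biproduct.ι A i ≫ e.inv ≫ m.arrow) := by
        simpa only [Category.assoc] using
          Subobject.factors_comp_arrow (P := m) (j.inv ≫ biproduct.ι A i ≫ e.inv)
      have h₂ : m'.Factors (j.inv ≫ biproduct.ι A i ≫ e.inv ≫ m.arrow) := h k h₁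
      simpa using Subobject.factors_of_factors_right j.hom h₂
    have h₃ : m.arrow = e.hom ≫ biproduct.desc
        (fun i => m'.factorThru _ (key i)) ≫ m'.arrow := by
      rw [← Iso.inv_comp_eq]
      ext i
      simp
    rw [h₃, ← Category.assoc]
    exact Subobject.factors_comp_arrow _
  have wf : WellFoundedLT (Subobject X) :=
    (OrderEmbedding.ofMapLEIff V hV).wellFoundedLT
  obtain ⟨m, ⟨t, ht, rfl⟩, hmin⟩ := wf.wf.has_min
    {m : Subobject X | ∃ t : Finset (Subobject X), (∀ s ∈ t, s ∈ S) ∧ m = t.inf id}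
    ⟨_, ∅, by simp, rfl⟩
  refine ⟨t.inf id, fun {T} f => ⟨fun hf s hs => ?_, fun hf => ?_⟩⟩
  · classical
    have hle : (insert s t).inf id ≤ t.inf id := Finset.inf_mono (Finset.subset_insert _ _)
    have heq : (insert s t).inf id = t.inf id :=
      (lt_or_eq_of_le hle).resolve_left (hmin _ ⟨insert s t, by simpa [hs] using ht, rfl⟩)
    refine Subobject.factors_of_le f ?_ hf
    rw [← heq]
    exact Finset.inf_le (f := id) (Finset.mem_insert_self s t)
  · rw [Subobject.finset_inf_factors]
    exact fun s hs => hf s (ht s hs)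

instance hasIntersections_of_fusion [MonoidalCategory B] [MonoidalPreadditive B]
    [MonoidalLinear ℂ B] [RigidCategory B] [IsFusion B] : HasIntersections B where
  hasEqualizers := inferInstance
  exists_intersection := exists_intersection_of_fusion

end Intersections

/-- A braided fusion category as a braided monoidal category enriched over itself. -/
def fusionEnr (B : Type u) [Category.{v} B] [Abelian B] [Linear ℂ B] [MonoidalCategory B]
    [MonoidalPreadditive B] [MonoidalLinear ℂ B] [BraidedCategory B] [RigidCategory B]
    [IsFusion B] : EBraidedCat.{u} B :=
  haveI : ∀ X Y : B, Module.Finite ℂ (X ⟶ Y) := IsFusion.finite_dim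
  vecEnr B

end Fusion

end EnrichedCenter

end

/-! Write [x, y] = y ⊗ x* for the hom objects of B♯. Tensoring on the right by z acts on [x, y]
without any braiding, while tensoring on the left by z has to carry z past [x, y] and so brings in
an inverse braiding (`rwMap_ev`, `lwMap_ev`). Everything follows from this asymmetry.

Objects of the center. The braiding of B is an enriched half-braiding on every x, by naturality and
a hexagon (`lwMap_braiding`). It is the only one: the enriched naturality square for [1, z]
expresses b_{x,z} through b_{x,1}, because evaluation [1, z] ⊗ 1 ⟶ z is a split epimorphism, and
b_{x,1} is forced by the unitors (`eq_braiding`, `half_eq`). So an object of the center is just an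
object of B, and since the braiding is natural, its morphisms are all morphisms of B (`centerHom`,
`exists_zName`).

Hom objects of the center. With all half-braidings equal to the braiding, a map f : T ⟶ [x, y]
equalizes the two maps attached to z exactly when c_{T,z} and the inverse of c_{z,T} agree after z ⊗
f; the direction needed is `transparent_of_ev`. For the inclusion of the hom object, z ⊗ f is monic
by rigidity, so the hom object braids trivially with everything (`transparent_homSub`).
Nondegeneracy makes it a direct sum of copies of 1 (`splitGen_of_transparent`). Its points 1 ⟶
Z(B♯)(x, y) are the morphisms x ⟶ y of B, and End(1) = ℂ, so it is Hom(x, y)·1 (`isIso_homMap`).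

The equivalence. On both sides the identity of each hom object is a finite sum of maps factoring
through points, so points are jointly epic and enriched naturality is ordinary naturality on
underlying categories (`IsENat.of_naturality`, `EFunctor.μ_nat`). It remains to give mutually
inverse enriched functors, one of them braided. Forgetting the half-braiding is strictly monoidal,
and it is braided because the braiding of the center is the half-braiding, hence that of B. The
braided structure on the inverse and the monoidality of the unit and counit are then formal
(`EBraidedEquiv.ofPointGenerated`). -/

noncomputable section

namespace EnrichedCenter

/-! ### Transport of a braided monoidal structure to the inverse of an equivalence. -/

section BraidedEquivalence

variable {C : Type w₁} [Category.{v} C] [MonoidalCategory C] [BraidedCategory C]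
  {D : Type w₂} [Category.{v} D] [MonoidalCategory D] [BraidedCategory D]

/-- The inverse of a braided monoidal equivalence is braided. -/
@[reducible]
def inverseBraided (e : C ≌ D) [e.functor.Braided] [e.inverse.Monoidal] [e.IsMonoidal] :
    e.inverse.Braided where
  toMonoidal := inferInstance
  braided X Y := by
    apply e.functor.map_injective
    -- The counit is invertible, so the two sides may be compared after it. There the image of μ of
    -- the inverse is expressed through δ of the functor and the counit, and the compatibility of
    -- the functor with braidings applies.
    rw [← cancel_mono (e.counitIso.hom.app _), Functor.map_comp, Functor.map_comp,
      Category.assoc, Category.assoc,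
      e.functor_map_μ_inverse_comp_counitIso_hom_app_tensor, e.functor.map_braiding]
    have h := e.counitIso.hom.naturality (β_ X Y).hom
    dsimp at h
    rw [h, ← Category.assoc, e.functor_map_μ_inverse_comp_counitIso_hom_app_tensor]
    simp

/-- The structure on the inverse is the one that a right adjoint of a monoidal functor inherits, and
for that structure the adjunction is monoidal. -/
theorem isMonoidal_inverseMonoidal (e : C ≌ D) [e.functor.Monoidal] :
    letI := e.inverseMonoidal
    e.IsMonoidal := by
  let := e.toAdjunction.rightAdjointLaxMonoidal
  have h : e.toAdjunction.IsMonoidal := inferInstance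
  exact ⟨h.1, h.2⟩

theorem isMonoidal_unit (e : C ≌ D) [e.functor.Braided] [e.inverse.Monoidal] [e.IsMonoidal] :
    NatTrans.IsMonoidal e.unit := inferInstance

theorem isMonoidal_counit (e : C ≌ D) [e.functor.Braided] [e.inverse.Monoidal] [e.IsMonoidal] :
    NatTrans.IsMonoidal e.counit := inferInstance

end BraidedEquivalence

/-! ### Enriched categories whose hom objects are generated by their points. -/

section PointGenerated

variable {B : Type u} [Category.{v} B] [MonoidalCategory B] [Preadditive B] [Linear ℂ B]
  [HasFiniteBiproducts B]

/-- The hom objects of an enriched category are direct summands of finite sums of the unit. -/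
def ECat.PointGenerated (C : ECat.{w} B) : Prop :=
  ∀ x y : C.Obj, SplitGen (fun f : x ⟶ y => ECat.UHom.hom f)

/-- Points are jointly epic on the hom objects of the source, and an enriched naturality square
precomposed with the point f is the ordinary naturality square at f. -/
theorem IsENat.of_naturality {C : ECat.{w₁} B} {D : ECat.{w₂} B} (hC : C.PointGenerated)
    {F G : EFunctor C D} {ξ : ∀ x, F.obj x ⟶ G.obj x}
    (h : ∀ {x y : C.Obj} (f : x ⟶ y), F.und.map f ≫ ξ y = ξ x ≫ G.und.map f) :
    IsENat F G ξ := fun x y => by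
  apply (hC x y).ext
  intro f
  have e := congrArg ECat.UHom.hom (h f)
  rw [ECat.comp_hom_post, ECat.comp_hom_pre, EFunctor.und_map_hom, EFunctor.und_map_hom,
    Category.assoc, Category.assoc] at e
  exact e

theorem EFunctor.id_und_map {C : ECat.{w₁} B} {x y : C.Obj} (f : x ⟶ y) :
    (EFunctor.id C).und.map f = f :=
  ECat.hom_ext _ _ (Category.comp_id _)

theorem EFunctor.comp_und_map {C : ECat.{w₁} B} {D : ECat.{w₂} B} {E : ECat.{w₃} B}
    (F : EFunctor C D) (G : EFunctor D E) {x y : C.Obj} (f : x ⟶ y) :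
    (F.comp G).und.map f = G.und.map (F.und.map f) :=
  ECat.hom_ext _ _ (Category.assoc _ _ _).symm

variable [BraidedCategory B] [MonoidalPreadditive B]

/-- The square lives on a tensor product of two hom objects, where pairs of points are jointly epic
by `SplitGen.tensor`. On a pair it is the naturality of μ for the underlying functor. -/
theorem EFunctor.μ_nat {C : EBraidedCat.{w₁} B} {D : EBraidedCat.{w₂} B}
    (hC : C.toECat.PointGenerated) (F : EFunctor C.toECat D.toECat) [F.und.LaxMonoidal] :
    IsENat ((F.prod F).comp D.tensor) (C.tensor.comp F)
      (fun p => Functor.LaxMonoidal.μ F.und p.fst p.snd) := fun p q => by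
  apply ((hC p.fst q.fst).tensor (hC p.snd q.snd)).ext
  rintro ⟨f, g⟩
  have e := congrArg ECat.UHom.hom (Functor.LaxMonoidal.μ_natural F.und f g)
  rw [ECat.comp_hom_post, ECat.comp_hom_pre, EFunctor.und_map_hom, EMonCat.tensorHom_hom,
    EMonCat.tensorHom_hom, EFunctor.und_map_hom, EFunctor.und_map_hom,
    ← tensorHom_comp_tensorHom] at e
  simp only [Category.assoc] at e ⊢
  exact e

/-- Mutually inverse enriched functors between enriched braided monoidal categories with point
generated hom objects are an equivalence of enriched braided monoidal categories as soon as one of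
them is braided monoidal. -/
def EBraidedEquiv.ofPointGenerated {C : EBraidedCat.{w₁} B} {D : EBraidedCat.{w₂} B}
    (hC : C.toECat.PointGenerated) (hD : D.toECat.PointGenerated)
    (F : EFunctor C.toECat D.toECat) (G : EFunctor D.toECat C.toECat) (hF : F.und.Braided)
    (i : 𝟭 C.Obj ≅ F.und ⋙ G.und) (j : G.und ⋙ F.und ≅ 𝟭 D.Obj)
    (h : ∀ x, F.und.map (i.hom.app x) ≫ j.hom.app (F.obj x) = 𝟙 (F.obj x)) : EBraidedEquiv C D :=
  let e : C.Obj ≌ D.Obj := ⟨F.und, G.und, i, j, h⟩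
  letI : e.functor.Braided := hF
  -- The inverse receives the structure determined by the adjunction. This choice is what makes the
  -- unit and counit monoidal.
  letI : e.inverse.Monoidal := e.inverseMonoidal
  haveI : e.IsMonoidal := isMonoidal_inverseMonoidal e
  letI hG : G.und.Braided := inverseBraided e
  { F := ⟨F, hF, F.μ_nat hC⟩
    G := ⟨G, hG, G.μ_nat hD⟩
    unitIso := e.unitIso
    unit_nat := IsENat.of_naturality hC fun f => by
      rw [EFunctor.id_und_map, EFunctor.comp_und_map]
      exact e.unitIso.hom.naturality f
    unit_monoidal := isMonoidal_unit e
    counitIso := e.counitIso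
    counit_nat := IsENat.of_naturality hD fun f => by
      rw [EFunctor.id_und_map, EFunctor.comp_und_map]
      exact e.counitIso.hom.naturality f
    counit_monoidal := isMonoidal_counit e }

end PointGenerated

/-! ### Tensoring by an object on the hom objects of B♯, and uniqueness of enriched half-braidings.
-/

section SelfEnrichedCenter

variable {B : Type u} [Category.{v} B] [MonoidalCategory B] [BraidedCategory B]
  [RightRigidCategory B]

namespace SelfEnr

/-- The morphism of `B` underlying a morphism of the self-enrichment. -/
def unname {x y : SObj B} (f : x ⟶ y) : x.of ⟶ y.of :=
  (λ_ x.of).inv ≫ ECat.UHom.hom f ▷ x.of ≫ ev x.of y.of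

theorem unname_name {x y : SObj B} (f : x.of ⟶ y.of) : unname (name f) = f := by
  rw [unname, name_ev, Iso.inv_hom_id_assoc]

theorem name_unname {x y : SObj B} (f : x ⟶ y) : name (unname f) = f := by
  apply ECat.hom_ext (C := eCat B)
  apply ext
  rw [name_ev, unname, Iso.hom_inv_id_assoc]

theorem name_injective {x y : SObj B} {f g : x.of ⟶ y.of} (h : name (x := x) (y := y) f = name g) :
    f = g := by
  rw [← unname_name (x := x) (y := y) f, h, unname_name]

/-- The action of `z ⊗ -` on the hom objects of the self-enrichment. -/
def lwMap (z x y : B) : y ⊗ xᘁ ⟶ (z ⊗ y) ⊗ (z ⊗ x)ᘁ :=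
  (λ_ _).inv ≫ u z ▷ (y ⊗ (xᘁ : B)) ≫ ten z z x y

/-- The action of `- ⊗ z` on the hom objects of the self-enrichment. -/
def rwMap (z x y : B) : y ⊗ xᘁ ⟶ (y ⊗ z) ⊗ (x ⊗ z)ᘁ :=
  (ρ_ _).inv ≫ (y ⊗ (xᘁ : B)) ◁ u z ≫ ten x y z z

theorem lw_eq (z x y : SObj B) : (selfEnr B).lw z x y = lwMap z.of x.of y.of :=
  (selfEnr B).lw_eq z x y

theorem rw_eq (z x y : SObj B) : (selfEnr B).rw z x y = rwMap z.of x.of y.of :=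
  (selfEnr B).rw_eq z x y

/-- By `ten_ev`, evaluating a tensor product means interchanging and evaluating each factor. The
factor z ⊗ z* comes from the unit of the duality and evaluates to the identity; what survives of the
interchange is the crossing of z with y ⊗ x*. -/
theorem lwMap_ev (z x y : B) : lwMap z x y ▷ (z ⊗ x) ≫ ev (z ⊗ x) (z ⊗ y) =
    (α_ _ _ _).inv ≫ (β_ z (y ⊗ xᘁ)).inv ▷ x ≫ (α_ _ _ _).hom ≫ z ◁ ev x y := by
  rw [lwMap]
  simp only [comp_whiskerRight, Category.assoc]
  rw [ten_ev, ← tensorHom_id (u _),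
    reassoc_of% (tensorδ_natural_left (u z) (𝟙 (y ⊗ (xᘁ : B))) z x),
    tensorHom_comp_tensorHom, id_ev, id_whiskerRight, Category.id_comp]
  simp only [tensorδ, MonoidalCategory.tensorHom_def]
  monoidal

/-- Here the interchange only crosses x with the tensor unit, so no braiding survives, in contrast
with `lwMap_ev`. -/
theorem rwMap_ev (z x y : B) : rwMap z x y ▷ (x ⊗ z) ≫ ev (x ⊗ z) (y ⊗ z) =
    (α_ _ _ _).inv ≫ ev x y ▷ z := by
  rw [rwMap]
  simp only [comp_whiskerRight, Category.assoc]
  rw [ten_ev, ← id_tensorHom _ (u _),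
    reassoc_of% (tensorδ_natural_left (𝟙 (y ⊗ (xᘁ : B))) (u z) x z),
    tensorHom_comp_tensorHom, id_ev, id_whiskerRight, Category.id_comp]
  simp only [tensorδ, MonoidalCategory.tensorHom_def, braiding_inv_tensorUnit_right]
  monoidal

/-- Transposing along evaluation turns squares in B♯ into equations in B. Unlike in `sq_name`, the
sides need not be invertible and both directions are available; the converse extracts information
from a given half-braiding. -/
theorem sq_name_iff {T : B} {a b a' b' : SObj B} {f : T ⟶ (eCat B).Hom a b}
    {g : T ⟶ (eCat B).Hom a' b'} {ξ : a.of ⟶ a'.of} {ζ : b.of ⟶ b'.of} :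
    Sq (eCat B) f g (name ξ) (name ζ) ↔
      f ▷ a.of ≫ ev a.of b.of ≫ ζ = g ▷ a.of ≫ _ ◁ ξ ≫ ev a'.of b'.of := by
  have e₁ : (f ≫ (eCat B).post a (name ζ)) ▷ a.of ≫ ev a.of b'.of =
      f ▷ a.of ≫ ev a.of b.of ≫ ζ := by
    rw [comp_whiskerRight, Category.assoc]
    exact congrArg (CategoryStruct.comp (f ▷ a.of)) (post_ev a ζ)
  have e₂ : (g ≫ (eCat B).pre (name ξ) b') ▷ a.of ≫ ev a.of b'.of =
      g ▷ a.of ≫ _ ◁ ξ ≫ ev a'.of b'.of := by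
    rw [comp_whiskerRight, Category.assoc]
    exact congrArg (CategoryStruct.comp (g ▷ a.of)) (pre_ev ξ b')
  rw [← e₁, ← e₂]
  exact ⟨fun h => congrArg (fun k => k ▷ a.of ≫ ev a.of b'.of) h, fun h => ext h⟩

/-- Naturality slides the braiding with x over the evaluation, and the hexagon splits it into the
crossings of x with z' ⊗ z* and with z. The first cancels the inverse braiding contributed by
`lwMap`; the second is the braiding on the other side. -/
theorem lwMap_braiding (x z z' : B) :
    lwMap x z z' ▷ (x ⊗ z) ≫ ev (x ⊗ z) (x ⊗ z') ≫ (β_ x z').hom =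
      rwMap x z z' ▷ (x ⊗ z) ≫ _ ◁ (β_ x z).hom ≫ ev (z ⊗ x) (z' ⊗ x) := by
  rw [reassoc_of% lwMap_ev, ← whisker_exchange_assoc, rwMap_ev,
    BraidedCategory.braiding_naturality_right, braiding_tensor_right_hom]
  simp

/-- The braiding of `B` is an enriched natural half-braiding. -/
theorem sq_braiding (x z z' : SObj B) :
    Sq (selfEnr B).toECat ((selfEnr B).lw x z z') ((selfEnr B).rw x z z')
      (name (x := ⟨x.of ⊗ z.of⟩) (y := ⟨z.of ⊗ x.of⟩) (β_ x.of z.of).hom)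
      (name (x := ⟨x.of ⊗ z'.of⟩) (y := ⟨z'.of ⊗ x.of⟩) (β_ x.of z'.of).hom) := by
  rw [lw_eq, rw_eq]
  exact sq_name_iff.2 (lwMap_braiding x.of z.of z'.of)

/-- Surjectivity half of the duality adjunction, whose injectivity half is `ext`. -/
theorem exists_ev {T x y : B} (f : T ⊗ x ⟶ y) : ∃ k : T ⟶ y ⊗ xᘁ, k ▷ x ≫ ev x y = f :=
  (tensorRightHomEquiv T x xᘁ y).symm.surjective f

/-- Half-braiding components `x ⊗ z ⟶ z ⊗ x` that satisfy the enriched naturality and are trivial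
at the tensor unit are given by the braiding. -/
theorem eq_braiding (x z : B) (b₁ : x ⊗ 𝟙_ B ⟶ 𝟙_ B ⊗ x) (b : x ⊗ z ⟶ z ⊗ x)
    (h₁ : b₁ = (ρ_ x).hom ≫ (λ_ x).inv)
    (h : lwMap x (𝟙_ B) z ▷ (x ⊗ 𝟙_ B) ≫ ev (x ⊗ 𝟙_ B) (x ⊗ z) ≫ b =
      rwMap x (𝟙_ B) z ▷ (x ⊗ 𝟙_ B) ≫ _ ◁ b₁ ≫ ev (𝟙_ B ⊗ x) (z ⊗ x)) : b = (β_ x z).hom := by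
  subst h₁
  have h' := lwMap_braiding x (𝟙_ B) z
  have e : (β_ x (𝟙_ B)).hom = (ρ_ x).hom ≫ (λ_ x).inv := by simp
  -- The braiding satisfies the same square with the same component at the unit, so b and the
  -- braiding agree after a common map.
  rw [e, ← h] at h'
  simp only [reassoc_of% lwMap_ev] at h'
  -- Two associators and an inverse braiding cancel, leaving x ⊗ ev as the common map.
  rw [cancel_epi, cancel_epi, cancel_epi] at h'
  -- Transposing the right unitor of z shows that evaluation at the tensor unit is a split
  -- epimorphism, so x ⊗ ev cancels as well.
  obtain ⟨k, hk⟩ := exists_ev (ρ_ z).hom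
  have h'' := congrArg (fun t => x ◁ (k ▷ 𝟙_ B) ≫ t) h'
  simp only [← MonoidalCategory.whiskerLeft_comp_assoc, hk] at h''
  rw [cancel_epi] at h''
  exact h''.symm

end SelfEnr

end SelfEnrichedCenter

/-- Allows the actions and half-braidings occurring in a square of B♯ to be replaced by their
descriptions in B, after which `sq_name_iff` applies. -/
theorem Sq.congr {B : Type u} [Category.{v} B] [MonoidalCategory B] {C : ECat.{w} B} {T : B}
    {a b a' b' : C.Obj} {f f' : T ⟶ C.Hom a b} {g g' : T ⟶ C.Hom a' b'} {ξ ξ' : a ⟶ a'}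
    {ζ ζ' : b ⟶ b'} (p : Sq C f g ξ ζ) (hf : f = f') (hg : g = g') (hξ : ξ = ξ') (hζ : ζ = ζ') :
    Sq C f' g' ξ' ζ' := by
  subst hf hg hξ hζ
  exact p

/-! ### Objects of the center are objects of B, and its hom objects are transparent. -/

section SelfEnrichedHalfBraiding

variable {B : Type u} [Category.{v} B] [MonoidalCategory B] [BraidedCategory B]
  [RightRigidCategory B]

namespace SelfEnr

theorem whiskerLeft_name (x : SObj B) {y y' : SObj B} (g : y.of ⟶ y'.of) :
    MonoidalCategoryStruct.whiskerLeft (C := (selfEnr B).Obj) x (name g) =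
      name (x := ⟨x.of ⊗ y.of⟩) (y := ⟨x.of ⊗ y'.of⟩) (x.of ◁ g) := by
  rw [← id_tensorHom, ← map₂_name, name_id]
  rfl

theorem whiskerRight_name {x x' : SObj B} (f : x.of ⟶ x'.of) (y : SObj B) :
    MonoidalCategoryStruct.whiskerRight (C := (selfEnr B).Obj) (name f) y =
      name (x := ⟨x.of ⊗ y.of⟩) (y := ⟨x'.of ⊗ y.of⟩) (f ▷ y.of) := by
  rw [← tensorHom_id, ← map₂_name, name_id]
  rfl

/-- The half-braiding on an object of the self-enrichment given by the braiding of `B`. -/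
def halfBraiding (x : B) : HalfBraiding (C := (selfEnr B).Obj) (⟨x⟩ : SObj B) where
  β z := nameIso (x := ⟨x ⊗ SObj.of z⟩) (y := ⟨SObj.of z ⊗ x⟩) (β_ x (SObj.of z))
  monoidal z z' := by
    -- The monoidality of the half-braiding is the hexagon for the braiding of x with z ⊗ z',
    -- carried to B♯ factor by factor.
    have h := congrArg (name (x := ⟨x ⊗ (SObj.of z ⊗ SObj.of z')⟩)
      (y := ⟨(SObj.of z ⊗ SObj.of z') ⊗ x⟩)) (braiding_tensor_right_hom x (SObj.of z) (SObj.of z'))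
    refine h.trans ?_
    rw [← name_comp (y := ⟨(x ⊗ SObj.of z) ⊗ SObj.of z'⟩),
      ← name_comp (y := ⟨(SObj.of z ⊗ x) ⊗ SObj.of z'⟩),
      ← name_comp (y := ⟨SObj.of z ⊗ (x ⊗ SObj.of z')⟩),
      ← name_comp (y := ⟨SObj.of z ⊗ (SObj.of z' ⊗ x)⟩)]
    exact congrArg₂ (fun s t => _ ≫ s ≫ _ ≫ t ≫ _)
      (whiskerRight_name (x := ⟨x ⊗ SObj.of z⟩) (x' := ⟨SObj.of z ⊗ x⟩) _ z').symm
      (whiskerLeft_name z (y := ⟨x ⊗ SObj.of z'⟩) (y' := ⟨SObj.of z' ⊗ x⟩) _).symm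
  naturality {z z'} f := by
    obtain ⟨g, rfl⟩ : ∃ g : SObj.of z ⟶ SObj.of z', name (x := z) (y := z') g = f :=
      ⟨_, name_unname f⟩
    refine (congrArg (fun t => t ≫ _) (whiskerLeft_name (⟨x⟩ : SObj B) g)).trans
      (Eq.trans ?_ (congrArg (fun t => _ ≫ t) (whiskerRight_name g (⟨x⟩ : SObj B))).symm)
    refine (name_comp (x := ⟨x ⊗ SObj.of z⟩) (y := ⟨x ⊗ SObj.of z'⟩) (z := ⟨SObj.of z' ⊗ x⟩)
      _ _).trans (Eq.trans ?_ (name_comp (x := ⟨x ⊗ SObj.of z⟩) (y := ⟨SObj.of z ⊗ x⟩)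
        (z := ⟨SObj.of z' ⊗ x⟩) _ _).symm)
    exact congrArg (name (x := ⟨x ⊗ SObj.of z⟩) (y := ⟨SObj.of z' ⊗ x⟩))
      (BraidedCategory.braiding_naturality_right x g)

/-- An object of `B` as an object of the Drinfeld center of the self-enrichment. -/
abbrev zOf (x : B) : ZObj (selfEnr B) where
  obj := (⟨x⟩ : SObj B)
  half := halfBraiding x
  nat z z' := sq_braiding (⟨x⟩ : SObj B) z z'

/-- The object of `B` underlying an object of the Drinfeld center of the self-enrichment. -/
abbrev base (X : ZObj (selfEnr B)) : B := SObj.of X.obj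

/-- In the braided center of the underlying monoidal category this component is the braiding with
the unit object, and a braiding with the unit is determined by the unitors. -/
theorem half_unit (X : ZObj (selfEnr B)) :
    (X.half.β (𝟙_ (selfEnr B).Obj)).hom = (ρ_ X.obj).hom ≫ (λ_ X.obj).inv := by
  have h := congrArg Center.Hom.f (braiding_tensorUnit_right X.toCenter)
  rw [Center.comp_f, Center.rightUnitor_hom_f, Center.leftUnitor_inv_f] at h
  exact h

/-- The half-braidings of the Drinfeld center of the self-enrichment are given by the braiding of
`B`. -/
theorem half_eq (X : ZObj (selfEnr B)) (z : SObj B) :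
    (X.half.β z).hom =
      name (x := ⟨base X ⊗ z.of⟩) (y := ⟨z.of ⊗ base X⟩) (β_ (base X) z.of).hom := by
  let b (z : SObj B) : base X ⊗ z.of ⟶ z.of ⊗ base X :=
    unname (x := ⟨base X ⊗ z.of⟩) (y := ⟨z.of ⊗ base X⟩) (X.half.β z).hom
  have hb (z : SObj B) : (X.half.β z).hom =
    name (x := ⟨base X ⊗ z.of⟩) (y := ⟨z.of ⊗ base X⟩) (b z) := (name_unname _).symm
  have h₁ : b ⟨𝟙_ B⟩ = (ρ_ (base X)).hom ≫ (λ_ (base X)).inv := by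
    apply name_injective (x := ⟨base X ⊗ 𝟙_ B⟩) (y := ⟨𝟙_ B ⊗ base X⟩)
    rw [← name_comp (y := ⟨base X⟩), ← hb ⟨𝟙_ B⟩]
    exact half_unit X
  -- Of all the enriched naturality squares only those on hom objects out of the tensor unit are
  -- used.
  have h := X.sq (⟨𝟙_ B⟩ : SObj B) z
  have h' := h.congr (lw_eq _ _ _) (rw_eq _ _ _) (hb ⟨𝟙_ B⟩) (hb z)
  rw [hb, eq_braiding (base X) z.of (b ⟨𝟙_ B⟩) (b z) h₁ (sq_name_iff.1 h')]

/-- Every morphism of `B` is a morphism of the Drinfeld center of the self-enrichment. -/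
def centerHom {X Y : ZObj (selfEnr B)} (f : base X ⟶ base Y) : X.toCenter ⟶ Y.toCenter where
  f := name (x := X.obj) (y := Y.obj) f
  comm z := by
    refine (congrArg₂ (fun s t => s ≫ t) (whiskerRight_name f z) (half_eq Y z)).trans
      (Eq.trans ?_ (congrArg₂ (fun s t => s ≫ t) (half_eq X z) (whiskerLeft_name z f)).symm)
    refine (name_comp (x := ⟨base X ⊗ SObj.of z⟩) (y := ⟨base Y ⊗ SObj.of z⟩)
      (z := ⟨SObj.of z ⊗ base Y⟩) _ _).trans (Eq.trans ?_ (name_comp (x := ⟨base X ⊗ SObj.of z⟩)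
        (y := ⟨SObj.of z ⊗ base X⟩) (z := ⟨SObj.of z ⊗ base Y⟩) _ _).symm)
    exact congrArg (name (x := ⟨base X ⊗ SObj.of z⟩) (y := ⟨SObj.of z ⊗ base Y⟩))
      (BraidedCategory.braiding_naturality_left f (SObj.of z))

/-- The hypothesis is the equalizer condition at z, transposed along evaluation. On the side of
`rwMap`, naturality and the hexagon produce the braiding of y ⊗ x* past z; on the side of `lwMap`
the inverse of the opposite braiding is already there. The crossing of x with z is common to both
sides and cancels. -/
theorem transparent_of_ev {T x y : B} (f : T ⟶ y ⊗ xᘁ) (z : B)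
    (h : (f ≫ rwMap z x y) ▷ (x ⊗ z) ≫ ev (x ⊗ z) (y ⊗ z) ≫ (β_ y z).hom =
      (f ≫ lwMap z x y) ▷ (x ⊗ z) ≫ _ ◁ (β_ x z).hom ≫ ev (z ⊗ x) (z ⊗ y)) :
    (β_ T z).hom ≫ z ◁ f = (β_ z T).inv ≫ z ◁ f := by
  -- A map into z ⊗ (y ⊗ x*) is determined by its evaluation on x, as one sees by reassociating to
  -- (z ⊗ y) ⊗ x*.
  have key : ∀ {a b : T ⊗ z ⟶ z ⊗ (y ⊗ (xᘁ : B))},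
      a ▷ x ≫ (α_ _ _ _).hom ≫ z ◁ ev x y = b ▷ x ≫ (α_ _ _ _).hom ≫ z ◁ ev x y → a = b := by
    intro a b hab
    rw [← cancel_mono (α_ z y (xᘁ : B)).inv]
    apply ext
    have e : (α_ z y (xᘁ : B)).inv ▷ x ≫ ev x (z ⊗ y) = (α_ _ _ _).hom ≫ z ◁ ev x y := by
      simp only [ev]
      monoidal
    rw [comp_whiskerRight, comp_whiskerRight, Category.assoc, Category.assoc, e]
    exact hab
  apply key
  -- Both crossings are moved from T to y ⊗ x*, where the equalizer condition speaks.
  rw [← BraidedCategory.braiding_naturality_left, ← BraidedCategory.braiding_inv_naturality_left]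
  have h₁ := rwMap_ev z x y
  have h₂ := lwMap_ev z x y
  rw [← whisker_exchange_assoc, comp_whiskerRight, comp_whiskerRight, Category.assoc,
    Category.assoc, reassoc_of% h₁, h₂, BraidedCategory.braiding_naturality_left,
    braiding_tensor_left_hom] at h
  -- Restores the invertible crossing of x with z with which both sides of the equalizer condition
  -- begin.
  rw [← cancel_epi (α_ T z x).inv, ← cancel_epi (T ◁ (β_ x z).hom)]
  simp only [comp_whiskerRight, Category.assoc]
  simp only [Category.assoc, Iso.inv_hom_id_assoc] at h
  rw [← whisker_exchange_assoc] at h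
  rw [← associator_inv_naturality_left_assoc, ← associator_inv_naturality_left_assoc]
  exact h

/-- Factoring through the intersection means satisfying every equalizer condition, and by `half_eq`
the half-braidings in it are braidings of B. -/
theorem transparent_of_factors [HasIntersections B] {X Y : ZObj (selfEnr B)} {T : B}
    (f : T ⟶ base Y ⊗ (base X)ᘁ) (h : (X.homSub Y).Factors f) (z : B) :
    (β_ T z).hom ≫ z ◁ f = (β_ z T).inv ≫ z ◁ f := by
  have h' := (X.homSub_factors_iff Y f).1 h (⟨z⟩ : SObj B)
  have h'' := h'.congr (congrArg (fun k => f ≫ k) (rw_eq _ _ _))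
    (congrArg (fun k => f ≫ k) (lw_eq _ _ _)) (half_eq X ⟨z⟩) (half_eq Y ⟨z⟩)
  exact transparent_of_ev f z (sq_name_iff.1 h'')

end SelfEnr

end SelfEnrichedHalfBraiding

/-! ### Morphisms and hom objects of the center of B♯. -/

section CenterPoints

variable {B : Type u} [Category.{v} B] [MonoidalCategory B] [BraidedCategory B]
  [RightRigidCategory B] [HasIntersections B]

namespace SelfEnr

/-- Morphisms of `B` as morphisms of the Drinfeld center of the self-enrichment. -/
def zName {X Y : ZObj (selfEnr B)} (f : base X ⟶ base Y) : X ⟶ Y := zHom (centerHom f)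

theorem zForget_zName {X Y : ZObj (selfEnr B)} (f : base X ⟶ base Y) :
    (zForget (selfEnr B)).und.map (zName f) = name (x := X.obj) (y := Y.obj) f :=
  zForget_zHom (centerHom f)

theorem zName_ι {X Y : ZObj (selfEnr B)} (f : base X ⟶ base Y) :
    ECat.UHom.hom (zName f) ≫ X.ι Y = ECat.UHom.hom (name (x := X.obj) (y := Y.obj) f) :=
  congrArg ECat.UHom.hom (zForget_zName f)

/-- Faithfulness of the forgetful functor. This is how the structure morphisms of the center are
recognised as those of B. -/
theorem eq_zName {X Y : ZObj (selfEnr B)} {f : X ⟶ Y} {g : base X ⟶ base Y}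
    (h : (zForget (selfEnr B)).und.map f = name (x := X.obj) (y := Y.obj) g) : f = zName g :=
  (zForget (selfEnr B)).und.map_injective (h.trans (zForget_zName g).symm)

theorem exists_zName {X Y : ZObj (selfEnr B)} (f : X ⟶ Y) :
    ∃ g : base X ⟶ base Y, f = zName g :=
  ⟨unname ((zForget (selfEnr B)).und.map f), eq_zName (name_unname _).symm⟩

theorem zName_injective {X Y : ZObj (selfEnr B)} {f g : base X ⟶ base Y}
    (h : zName (X := X) (Y := Y) f = zName g) : f = g := by
  apply name_injective (x := X.obj) (y := Y.obj)
  rw [← zForget_zName, h, zForget_zName]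

theorem zName_id (X : ZObj (selfEnr B)) : zName (𝟙 (base X)) = 𝟙 X :=
  (eq_zName (((zForget (selfEnr B)).und.map_id X).trans (name_id X.obj).symm)).symm

theorem zName_comp {X Y Z : ZObj (selfEnr B)} (f : base X ⟶ base Y) (g : base Y ⟶ base Z) :
    zName f ≫ zName g = zName (X := X) (Y := Z) (f ≫ g) := by
  apply eq_zName
  refine ((zForget (selfEnr B)).und.map_comp (zName f) (zName g)).trans ?_
  rw [zForget_zName, zForget_zName]
  exact name_comp f g

theorem tensorHom_zName {X X' Y Y' : ZObj (selfEnr B)} (f : base X ⟶ base X')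
    (g : base Y ⟶ base Y') : (zTensor (selfEnr B)).map₂ (zName f) (zName g) =
      zName (X := X.tensor Y) (Y := X'.tensor Y') (f ⊗ₘ g) := by
  apply eq_zName
  refine (zForget_map₂ (selfEnr B) (zName f) (zName g)).trans ?_
  rw [zForget_zName, zForget_zName]
  exact map₂_name f g

/-- The braiding of the center is by definition the half-braiding, which `half_eq` identifies with
the braiding of B. -/
theorem zBraiding_eq (X Y : ZObj (selfEnr B)) : (zBraiding (selfEnr B) X Y).hom =
    zName (X := X.tensor Y) (Y := Y.tensor X) (β_ (base X) (base Y)).hom :=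
  eq_zName ((zForget_braiding (selfEnr B) X Y).trans (half_eq X Y.obj))

/-- Isomorphisms of `B` as isomorphisms of the Drinfeld center of the self-enrichment. -/
def zNameIso {X Y : ZObj (selfEnr B)} (f : base X ≅ base Y) : X ≅ Y where
  hom := zName f.hom
  inv := zName f.inv
  hom_inv_id := by rw [zName_comp, Iso.hom_inv_id, zName_id]
  inv_hom_id := by rw [zName_comp, Iso.inv_hom_id, zName_id]

end SelfEnr

/-- In a rigid category tensoring preserves monomorphisms. -/
theorem mono_whiskerLeft (z : B) {x y : B} (f : x ⟶ y) [Mono f] : Mono (z ◁ f) := by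
  have : (tensorLeft z).IsRightAdjoint := (tensorLeftAdjunction z zᘁ).isRightAdjoint
  exact inferInstanceAs (Mono ((tensorLeft z).map f))

/-- The inclusion of the hom object factors through itself, so `transparent_of_factors` applies to
it. After tensoring with z it is still monic and can be cancelled. -/
theorem SelfEnr.transparent_homSub (X Y : ZObj (selfEnr B)) (z : B) :
    (β_ ((X.homSub Y : Subobject _) : B) z).hom = (β_ z ((X.homSub Y : Subobject _) : B)).inv := by
  have := mono_whiskerLeft z (X.ι Y)
  rw [← cancel_mono (z ◁ X.ι Y)]
  exact transparent_of_factors (X.ι Y) (Subobject.factors_self _) z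

end CenterPoints

/-! ### Nondegeneracy and the identification of the hom objects with Hom(x, y)·1. -/

section Transparent

attribute [local instance] CategoryTheory.Abelian.hasFiniteBiproducts

variable {B : Type u} [Category.{v} B] [Abelian B] [Linear ℂ B] [MonoidalCategory B]
  [MonoidalPreadditive B] [MonoidalLinear ℂ B] [BraidedCategory B] [RigidCategory B] [IsFusion B]

/-- Trivial double braiding passes to retracts by naturality. It is applied to the simple summands
of a transparent object, and the conclusion has the form required by `IsNondegenerate`. -/
theorem transparent_retract {Z S : B} (hZ : ∀ z : B, (β_ Z z).hom = (β_ z Z).inv) (s : S ⟶ Z)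
    (r : Z ⟶ S) (h : s ≫ r = 𝟙 S) (z : B) : (β_ S z).hom ≫ (β_ z S).hom = 𝟙 (S ⊗ z) := by
  have e : (β_ S z).hom = (β_ z S).inv := by
    calc (β_ S z).hom = (s ≫ r) ▷ z ≫ (β_ S z).hom := by rw [h]; simp
      _ = s ▷ z ≫ (β_ z Z).inv ≫ z ◁ r := by
        rw [comp_whiskerRight, Category.assoc, BraidedCategory.braiding_naturality_left, hZ]
      _ = (s ≫ r) ▷ z ≫ (β_ z S).inv := by
        rw [← BraidedCategory.braiding_inv_naturality_left, comp_whiskerRight, Category.assoc]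
      _ = (β_ z S).inv := by rw [h]; simp
  rw [e, Iso.inv_hom_id]

/-- In a nondegenerate braided fusion category a transparent object is a sum of copies of the
tensor unit. -/
theorem splitGen_of_transparent (hB : IsNondegenerate B) {Z : B}
    (hZ : ∀ z : B, (β_ Z z).hom = (β_ z Z).inv) : SplitGen (fun p : 𝟙_ B ⟶ Z => p) := by
  obtain ⟨n, S, hS, ⟨e⟩⟩ := IsFusion.semisimple Z
  -- Each simple summand is a retract of Z, hence transparent, hence a copy of the unit. The
  -- inclusions of these copies are then the generating points.
  have j : ∀ i, Nonempty (S i ≅ 𝟙_ B) := fun i =>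
    hB (S i) (hS i) (transparent_retract hZ (biproduct.ι S i ≫ e.inv) (e.hom ≫ biproduct.π S i)
      (by simp))
  refine ⟨n, fun i => e.hom ≫ biproduct.π S i ≫ (j i).some.hom,
    fun i => (j i).some.inv ≫ biproduct.ι S i ≫ e.inv, ?_⟩
  simp only [Category.assoc, Iso.hom_inv_id_assoc]
  rw [← Preadditive.comp_sum]
  simp only [← Category.assoc]
  rw [← Preadditive.sum_comp, biproduct.total]
  simp

theorem finite_hom (X Y : B) : Module.Finite ℂ (X ⟶ Y) := IsFusion.finite_dim X Y

attribute [local instance] finite_hom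

namespace SelfEnr

/-- The hom object is transparent, hence generated by its points, and each point comes from a
morphism of B. Indexing by morphisms of B lets later identities be checked in B. -/
theorem splitGen_zName (hB : IsNondegenerate B) (X Y : ZObj (selfEnr B)) :
    SplitGen (fun f : base X ⟶ base Y => ECat.UHom.hom (zName (X := X) (Y := Y) f)) := by
  obtain ⟨n, q, p, h⟩ := splitGen_of_transparent hB (transparent_homSub X Y)
  choose f hf using fun i => exists_zName (X := X) (Y := Y) ⟨p i⟩
  refine ⟨n, q, f, ?_⟩
  rw [← h]
  exact Finset.sum_congr rfl fun i _ => congrArg (fun t => q i ≫ ECat.UHom.hom t) (hf i).symm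

theorem pointGenerated_zCat (hB : IsNondegenerate B) :
    (ZCat (selfEnr B)).PointGenerated := fun X Y => by
  obtain ⟨n, q, f, h⟩ := splitGen_zName hB X Y
  exact ⟨n, q, fun i => zName (f i), h⟩

/-- The point of the hom object of the center corresponding to a morphism of `B`, as a linear
map. -/
def zPoint (X Y : ZObj (selfEnr B)) :
    (base X ⟶ base Y) →ₗ[ℂ] (𝟙_ B ⟶ ((X.homSub Y : Subobject _) : B)) where
  toFun f := ECat.UHom.hom (zName (X := X) (Y := Y) f)
  map_add' f g := by
    rw [← cancel_mono (X.ι Y), Preadditive.add_comp, zName_ι, zName_ι, zName_ι]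
    exact (congrArg (fun t => η_ (base X) (base X)ᘁ ≫ t)
      (MonoidalPreadditive.add_whiskerRight f g)).trans (Preadditive.comp_add _ _ _ _ _ _)
  map_smul' c f := by
    rw [← cancel_mono (X.ι Y), RingHom.id_apply, Linear.smul_comp, zName_ι, zName_ι]
    exact (congrArg (fun t => η_ (base X) (base X)ᘁ ≫ t)
      (MonoidalLinear.smul_whiskerRight c f _)).trans (Linear.comp_smul _ _ _ _ _ _)

theorem zPoint_injective (X Y : ZObj (selfEnr B)) : Function.Injective (zPoint X Y) :=
  fun _ _ h => zName_injective (ECat.hom_ext (C := ZCat (selfEnr B)) _ _ h)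

/-- The comparison of the hom objects `Hom(x, y) · 𝟙` with those of the center. -/
def homMap (X Y : ZObj (selfEnr B)) :
    VecEnr.hom (base X) (base Y) ⟶ ((X.homSub Y : Subobject _) : B) :=
  vecDesc (zPoint X Y)

theorem pt_homMap {X Y : ZObj (selfEnr B)} (f : base X ⟶ base Y) :
    VecEnr.pt f ≫ homMap X Y = ECat.UHom.hom (zName (X := X) (Y := Y) f) :=
  vecPt_desc (zPoint X Y) f

/-- Both objects are generated by points indexed by Hom(x, y), and `homMap` matches the points.
Since End(1) = ℂ, coordinates on the center side are scalars, so linear relations can be compared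
through the injective linear map `zPoint`. -/
theorem isIso_homMap (hB : IsNondegenerate B) (X Y : ZObj (selfEnr B)) : IsIso (homMap X Y) := by
  obtain ⟨n, q, f, hq⟩ := splitGen_zName hB X Y
  -- The inverse is the splitting of the identity of the center's hom object, with each of its
  -- points replaced by the point of Hom(x, y)·1 with the same name.
  refine ⟨∑ j, q j ≫ VecEnr.pt (f j), (VecEnr.gen _ _).ext fun g => ?_, ?_⟩
  · have : Simple (𝟙_ B) := IsFusion.simple_unit
    -- Schur's lemma over ℂ for the simple unit: the j-th coordinate of the point g is a scalar.
    choose c hc using fun j => endomorphism_simple_eq_smul_id ℂ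
      (ECat.UHom.hom (zName (X := X) (Y := Y) g) ≫ q j)
    -- Expanding the point g by the splitting of the identity gives the same relation among points,
    -- which injectivity of `zPoint` brings back to morphisms of B.
    have hg : g = ∑ j, c j • f j := by
      apply zPoint_injective X Y
      have h := Category.comp_id (zPoint X Y g)
      rw [← hq, Preadditive.comp_sum] at h
      rw [← h, map_sum]
      refine Finset.sum_congr rfl fun j _ => ?_
      rw [map_smul, ← Category.assoc]
      refine (congrArg (fun t => t ≫ zPoint X Y (f j)) (hc j).symm).trans ?_
      rw [Linear.smul_comp, Category.id_comp]
    rw [← Category.assoc, pt_homMap, Preadditive.comp_sum, Category.comp_id]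
    refine Eq.trans ?_ (congrArg (vecPt B (base X ⟶ base Y)) hg).symm
    rw [map_sum]
    refine Finset.sum_congr rfl fun j _ => ?_
    rw [map_smul, ← Category.assoc, ← hc, Linear.smul_comp, Category.id_comp]
  · rw [Preadditive.sum_comp, ← hq]
    exact Finset.sum_congr rfl fun j _ => by rw [Category.assoc, pt_homMap]

end SelfEnr

end Transparent

/-! ### The comparison functors and the braided equivalence. -/

section Comparison

attribute [local instance] CategoryTheory.Abelian.hasFiniteBiproducts finite_hom

variable {B : Type u} [Category.{v} B] [Abelian B] [Linear ℂ B] [MonoidalCategory B]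
  [MonoidalPreadditive B] [MonoidalLinear ℂ B] [BraidedCategory B] [RigidCategory B] [IsFusion B]

open SelfEnr

theorem zName_homMap_inv (hB : IsNondegenerate B) {X Y : ZObj (selfEnr B)}
    (f : base X ⟶ base Y) :
    haveI := isIso_homMap hB X Y
    ECat.UHom.hom (zName (X := X) (Y := Y) f) ≫ inv (homMap X Y) = VecEnr.pt f := by
  have := isIso_homMap hB X Y
  rw [IsIso.comp_inv_eq, pt_homMap]

/-- The enriched functor from the center of the self-enrichment to `B` that forgets the
half-braidings. -/
abbrev centerToFusion (hB : IsNondegenerate B) :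
    EFunctor (ZCat (selfEnr B)) (VecEnr.eCat B) where
  obj X := ⟨base X⟩
  map X Y := haveI := isIso_homMap hB X Y; inv (homMap X Y)
  map_id X := (congrArg (fun t => ECat.UHom.hom t ≫ _) (zName_id X)).symm.trans
    (zName_homMap_inv hB (𝟙 (base X)))
  map_comp X Y Z := by
    -- Pairs of named points are jointly epic, and on such a pair both composition laws are
    -- composition in B.
    apply ((splitGen_zName hB Y Z).tensor (splitGen_zName hB X Y)).ext
    rintro ⟨g, f⟩
    dsimp only
    have h : ((λ_ (𝟙_ B)).inv ≫ (ECat.UHom.hom (zName (X := Y) (Y := Z) g) ⊗ₘ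
        ECat.UHom.hom (zName (X := X) (Y := Y) f))) ≫ (ZCat (selfEnr B)).comp X Y Z =
        ECat.UHom.hom (zName (X := X) (Y := Z) (f ≫ g)) :=
      (Category.assoc _ _ _).trans (congrArg ECat.UHom.hom (zName_comp f g))
    rw [← Category.assoc, h, zName_homMap_inv hB, ← Category.assoc, Category.assoc _ (_ ⊗ₘ _) (_ ⊗ₘ _),
      tensorHom_comp_tensorHom, zName_homMap_inv hB, zName_homMap_inv hB, VecEnr.comp_pt]

/-- The enriched functor from `B` to the center of the self-enrichment given by the braiding. -/
abbrev fusionToCenter (B : Type u) [Category.{v} B] [Abelian B] [Linear ℂ B] [MonoidalCategory B]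
    [MonoidalPreadditive B] [MonoidalLinear ℂ B] [BraidedCategory B] [RigidCategory B]
    [IsFusion B] : EFunctor (VecEnr.eCat B) (ZCat (selfEnr B)) where
  obj x := zOf x.of
  map x y := homMap (zOf x.of) (zOf y.of)
  map_id x := (pt_homMap (X := zOf x.of) (Y := zOf x.of) (𝟙 x.of)).trans
    (congrArg ECat.UHom.hom (zName_id (zOf x.of)))
  map_comp x y z := by
    apply ((VecEnr.gen y.of z.of).tensor (VecEnr.gen x.of y.of)).ext
    rintro ⟨g, f⟩
    dsimp only
    have e₁ := pt_homMap (X := zOf y.of) (Y := zOf z.of) g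
    have e₂ := pt_homMap (X := zOf x.of) (Y := zOf y.of) f
    rw [← Category.assoc, ← Category.assoc, Category.assoc _ (_ ⊗ₘ _) (_ ⊗ₘ _),
      tensorHom_comp_tensorHom]
    refine (congrArg (fun t => t ≫ homMap (zOf x.of) (zOf z.of)) (VecEnr.comp_pt f g)).trans ?_
    refine (pt_homMap (X := zOf x.of) (Y := zOf z.of) (f ≫ g)).trans ?_
    refine Eq.trans ?_ (congrArg₂ (fun s t => ((λ_ (𝟙_ B)).inv ≫ (s ⊗ₘ t)) ≫
      (ZCat (selfEnr B)).comp (zOf x.of) (zOf y.of) (zOf z.of)) e₁ e₂).symm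
    exact (congrArg ECat.UHom.hom (zName_comp (X := zOf x.of) (Y := zOf y.of) (Z := zOf z.of)
      f g)).symm.trans (Category.assoc _ _ _).symm

/-- On underlying categories the functor keeps the name of a morphism. With `exists_zName` this
reduces every coherence condition for it to an identity in B. -/
theorem centerToFusion_map (hB : IsNondegenerate B) {X Y : ZObj (selfEnr B)}
    (f : base X ⟶ base Y) : (centerToFusion hB).und.map (zName (X := X) (Y := Y) f) =
      VecEnr.name (x := ⟨base X⟩) (y := ⟨base Y⟩) f :=
  ECat.hom_ext (C := VecEnr.eCat B) _ _ (zName_homMap_inv hB f)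

theorem fusionToCenter_map {x y : VObj B} (f : x.of ⟶ y.of) :
    (fusionToCenter B).und.map (VecEnr.name f) = zName (X := zOf x.of) (Y := zOf y.of) f :=
  ECat.hom_ext (C := ZCat (selfEnr B)) _ _ (pt_homMap (X := zOf x.of) (Y := zOf y.of) f)

/-- Strict compatibility with tensor products of morphisms: on both sides the tensor product of
named morphisms is named by their tensor product in B. -/
theorem centerToFusion_map₂ (hB : IsNondegenerate B) {X X' Y Y' : ZObj (selfEnr B)}
    (f : X ⟶ X') (g : Y ⟶ Y') :
    (VecEnr.tensor B).map₂ ((centerToFusion hB).und.map f) ((centerToFusion hB).und.map g) =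
      (centerToFusion hB).und.map ((zTensor (selfEnr B)).map₂ f g) := by
  obtain ⟨f, rfl⟩ := exists_zName f
  obtain ⟨g, rfl⟩ := exists_zName g
  have e := congrArg (centerToFusion hB).und.map (tensorHom_zName (X := X) (X' := X') (Y := Y)
    (Y' := Y') f g)
  have e' := centerToFusion_map hB (X := X.tensor Y) (Y := X'.tensor Y') (f ⊗ₘ g)
  have e'' := VecEnr.map₂_name (x := ⟨base X⟩) (x' := ⟨base X'⟩) (y := ⟨base Y⟩)
    (y' := ⟨base Y'⟩) f g
  rw [centerToFusion_map, centerToFusion_map]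
  exact e''.trans (e'.symm.trans e.symm)

theorem centerToFusion_whiskerRight (hB : IsNondegenerate B) {X X' : ZObj (selfEnr B)}
    (f : X ⟶ X') (Y : ZObj (selfEnr B)) :
    (VecEnr.tensor B).map₂ ((centerToFusion hB).und.map f) (𝟙 (⟨base Y⟩ : VObj B)) =
      (centerToFusion hB).und.map ((zTensor (selfEnr B)).map₂ f (𝟙 Y)) := by
  rw [← centerToFusion_map₂, CategoryTheory.Functor.map_id]

theorem centerToFusion_whiskerLeft (hB : IsNondegenerate B) (X : ZObj (selfEnr B))
    {Y Y' : ZObj (selfEnr B)} (g : Y ⟶ Y') :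
    (VecEnr.tensor B).map₂ (𝟙 (⟨base X⟩ : VObj B)) ((centerToFusion hB).und.map g) =
      (centerToFusion hB).und.map ((zTensor (selfEnr B)).map₂ (𝟙 X) g) := by
  rw [← centerToFusion_map₂, CategoryTheory.Functor.map_id]

theorem centerToFusion_associator (hB : IsNondegenerate B) (X Y Z : ZObj (selfEnr B)) :
    (centerToFusion hB).und.map (zAssociator X Y Z).hom =
      VecEnr.name (x := ⟨(base X ⊗ base Y) ⊗ base Z⟩) (y := ⟨base X ⊗ (base Y ⊗ base Z)⟩)
        (α_ (base X) (base Y) (base Z)).hom :=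
  (congrArg (centerToFusion hB).und.map (eq_zName (zForget_associator X Y Z))).trans
    (centerToFusion_map hB (X := (X.tensor Y).tensor Z) (Y := X.tensor (Y.tensor Z))
      (α_ (base X) (base Y) (base Z)).hom)

theorem centerToFusion_leftUnitor (hB : IsNondegenerate B) (X : ZObj (selfEnr B)) :
    (centerToFusion hB).und.map (zLeftUnitor X).hom =
      VecEnr.name (x := ⟨𝟙_ B ⊗ base X⟩) (y := ⟨base X⟩) (λ_ (base X)).hom :=
  (congrArg (centerToFusion hB).und.map (eq_zName (zForget_leftUnitor X))).trans
    (centerToFusion_map hB (X := (ZObj.unit (selfEnr B)).tensor X) (Y := X)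
      (λ_ (base X)).hom)

theorem centerToFusion_rightUnitor (hB : IsNondegenerate B) (X : ZObj (selfEnr B)) :
    (centerToFusion hB).und.map (zRightUnitor X).hom =
      VecEnr.name (x := ⟨base X ⊗ 𝟙_ B⟩) (y := ⟨base X⟩) (ρ_ (base X)).hom :=
  (congrArg (centerToFusion hB).und.map (eq_zName (zForget_rightUnitor X))).trans
    (centerToFusion_map hB (X := X.tensor (ZObj.unit (selfEnr B))) (Y := X)
      (ρ_ (base X)).hom)

theorem centerToFusion_braiding (hB : IsNondegenerate B) (X Y : ZObj (selfEnr B)) :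
    (centerToFusion hB).und.map (zBraiding (selfEnr B) X Y).hom =
      VecEnr.name (x := ⟨base X ⊗ base Y⟩) (y := ⟨base Y ⊗ base X⟩)
        (β_ (base X) (base Y)).hom :=
  (congrArg (centerToFusion hB).und.map (zBraiding_eq X Y)).trans
    (centerToFusion_map hB (X := X.tensor Y) (Y := Y.tensor X) (β_ (base X) (base Y)).hom)

/-- `centerToFusion` as an enriched functor between the enriched braided monoidal categories. -/
abbrev comparison (hB : IsNondegenerate B) :
    EFunctor (center (selfEnr B)).toECat (fusionEnr B).toECat := centerToFusion hB

/-- The functor `comparison` is strictly monoidal. -/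
def comparisonCoreMonoidal (hB : IsNondegenerate B) : (comparison hB).und.CoreMonoidal where
  εIso := Iso.refl (𝟙_ (fusionEnr B).Obj)
  -- The object underlying a tensor product in the center is by definition the tensor product in B,
  -- so identities serve as comparison maps. The axioms then say only that the unitors and
  -- associators correspond.
  μIso X Y := Iso.refl ((comparison hB).obj X ⊗ (comparison hB).obj Y : (fusionEnr B).Obj)
  μIso_hom_natural_left f X := (Category.comp_id _).trans
    ((centerToFusion_whiskerRight hB f X).trans (Category.id_comp _).symm)
  μIso_hom_natural_right X f := (Category.comp_id _).trans
    ((centerToFusion_whiskerLeft hB X f).trans (Category.id_comp _).symm)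
  associativity X Y Z := by
    have h₁ := id_whiskerRight (C := (fusionEnr B).Obj)
      ((comparison hB).obj X ⊗ (comparison hB).obj Y) ((comparison hB).obj Z)
    have h₂ := MonoidalCategory.whiskerLeft_id (C := (fusionEnr B).Obj)
      ((comparison hB).obj X) ((comparison hB).obj Y ⊗ (comparison hB).obj Z)
    refine (congrArg (fun t => t ≫ _) h₁).trans ((Category.id_comp _).trans
      ((Category.id_comp _).trans ((centerToFusion_associator hB X Y Z).trans ?_)))
    refine Eq.trans ?_ (congrArg (fun t => _ ≫ t ≫ _) h₂).symm
    exact (congrArg (fun t => _ ≫ t) (Category.id_comp _)).trans (Category.comp_id _) |>.symm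
  left_unitality X := by
    have h := id_whiskerRight (C := (fusionEnr B).Obj) (𝟙_ (fusionEnr B).Obj)
      ((comparison hB).obj X)
    refine Eq.trans ?_ (congrArg (fun t => t ≫ _) h).symm
    exact ((Category.id_comp _).trans ((Category.id_comp _).trans
      (centerToFusion_leftUnitor hB X))).symm
  right_unitality X := by
    have h := MonoidalCategory.whiskerLeft_id (C := (fusionEnr B).Obj) ((comparison hB).obj X)
      (𝟙_ (fusionEnr B).Obj)
    refine Eq.trans ?_ (congrArg (fun t => t ≫ _) h).symm
    exact ((Category.id_comp _).trans ((Category.id_comp _).trans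
      (centerToFusion_rightUnitor hB X))).symm

/-- The functor `comparison` is braided. -/
@[reducible]
def comparisonBraided (hB : IsNondegenerate B) : (comparison hB).und.Braided where
  toMonoidal := (comparisonCoreMonoidal hB).toMonoidal
  braided X Y := (Category.id_comp _).trans
    ((centerToFusion_braiding hB X Y).trans (Category.comp_id _).symm)

/-- The identity of the underlying object identifies an object of the center with the object of `B`
equipped with its braiding. -/
def comparisonUnit (hB : IsNondegenerate B) :
    𝟭 (ZObj (selfEnr B)) ≅ (centerToFusion hB).und ⋙ (fusionToCenter B).und :=
  -- The identity of the underlying object is a morphism of the center whatever the given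
  -- half-braiding, since that half-braiding is the braiding.
  NatIso.ofComponents (fun X => zNameIso (X := X) (Y := zOf (base X)) (Iso.refl (base X)))
    (fun {X Y} f => by
      obtain ⟨f, rfl⟩ := exists_zName f
      rw [Functor.comp_map, centerToFusion_map, fusionToCenter_map]
      refine (zName_comp (X := X) (Y := Y) (Z := zOf (base Y)) f (𝟙 (base Y))).trans
        (Eq.trans ?_ (zName_comp (X := X) (Y := zOf (base X)) (Z := zOf (base Y)) (𝟙 (base X))
          f).symm)
      exact congrArg (zName (X := X) (Y := zOf (base Y)))
        ((Category.comp_id f).trans (Category.id_comp f).symm))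

/-- A point of Hom(x, y)·1 is carried by the isomorphism `homMap` to a point of the center's hom
object, which is known to come from a morphism of B. -/
theorem exists_vecName (hB : IsNondegenerate B) {x y : VObj B} (f : x ⟶ y) :
    ∃ g : x.of ⟶ y.of, f = VecEnr.name g := by
  obtain ⟨g, hg⟩ := exists_zName ((fusionToCenter B).und.map f)
  refine ⟨g, ECat.hom_ext (C := VecEnr.eCat B) _ _ ?_⟩
  have := isIso_homMap hB (zOf x.of) (zOf y.of)
  refine (cancel_mono (homMap (zOf x.of) (zOf y.of))).1 ?_
  exact (congrArg ECat.UHom.hom hg).trans (pt_homMap (X := zOf x.of) (Y := zOf y.of) g).symm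

/-- The composite on `B` is the identity. -/
def comparisonCounit (hB : IsNondegenerate B) :
    (fusionToCenter B).und ⋙ (centerToFusion hB).und ≅ 𝟭 (VObj B) :=
  NatIso.ofComponents (fun x => VecEnr.nameIso (x := ⟨x.of⟩) (y := x) (Iso.refl x.of))
    (fun {x y} f => by
      obtain ⟨f, rfl⟩ := exists_vecName hB f
      rw [Functor.comp_map, fusionToCenter_map]
      refine (congrArg (fun t => t ≫ _)
        (centerToFusion_map hB (X := zOf x.of) (Y := zOf y.of) f)).trans ?_
      exact (VecEnr.name_comp f (𝟙 y.of)).trans ((congrArg _ ((Category.comp_id f).trans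
        (Category.id_comp f).symm)).trans (VecEnr.name_comp (𝟙 x.of) f).symm))

/-- Both the unit and the counit have components named by identities of B. -/
theorem comparison_triangle (hB : IsNondegenerate B) (X : ZObj (selfEnr B)) :
    (centerToFusion hB).und.map ((comparisonUnit hB).hom.app X) ≫
      (comparisonCounit hB).hom.app ((centerToFusion hB).obj X) =
        𝟙 ((centerToFusion hB).obj X) := by
  refine (congrArg (fun t => t ≫ _)
    (centerToFusion_map hB (X := X) (Y := zOf (base X)) (𝟙 (base X)))).trans ?_
  refine (VecEnr.name_comp (x := ⟨base X⟩) (y := ⟨base X⟩) (z := ⟨base X⟩) (𝟙 (base X))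
    (𝟙 (base X))).trans ?_
  rw [Category.comp_id]
  rfl

theorem pointGenerated_vecEnr : (VecEnr.eCat B).PointGenerated := fun x y => by
  obtain ⟨n, q, f, h⟩ := VecEnr.gen x.of y.of
  exact ⟨n, q, fun i => VecEnr.name (f i), h⟩

/-- The Drinfeld center of the self-enrichment of a nondegenerate braided fusion category `B` is
equivalent to `B`. -/
def centerSelfEnrEquiv (hB : IsNondegenerate B) :
    EBraidedEquiv (center (selfEnr B)) (fusionEnr B) :=
  EBraidedEquiv.ofPointGenerated (C := center (selfEnr B)) (D := fusionEnr B)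
    (pointGenerated_zCat hB) pointGenerated_vecEnr (comparison hB) (fusionToCenter B)
    (comparisonBraided hB) (comparisonUnit hB) (comparisonCounit hB) (comparison_triangle hB)

end Comparison

end EnrichedCenter

end

theorem mainTheorem1 {B : Type u} [Category.{v} B] [Abelian B] [Linear ℂ B] [MonoidalCategory B]
    [MonoidalPreadditive B] [MonoidalLinear ℂ B] [BraidedCategory B] [RigidCategory B]
    [EnrichedCenter.IsFusion B] (hB : EnrichedCenter.IsNondegenerate B) :
    Nonempty (EnrichedCenter.EBraidedEquiv (EnrichedCenter.center (EnrichedCenter.selfEnr B))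
      (EnrichedCenter.fusionEnr B)) :=
  ⟨EnrichedCenter.centerSelfEnrEquiv hB⟩
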